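/- Let $X$ be a path-connected CW complex of finite type, that is, a path-connected CW complex with only finitely many cells in each dimension. For a field $\Bbbk$ let $\dim_{\Bbbk}\widetilde H^*(X;\Bbbk)$ denote the total dimension $\dim_{\Bbbk}\bigoplus_{n\ge 0}\widetilde H^n(X;\Bbbk)$ of the reduced (singular) cohomology of $X$ with coefficients in $\Bbbk$. Suppose that $\dim_{\Bbbk}\widetilde H^*(X;\Bbbk)\le 1$ for every field $\Bbbk$. Then either $X$ is acyclic, i.e. its reduced integral homology $\widetilde H_n(X;\mathbb Z)$ vanishes for all $n$, or $X$ is an integral homology sphere, i.e. there is an $n\ge 1$ such that $H_i(X;\mathbb Z)\cong H_i(S^n;\mathbb Z)$ for all $i\ge 0$. (No manifold structure on $X$ is assumed.) -/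

import Mathlib

universe u v

noncomputable section

open CategoryTheory AlgebraicTopology
open scoped Simplicial DirectSum

/-- The integral singular homology group `H_n(X) = H_n(X; ℤ)`. -/
def integralHomology (n : ℕ) (X : TopCat.{u}) : ModuleCat.{u} ℤ :=
  ((singularHomologyFunctor (ModuleCat.{u} ℤ) n).obj (ModuleCat.of ℤ (ULift.{u} ℤ))).obj X

/-- The homomorphism `H_n(X) → H_n(Y)` induced by a continuous map `X → Y`. -/
def integralHomologyMap (n : ℕ) {X Y : TopCat.{u}} (f : X ⟶ Y) :
    integralHomology n X ⟶ integralHomology n Y :=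
  ((singularHomologyFunctor (ModuleCat.{u} ℤ) n).obj (ModuleCat.of ℤ (ULift.{u} ℤ))).map f

/-- The reduced integral homology of a nonempty space `X` in degree `n`: the kernel of
`H_n(X) → H_n(pt)`. -/
def reducedIntegralHomology (n : ℕ) (X : TopCat.{u}) : Submodule ℤ (integralHomology n X) :=
  LinearMap.ker (integralHomologyMap n
    (TopCat.ofHom (ContinuousMap.const X PUnit.unit) : X ⟶ TopCat.of PUnit.{u + 1})).hom

/-- A space is acyclic if it is nonempty and its reduced integral homology vanishes in every
degree. -/
def IsAcyclicSpace (X : Type u) [TopologicalSpace X] : Prop :=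
  Nonempty X ∧ ∀ n : ℕ, reducedIntegralHomology n (TopCat.of X) = ⊥

/-- A space is an integral homology sphere if, for some `n ≥ 1`, its integral homology is
isomorphic, degree by degree, to that of the sphere `Sⁿ`. -/
def IsIntegralHomologySphere (X : Type u) [TopologicalSpace X] : Prop :=
  ∃ n : ℕ, 1 ≤ n ∧ ∀ i : ℕ,
    Nonempty (integralHomology i (TopCat.of X) ≃+ integralHomology i (TopCat.sphere.{u} n))

section Cohomology

variable (k : Type v) [Field k] (X : Type u) [TopologicalSpace X]

/-- The singular `n`-cochains of `X` with coefficients in `k`: the functions on the set of singular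
`n`-simplices of `X`. -/
abbrev SingularCochain (n : ℕ) : Type (max u v) :=
  (TopCat.toSSet.obj (TopCat.of X)) _⦋n⦌ → k

/-- The coboundary `(δ φ)(σ) = ∑ᵢ (-1)ⁱ φ(dᵢ σ)`, where `dᵢ σ` is the `i`-th face of the singular
simplex `σ`. -/
def singularCoboundary (n : ℕ) : SingularCochain k X n →ₗ[k] SingularCochain k X (n + 1) where
  toFun φ σ := ∑ i : Fin (n + 2), (-1 : k) ^ (i : ℕ) *
    φ ((TopCat.toSSet.obj (TopCat.of X)).δ i σ)
  map_add' φ ψ := by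
    funext σ
    simp [mul_add, Finset.sum_add_distrib]
  map_smul' c φ := by
    funext σ
    simp [Finset.mul_sum, mul_left_comm]

/-- The dual of the augmentation: it sends `c : k` to the constant `0`-cochain `c`. -/
def cochainAugmentation : k →ₗ[k] SingularCochain k X 0 where
  toFun c _ := c
  map_add' _ _ := rfl
  map_smul' _ _ := rfl

/-- The `n`-coboundaries of the augmented cochain complex `k → C⁰(X; k) → C¹(X; k) → ⋯`. -/
def reducedCoboundaries (n : ℕ) : Submodule k (SingularCochain k X n) :=
  match n with
  | 0 => LinearMap.range (cochainAugmentation k X)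
  | m + 1 => LinearMap.range (singularCoboundary k X m)

/-- Coboundaries are cocycles, i.e. the augmented cochain sequence is a complex. -/
theorem reducedCoboundaries_le_ker (n : ℕ) :
    reducedCoboundaries k X n ≤ LinearMap.ker (singularCoboundary k X n) := by
  cases n with
  | zero =>
    rintro _ ⟨c, rfl⟩
    rw [LinearMap.mem_ker]
    funext σ
    simp [singularCoboundary, cochainAugmentation, Fin.sum_univ_two]
  | succ m =>
    rintro _ ⟨φ, rfl⟩
    rw [LinearMap.mem_ker]
    funext σ
    simp only [singularCoboundary, LinearMap.coe_mk, AddHom.coe_mk, Finset.mul_sum, Pi.zero_apply]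
    rw [← Finset.sum_product', Finset.univ_product_univ]
    let P := Fin (m + 3) × Fin (m + 2)
    let S : Finset P := Finset.univ.filter fun ij => (ij.1 : ℕ) ≤ (ij.2 : ℕ)
    rw [← Finset.sum_add_sum_compl S, ← eq_neg_iff_add_eq_zero, ← Finset.sum_neg_distrib]
    let g : ∀ ij : P, ij ∈ S → P := fun ij hij =>
      (Fin.succ ij.2, ij.1.castLT (lt_of_le_of_lt (Finset.mem_filter.mp hij).right ij.2.isLt))
    refine Finset.sum_bij g ?_ ?_ ?_ ?_
    · intro ij hij
      simp only [S, Finset.mem_compl, Finset.mem_filter_univ, g, Fin.val_succ,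
        Fin.val_castLT] at hij ⊢
      omega
    · rintro ⟨i, j⟩ hij ⟨i', j'⟩ hij' h
      have h1 := Fin.succ_injective _ (congrArg Prod.fst h)
      have h2 := congrArg (fun q : P => (q.2 : ℕ)) h
      exact Prod.ext (Fin.ext h2) h1
    · rintro ⟨i', j'⟩ hij'
      simp only [S, Finset.mem_compl, Finset.mem_filter_univ, not_le] at hij'
      refine ⟨(Fin.castSucc j', i'.pred ?_), ?_, ?_⟩
      · rintro rfl
        simp at hij'
      · simpa [S] using Nat.le_sub_one_of_lt hij'
      · simp [g]
    · rintro ⟨i, j⟩ hij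
      have H : i ≤ Fin.castSucc j := (Finset.mem_filter.mp hij).2
      have h := SSet.δ_comp_δ''_apply H σ
      simp only [g, h, Fin.val_succ, Fin.val_castLT]
      ring

/-- The reduced singular cohomology of a nonempty space `X` in degree `n` with coefficients
in `k`: cocycles modulo coboundaries in the augmented cochain complex. (For nonempty `X` the
augmentation is injective, so there is no cohomology in degree `-1`.) -/
abbrev ReducedCohomology (n : ℕ) : Type (max u v) :=
  LinearMap.ker (singularCoboundary k X n) ⧸
    (reducedCoboundaries k X n).submoduleOf (LinearMap.ker (singularCoboundary k X n))

/-- The total dimension over `k` of the graded vector space `H̃^*(X; k)`, as a cardinal. -/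
def reducedCohomologyDim : Cardinal.{max u v} :=
  Module.rank k (⨁ n : ℕ, ReducedCohomology k X n)

end Cohomology

end

/-! The universal coefficient theorem says that H^n(X; F_p) is built from Hom(H_n(X), F_p) and
Ext(H_{n-1}(X), F_p). Finite type makes every H_n(X) finitely generated. If some H_n(X) with n ≥ 1
had p-torsion, it would surject onto Z/p and so give a class in H^n(X; F_p), and the torsion itself
would give an Ext class in H^{n+1}(X; F_p). The total dimension over F_p would be at least two.
Hence all homology in positive degrees is free. Coordinate functions of a basis, reduced mod 2, are
independent classes in H^*(X; F_2), so the total rank in positive degrees is at most one. Rank zero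
means acyclic, rank one means homology sphere. Only the two halves of universal coefficients used
here are proved (`exists_cohomology_of_linearMap`, `nontrivial_cohomology_of_torsion`); they feed
`isTorsionFree_homology`, `eq_of_nontrivial_homology` and `nonempty_homology_equiv_of_nontrivial`.

The bulk of the work is the topological input: finite generation of H_n(X) and the homology of
spheres. Both rest on a hands-on theory of singular chains. Operations (subdivision, prisms) are
built by coning on tuples of vertices, carried to singular simplices by naturality, and give
homotopy invariance and Mayer–Vietoris (`IsOpenUnion.exists_connecting`). Punctured Euclidean spaces
follow by suspension (`homology_compl_zero`). Attaching an m-cell preserves finite generation, and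
in degrees other than m the homology of the smaller space surjects onto that of the larger.
Compactness reduces the whole complex to its skeleta.

Chains are augmented and indexed by the number of vertices: index k is degree k - 1, the empty
simplex sits in index 0, and `Homology (n + 2)` is H_{n+1}. The fields are `ULift (ZMod p)`, so that
they live in the universe of the hypothesis. -/

noncomputable section

universe u₁ u₂ u₃

/-! ### Augmented chain complexes of semi-simplicial sets -/

/-- An augmented semi-simplicial set, indexed by the number of vertices of a simplex. -/
structure FaceSystem where
  simplex : ℕ → Type u
  face : ∀ {k : ℕ}, Fin (k + 1) → simplex (k + 1) → simplex k
  face_face : ∀ {k : ℕ} {i j : Fin (k + 1)}, i ≤ j → ∀ x : simplex (k + 2),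
    face i (face j.succ x) = face j (face i.castSucc x)

namespace FaceSystem

variable (A : FaceSystem.{u₁}) (B : FaceSystem.{u₂}) (C : FaceSystem.{u₃})

/-- Integral chains spanned by the simplices with `k` vertices. -/
abbrev Chain (k : ℕ) : Type u₁ := A.simplex k →₀ ℤ

/-- The alternating sum of the faces. -/
def d (k : ℕ) : A.Chain (k + 1) →ₗ[ℤ] A.Chain k :=
  Finsupp.linearCombination ℤ fun x =>
    ∑ i : Fin (k + 1), (-1 : ℤ) ^ (i : ℕ) • Finsupp.single (A.face i x) 1

@[simp]
theorem d_single (k : ℕ) (x : A.simplex (k + 1)) : A.d k (Finsupp.single x 1) =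
    ∑ i : Fin (k + 1), (-1 : ℤ) ^ (i : ℕ) • Finsupp.single (A.face i x) 1 := by
  simp [d]

theorem d_d (k : ℕ) (x : A.Chain (k + 2)) : A.d k (A.d (k + 1) x) = 0 := by
  suffices (A.d k).comp (A.d (k + 1)) = 0 from LinearMap.congr_fun this x
  refine Finsupp.lhom_ext' fun σ => LinearMap.ext_ring ?_
  simp only [LinearMap.comp_apply, Finsupp.lsingle_apply, d_single, map_sum, map_smul,
    Finset.smul_sum, LinearMap.zero_apply]
  rw [← Finset.sum_product', Finset.univ_product_univ]
  let P := Fin (k + 2) × Fin (k + 1)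
  let S : Finset P := Finset.univ.filter fun ij => (ij.1 : ℕ) ≤ (ij.2 : ℕ)
  rw [← Finset.sum_add_sum_compl S, ← eq_neg_iff_add_eq_zero, ← Finset.sum_neg_distrib]
  -- The face identity pairs (i, j) with i ≤ j against (j + 1, i), which has i < j + 1; the two
  -- terms carry opposite signs.
  let g : ∀ ij : P, ij ∈ S → P := fun ij hij =>
    (Fin.succ ij.2, ij.1.castLT (lt_of_le_of_lt (Finset.mem_filter.mp hij).right ij.2.isLt))
  refine Finset.sum_bij g ?_ ?_ ?_ ?_
  · intro ij hij
    simp only [S, Finset.mem_compl, Finset.mem_filter_univ, g, Fin.val_succ,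
      Fin.val_castLT] at hij ⊢
    omega
  · rintro ⟨i, j⟩ hij ⟨i', j'⟩ hij' h
    have h1 := Fin.succ_injective _ (congrArg Prod.fst h)
    have h2 := congrArg (fun q : P => (q.2 : ℕ)) h
    exact Prod.ext (Fin.ext h2) h1
  · rintro ⟨i', j'⟩ hij'
    simp only [S, Finset.mem_compl, Finset.mem_filter_univ, not_le] at hij'
    refine ⟨(Fin.castSucc j', i'.pred ?_), ?_, ?_⟩
    · rintro rfl
      simp at hij'
    · simpa [S] using Nat.le_sub_one_of_lt hij'
    · simp [g]
  · rintro ⟨i, j⟩ hij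
    have H : (i : ℕ) ≤ j := (Finset.mem_filter.mp hij).2
    have h := A.face_face (i := i.castLT (lt_of_le_of_lt H j.isLt)) (j := j) H σ
    simp only [Fin.castSucc_castLT] at h
    simp only [g, h, Fin.val_succ, Fin.val_castLT, smul_smul, ← neg_smul]
    congr 1
    ring

/-- The boundary with target in degree `k - 1`, which is zero for `k = 0`. -/
def dFrom (k : ℕ) : A.Chain k →ₗ[ℤ] A.Chain (k - 1) :=
  match k with
  | 0 => 0
  | k + 1 => A.d k

@[simp] theorem dFrom_zero : A.dFrom 0 = 0 := rfl

@[simp] theorem dFrom_succ (k : ℕ) : A.dFrom (k + 1) = A.d k := rfl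

@[simp] theorem dFrom_d (k : ℕ) (x : A.Chain (k + 1)) : A.dFrom k (A.d k x) = 0 := by
  cases k with
  | zero => rfl
  | succ k => exact A.d_d k x

/-- The cycles. -/
def cycles (k : ℕ) : Submodule ℤ (A.Chain k) := LinearMap.ker (A.dFrom k)

theorem mem_cycles {k : ℕ} {x : A.Chain k} : x ∈ A.cycles k ↔ A.dFrom k x = 0 := Iff.rfl

/-- The homology in the degree of the simplices with `k` vertices. -/
def Homology (k : ℕ) : Type u₁ :=
  A.cycles k ⧸ (LinearMap.range (A.d k)).submoduleOf (A.cycles k)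

instance (k : ℕ) : AddCommGroup (A.Homology k) := inferInstanceAs (AddCommGroup (_ ⧸ _))

instance (k : ℕ) : Module ℤ (A.Homology k) := inferInstanceAs (Module ℤ (_ ⧸ _))

/-- The homology class of a cycle. -/
def toHomology (k : ℕ) : A.cycles k →ₗ[ℤ] A.Homology k :=
  Submodule.mkQ ((LinearMap.range (A.d k)).submoduleOf (A.cycles k))

theorem toHomology_surjective (k : ℕ) : Function.Surjective (A.toHomology k) :=
  Submodule.mkQ_surjective _

theorem toHomology_eq_zero {k : ℕ} {z : A.cycles k} :
    A.toHomology k z = 0 ↔ ∃ w, A.d k w = z :=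
  Submodule.Quotient.mk_eq_zero _

theorem toHomology_eq_iff {k : ℕ} {z z' : A.cycles k} :
    A.toHomology k z = A.toHomology k z' ↔ ∃ w, A.d k w = z - z' := by
  rw [← sub_eq_zero, ← map_sub, toHomology_eq_zero]
  rfl

theorem exists_toHomology_eq {k : ℕ} (h : A.Homology k) :
    ∃ (z : A.Chain k) (hz : z ∈ A.cycles k), A.toHomology k ⟨z, hz⟩ = h := by
  obtain ⟨⟨z, hz⟩, rfl⟩ := A.toHomology_surjective k h
  exact ⟨z, hz, rfl⟩

theorem subsingleton_homology_iff {k : ℕ} :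
    Subsingleton (A.Homology k) ↔ ∀ z ∈ A.cycles k, ∃ w, A.d k w = z := by
  refine ⟨fun h z hz => (A.toHomology_eq_zero (z := ⟨z, hz⟩)).1 (Subsingleton.elim _ _),
    fun h => ⟨fun a b => ?_⟩⟩
  obtain ⟨a, ha, rfl⟩ := A.exists_toHomology_eq a
  obtain ⟨b, hb, rfl⟩ := A.exists_toHomology_eq b
  exact A.toHomology_eq_iff.2 (h _ (sub_mem ha hb))

variable {A B C}

/-- A degreewise map commuting with the faces. -/
structure Hom (A : FaceSystem.{u₁}) (B : FaceSystem.{u₂}) where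
  toFun : ∀ k, A.simplex k → B.simplex k
  face_toFun : ∀ {k} (i : Fin (k + 1)) (x : A.simplex (k + 1)),
    B.face i (toFun (k + 1) x) = toFun k (A.face i x)

namespace Hom

variable (f : Hom A B) (g : Hom B C)

/-- The induced map on chains. -/
def chainMap (k : ℕ) : A.Chain k →ₗ[ℤ] B.Chain k := Finsupp.lmapDomain ℤ ℤ (f.toFun k)

@[simp]
theorem chainMap_single (k : ℕ) (x : A.simplex k) (n : ℤ) :
    f.chainMap k (Finsupp.single x n) = Finsupp.single (f.toFun k x) n := by
  simp [chainMap]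

theorem d_chainMap (k : ℕ) (x : A.Chain (k + 1)) :
    B.d k (f.chainMap (k + 1) x) = f.chainMap k (A.d k x) := by
  suffices (B.d k).comp (f.chainMap (k + 1)) = (f.chainMap k).comp (A.d k) from
    LinearMap.congr_fun this x
  refine Finsupp.lhom_ext' fun σ => LinearMap.ext_ring ?_
  simp [f.face_toFun]

theorem dFrom_chainMap (k : ℕ) (x : A.Chain k) :
    B.dFrom k (f.chainMap k x) = f.chainMap (k - 1) (A.dFrom k x) := by
  cases k with
  | zero => simp
  | succ k => exact f.d_chainMap k x

theorem chainMap_mem_cycles {k : ℕ} {x : A.Chain k} (hx : x ∈ A.cycles k) :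
    f.chainMap k x ∈ B.cycles k := by
  rw [mem_cycles] at hx ⊢
  rw [f.dFrom_chainMap, hx, map_zero]

theorem mem_cycles_of_chainMap {k : ℕ} (hf : ∀ k, Function.Injective (f.toFun k)) {x : A.Chain k}
    (hx : f.chainMap k x ∈ B.cycles k) : x ∈ A.cycles k := by
  rw [mem_cycles, f.dFrom_chainMap] at hx
  exact (map_eq_zero_iff _ (Finsupp.mapDomain_injective (hf _))).1 hx

/-- The induced map on homology. -/
def homologyMap (k : ℕ) : A.Homology k →ₗ[ℤ] B.Homology k :=
  Submodule.mapQ _ _ ((f.chainMap k).restrict fun _ hx => f.chainMap_mem_cycles hx) <| by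
    rintro ⟨_, hx⟩ ⟨w, rfl⟩
    exact ⟨f.chainMap _ w, f.d_chainMap _ _⟩

theorem homologyMap_toHomology (k : ℕ) (x : A.Chain k) (hx : x ∈ A.cycles k) :
    f.homologyMap k (A.toHomology k ⟨x, hx⟩) =
      B.toHomology k ⟨f.chainMap k x, f.chainMap_mem_cycles hx⟩ := rfl

theorem homologyMap_eq_zero_iff (k : ℕ) (x : A.Chain k) (hx : x ∈ A.cycles k) :
    f.homologyMap k (A.toHomology k ⟨x, hx⟩) = 0 ↔ ∃ w, B.d k w = f.chainMap k x := by
  rw [homologyMap_toHomology, toHomology_eq_zero]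

/-- The composition. -/
def comp : Hom A C where
  toFun k x := g.toFun k (f.toFun k x)
  face_toFun i x := by rw [g.face_toFun, f.face_toFun]

theorem chainMap_comp (k : ℕ) (x : A.Chain k) :
    (f.comp g).chainMap k x = g.chainMap k (f.chainMap k x) :=
  Finsupp.mapDomain_comp (f := f.toFun k) (g := g.toFun k)

theorem homologyMap_comp (k : ℕ) (x : A.Homology k) :
    (f.comp g).homologyMap k x = g.homologyMap k (f.homologyMap k x) := by
  obtain ⟨z, hz, rfl⟩ := A.exists_toHomology_eq x
  simp only [homologyMap_toHomology, chainMap_comp]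

/-- In index 0 equality of the chain maps replaces the homotopy identity. This costs nothing for
singular chains, where index 0 contains only the empty simplex. -/
theorem homologyMap_eq_of_homotopy {k : ℕ} {f f' : Hom A B}
    (D : ∀ k, A.Chain k →ₗ[ℤ] B.Chain (k + 1))
    (hD : ∀ k x, B.d (k + 1) (D (k + 1) x) + D k (A.d k x) =
      f.chainMap (k + 1) x - f'.chainMap (k + 1) x) (hf : f.chainMap 0 = f'.chainMap 0) :
    f.homologyMap k = f'.homologyMap k := by
  ext x
  obtain ⟨z, hz, rfl⟩ := A.exists_toHomology_eq x
  simp only [homologyMap_toHomology]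
  rw [toHomology_eq_iff]
  cases k with
  | zero => exact ⟨0, by simp [hf]⟩
  | succ k =>
    refine ⟨D (k + 1) z, ?_⟩
    rw [← hD, show A.d k z = 0 from hz]
    simp

end Hom

end FaceSystem

/-! ### Cones and chain homotopies on tuples of points -/

/-- Simplices given by their vertices in an arbitrary type. -/
def tupleSystem (M : Type u) : FaceSystem.{u} where
  simplex k := Fin k → M
  face i v := v ∘ i.succAbove
  face_face {k i j} hij v := by
    funext l
    simp only [Function.comp_apply]
    congr 1
    rw [Fin.le_iff_val_le_val] at hij
    ext
    simp only [Fin.succAbove, Fin.lt_def]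
    split_ifs <;> simp_all <;> omega

/-- The map of tuples given by a map of vertices. -/
def tupleMap {M : Type u₁} {N : Type u₂} (f : M → N) :
    FaceSystem.Hom (tupleSystem M) (tupleSystem N) where
  toFun _ v := f ∘ v
  face_toFun _ _ := rfl

namespace tupleSystem

variable {M : Type u₁} {N : Type u₂}

/-- The join of a point and a simplex. -/
def cons (b : M) {k : ℕ} (v : (tupleSystem M).simplex k) : (tupleSystem M).simplex (k + 1) :=
  (Fin.cons b (v : Fin k → M) : Fin (k + 1) → M)

theorem face_zero_cons (b : M) {k : ℕ} (v : (tupleSystem M).simplex k) :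
    (tupleSystem M).face 0 (cons b v) = v := by
  funext l
  exact Fin.cons_succ (α := fun _ => M) b v l

theorem face_succ_cons (b : M) {k : ℕ} (v : (tupleSystem M).simplex (k + 1)) (i : Fin (k + 1)) :
    (tupleSystem M).face i.succ (cons b v) = cons b ((tupleSystem M).face i v) := by
  funext l
  change (Fin.cons b (v : Fin (k + 1) → M) : Fin (k + 2) → M) (i.succ.succAbove l) =
    (Fin.cons b ((v : Fin (k + 1) → M) ∘ i.succAbove) : Fin (k + 1) → M) l
  refine Fin.cases ?_ (fun l => ?_) l <;> simp <;> rfl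

theorem tupleMap_cons (f : M → N) (b : M) {k : ℕ} (v : (tupleSystem M).simplex k) :
    (tupleMap f).toFun (k + 1) (cons b v) = cons (f b) ((tupleMap f).toFun k v) := by
  funext l
  change f ((Fin.cons b (v : Fin k → M) : Fin (k + 1) → M) l) =
    (Fin.cons (f b) (f ∘ (v : Fin k → M)) : Fin (k + 1) → N) l
  refine Fin.cases ?_ (fun l => ?_) l <;> simp <;> rfl

/-- The cone of a chain with a given apex. -/
def cone (b : M) (k : ℕ) : (tupleSystem M).Chain k →ₗ[ℤ] (tupleSystem M).Chain (k + 1) :=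
  Finsupp.lmapDomain ℤ ℤ (cons b)

@[simp]
theorem cone_single (b : M) (k : ℕ) (v : (tupleSystem M).simplex k) (n : ℤ) :
    cone b k (Finsupp.single v n) = Finsupp.single (cons b v) n :=
  Finsupp.mapDomain_single

theorem d_cone_zero (b : M) (x : (tupleSystem M).Chain 0) :
    (tupleSystem M).d 0 (cone b 0 x) = x := by
  suffices ((tupleSystem M).d 0).comp (cone b 0) = LinearMap.id from LinearMap.congr_fun this x
  refine Finsupp.lhom_ext' fun v => LinearMap.ext_ring ?_
  simp [face_zero_cons]

theorem d_cone_succ (b : M) (k : ℕ) (x : (tupleSystem M).Chain (k + 1)) :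
    (tupleSystem M).d (k + 1) (cone b (k + 1) x) = x - cone b k ((tupleSystem M).d k x) := by
  suffices ((tupleSystem M).d (k + 1)).comp (cone b (k + 1)) =
      LinearMap.id - (cone b k).comp ((tupleSystem M).d k) from LinearMap.congr_fun this x
  refine Finsupp.lhom_ext' fun v => LinearMap.ext_ring ?_
  simp only [LinearMap.comp_apply, Finsupp.lsingle_apply, cone_single, LinearMap.sub_apply,
    LinearMap.id_apply, FaceSystem.d_single]
  rw [Fin.sum_univ_succ, map_sum, sub_eq_add_neg, ← Finset.sum_neg_distrib]
  congr 1
  · simp [face_zero_cons]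
  · refine Finset.sum_congr rfl fun i _ => ?_
    rw [map_smul, cone_single, Fin.val_succ, pow_succ, mul_neg_one, neg_smul, face_succ_cons]

theorem d_cone (b : M) (k : ℕ) (x : (tupleSystem M).Chain (k + 1))
    (hx : (tupleSystem M).d k x = 0) : (tupleSystem M).d (k + 1) (cone b (k + 1) x) = x := by
  rw [d_cone_succ, hx, map_zero, sub_zero]

theorem chainMap_cone (f : M → N) (b : M) (k : ℕ) (x : (tupleSystem M).Chain k) :
    (tupleMap f).chainMap (k + 1) (cone b k x) = cone (f b) k ((tupleMap f).chainMap k x) := by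
  suffices ((tupleMap f).chainMap (k + 1)).comp (cone b k) =
      (cone (f b) k).comp ((tupleMap f).chainMap k) from LinearMap.congr_fun this x
  refine Finsupp.lhom_ext' fun v => LinearMap.ext_ring ?_
  simp [tupleMap_cons]

/-- The chain homotopy obtained by coning off, with apex `c v` over the simplex `v`. -/
def coneHomotopy (c : ∀ k, (tupleSystem M).simplex (k + 1) → N)
    (φ : ∀ k, (tupleSystem M).Chain k →ₗ[ℤ] (tupleSystem N).Chain k)
    (k : ℕ) : (tupleSystem M).Chain k →ₗ[ℤ] (tupleSystem N).Chain (k + 1) :=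
  match k with
  | 0 => 0
  | k + 1 => Finsupp.linearCombination ℤ fun v =>
      cone (c k v) (k + 1) (φ (k + 1) (Finsupp.single v 1) -
        coneHomotopy c φ k ((tupleSystem M).d k (Finsupp.single v 1)))

@[simp]
theorem coneHomotopy_zero (c : ∀ k, (tupleSystem M).simplex (k + 1) → N)
    (φ : ∀ k, (tupleSystem M).Chain k →ₗ[ℤ] (tupleSystem N).Chain k) :
    coneHomotopy c φ 0 = 0 := rfl

theorem coneHomotopy_succ_single (c : ∀ k, (tupleSystem M).simplex (k + 1) → N)
    (φ : ∀ k, (tupleSystem M).Chain k →ₗ[ℤ] (tupleSystem N).Chain k) (k : ℕ)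
    (v : (tupleSystem M).simplex (k + 1)) :
    coneHomotopy c φ (k + 1) (Finsupp.single v 1) =
      cone (c k v) (k + 1) (φ (k + 1) (Finsupp.single v 1) -
        coneHomotopy c φ k ((tupleSystem M).d k (Finsupp.single v 1))) := by
  rw [coneHomotopy]
  exact (Finsupp.linearCombination_single ..).trans (one_smul _ _)

/-- Inductively φ v - D(dv) is a cycle, where D is `coneHomotopy`, and the cone over a cycle has
that cycle as boundary. This is the method of acyclic models with the contraction written out; φ
vanishing in index 0 starts the induction. -/
theorem d_coneHomotopy (c : ∀ k, (tupleSystem M).simplex (k + 1) → N)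
    (φ : ∀ k, (tupleSystem M).Chain k →ₗ[ℤ] (tupleSystem N).Chain k) (h0 : φ 0 = 0)
    (hφ : ∀ k x, (tupleSystem N).d k (φ (k + 1) x) = φ k ((tupleSystem M).d k x))
    (k : ℕ) (x : (tupleSystem M).Chain (k + 1)) :
    (tupleSystem N).d (k + 1) (coneHomotopy c φ (k + 1) x) +
      coneHomotopy c φ k ((tupleSystem M).d k x) = φ (k + 1) x := by
  suffices ((tupleSystem N).d (k + 1)).comp (coneHomotopy c φ (k + 1)) +
      (coneHomotopy c φ k).comp ((tupleSystem M).d k) = φ (k + 1) from LinearMap.congr_fun this x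
  induction k with
  | zero =>
    refine Finsupp.lhom_ext' fun v => LinearMap.ext_ring ?_
    simp only [LinearMap.comp_apply, Finsupp.lsingle_apply, LinearMap.add_apply]
    rw [coneHomotopy_succ_single, d_cone]
    · simp
    · rw [map_sub, hφ, h0]
      simp
  | succ k ih =>
    refine Finsupp.lhom_ext' fun v => LinearMap.ext_ring ?_
    simp only [LinearMap.comp_apply, Finsupp.lsingle_apply, LinearMap.add_apply]
    rw [coneHomotopy_succ_single, d_cone]
    · simp
    · have := LinearMap.congr_fun (ih ((tupleSystem M).d (k + 1) (Finsupp.single v 1)))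
        ((tupleSystem M).d (k + 1) (Finsupp.single v 1))
      simp only [LinearMap.comp_apply, LinearMap.add_apply, FaceSystem.d_d, map_zero,
        add_zero] at this
      rw [map_sub, hφ, this, sub_self]

/-- The homotopy is as natural as its apexes and φ are. This naturality is what later allows passage
from model simplices to singular ones. -/
theorem chainMap_coneHomotopy {M' : Type u₁} {N' : Type u₂} (f : M → M') (g : N → N')
    (c : ∀ k, (tupleSystem M).simplex (k + 1) → N)
    (c' : ∀ k, (tupleSystem M').simplex (k + 1) → N')
    (φ : ∀ k, (tupleSystem M).Chain k →ₗ[ℤ] (tupleSystem N).Chain k)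
    (φ' : ∀ k, (tupleSystem M').Chain k →ₗ[ℤ] (tupleSystem N').Chain k)
    (hc : ∀ k v, g (c k v) = c' k ((tupleMap f).toFun _ v))
    (hφ : ∀ k x, (tupleMap g).chainMap k (φ k x) = φ' k ((tupleMap f).chainMap k x))
    (k : ℕ) (x : (tupleSystem M).Chain k) :
    (tupleMap g).chainMap (k + 1) (coneHomotopy c φ k x) =
      coneHomotopy c' φ' k ((tupleMap f).chainMap k x) := by
  suffices ((tupleMap g).chainMap (k + 1)).comp (coneHomotopy c φ k) =
      (coneHomotopy c' φ' k).comp ((tupleMap f).chainMap k) from LinearMap.congr_fun this x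
  induction k with
  | zero => simp
  | succ k ih =>
    refine Finsupp.lhom_ext' fun v => LinearMap.ext_ring ?_
    have := LinearMap.congr_fun (ih ((tupleSystem M).d k (Finsupp.single v 1)))
        ((tupleSystem M).d k (Finsupp.single v 1))
    simp only [LinearMap.comp_apply] at this
    simp only [LinearMap.comp_apply, Finsupp.lsingle_apply]
    rw [coneHomotopy_succ_single, chainMap_cone, map_sub, hφ, this, ← FaceSystem.Hom.d_chainMap]
    rw [FaceSystem.Hom.chainMap_single, coneHomotopy_succ_single, hc]

end tupleSystem

end

noncomputable section


/-! ### Subdivision and prism operators on tuples -/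

namespace tupleSystem

variable {M : Type u₁} {N : Type u₂}

/-- Barycentric subdivision with respect to a choice of barycenters. -/
def subdivision (b : ∀ k, (tupleSystem M).simplex (k + 1) → M) (k : ℕ) :
    (tupleSystem M).Chain k →ₗ[ℤ] (tupleSystem M).Chain k :=
  match k with
  | 0 => LinearMap.id
  | k + 1 => Finsupp.linearCombination ℤ fun v =>
      cone (b k v) k (subdivision b k ((tupleSystem M).d k (Finsupp.single v 1)))

@[simp]
theorem subdivision_zero (b : ∀ k, (tupleSystem M).simplex (k + 1) → M) :
    subdivision b 0 = LinearMap.id := rfl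

theorem subdivision_succ_single (b : ∀ k, (tupleSystem M).simplex (k + 1) → M) (k : ℕ)
    (v : (tupleSystem M).simplex (k + 1)) :
    subdivision b (k + 1) (Finsupp.single v 1) =
      cone (b k v) k (subdivision b k ((tupleSystem M).d k (Finsupp.single v 1))) := by
  rw [subdivision]
  exact (Finsupp.linearCombination_single ..).trans (one_smul _ _)

theorem d_subdivision (b : ∀ k, (tupleSystem M).simplex (k + 1) → M) (k : ℕ)
    (x : (tupleSystem M).Chain (k + 1)) :
    (tupleSystem M).d k (subdivision b (k + 1) x) =
      subdivision b k ((tupleSystem M).d k x) := by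
  suffices ((tupleSystem M).d k).comp (subdivision b (k + 1)) =
      (subdivision b k).comp ((tupleSystem M).d k) from LinearMap.congr_fun this x
  induction k with
  | zero =>
    refine Finsupp.lhom_ext' fun v => LinearMap.ext_ring ?_
    simp only [LinearMap.comp_apply, Finsupp.lsingle_apply]
    rw [subdivision_succ_single, d_cone_zero]
  | succ k ih =>
    refine Finsupp.lhom_ext' fun v => LinearMap.ext_ring ?_
    simp only [LinearMap.comp_apply, Finsupp.lsingle_apply]
    rw [subdivision_succ_single, d_cone]
    have := LinearMap.congr_fun (ih ((tupleSystem M).d (k + 1) (Finsupp.single v 1)))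
      ((tupleSystem M).d (k + 1) (Finsupp.single v 1))
    simpa [FaceSystem.d_d, -FaceSystem.d_single] using this

theorem chainMap_subdivision {M' : Type u₂} (f : M → M')
    (b : ∀ k, (tupleSystem M).simplex (k + 1) → M)
    (b' : ∀ k, (tupleSystem M').simplex (k + 1) → M')
    (hb : ∀ k v, f (b k v) = b' k ((tupleMap f).toFun _ v))
    (k : ℕ) (x : (tupleSystem M).Chain k) :
    (tupleMap f).chainMap k (subdivision b k x) =
      subdivision b' k ((tupleMap f).chainMap k x) := by
  suffices ((tupleMap f).chainMap k).comp (subdivision b k) =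
      (subdivision b' k).comp ((tupleMap f).chainMap k) from LinearMap.congr_fun this x
  induction k with
  | zero => simp
  | succ k ih =>
    refine Finsupp.lhom_ext' fun v => LinearMap.ext_ring ?_
    have := LinearMap.congr_fun (ih ((tupleSystem M).d k (Finsupp.single v 1)))
        ((tupleSystem M).d k (Finsupp.single v 1))
    simp only [LinearMap.comp_apply] at this
    simp only [LinearMap.comp_apply, Finsupp.lsingle_apply]
    rw [subdivision_succ_single, chainMap_cone, this, ← FaceSystem.Hom.d_chainMap]
    rw [FaceSystem.Hom.chainMap_single, subdivision_succ_single, hb]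

/-- The chain homotopy from barycentric subdivision to the identity. -/
def subdivisionHomotopy (b : ∀ k, (tupleSystem M).simplex (k + 1) → M) (k : ℕ) :
    (tupleSystem M).Chain k →ₗ[ℤ] (tupleSystem M).Chain (k + 1) :=
  coneHomotopy b (fun k => LinearMap.id - subdivision b k) k

theorem d_subdivisionHomotopy (b : ∀ k, (tupleSystem M).simplex (k + 1) → M) (k : ℕ)
    (x : (tupleSystem M).Chain (k + 1)) :
    (tupleSystem M).d (k + 1) (subdivisionHomotopy b (k + 1) x) +
      subdivisionHomotopy b k ((tupleSystem M).d k x) = x - subdivision b (k + 1) x :=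
  d_coneHomotopy b _ (sub_self _) (fun k x => by simp [d_subdivision]) k x

theorem chainMap_subdivisionHomotopy {M' : Type u₁} (f : M → M')
    (b : ∀ k, (tupleSystem M).simplex (k + 1) → M)
    (b' : ∀ k, (tupleSystem M').simplex (k + 1) → M')
    (hb : ∀ k v, f (b k v) = b' k ((tupleMap f).toFun _ v))
    (k : ℕ) (x : (tupleSystem M).Chain k) :
    (tupleMap f).chainMap (k + 1) (subdivisionHomotopy b k x) =
      subdivisionHomotopy b' k ((tupleMap f).chainMap k x) :=
  chainMap_coneHomotopy f f b b' _ _ hb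
    (fun k x => by simp [chainMap_subdivision f b b' hb]) k x

/-- The homotopy between the two ends of the cylinder `unitInterval × M`. -/
def prism (M : Type u₁) (k : ℕ) :
    (tupleSystem M).Chain k →ₗ[ℤ] (tupleSystem (unitInterval × M)).Chain (k + 1) :=
  -- The apex is a point of the cylinder chosen naturally in v, so that the prism commutes with maps
  -- of vertices.
  coneHomotopy (fun _ v => (0, v (0 : Fin (_ + 1))))
    (fun k => (tupleMap fun x : M => ((1 : unitInterval), x)).chainMap k -
      (tupleMap fun x : M => ((0 : unitInterval), x)).chainMap k) k

theorem d_prism (k : ℕ) (x : (tupleSystem M).Chain (k + 1)) :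
    (tupleSystem (unitInterval × M)).d (k + 1) (prism M (k + 1) x) +
      prism M k ((tupleSystem M).d k x) =
      (tupleMap fun x : M => ((1 : unitInterval), x)).chainMap (k + 1) x -
      (tupleMap fun x : M => ((0 : unitInterval), x)).chainMap (k + 1) x := by
  refine d_coneHomotopy _ (fun k => (tupleMap fun x : M => ((1 : unitInterval), x)).chainMap k -
      (tupleMap fun x : M => ((0 : unitInterval), x)).chainMap k) ?_ ?_ k x
  · refine Finsupp.lhom_ext' fun v => LinearMap.ext_ring ?_
    simp only [LinearMap.comp_apply, Finsupp.lsingle_apply, LinearMap.sub_apply,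
      FaceSystem.Hom.chainMap_single, LinearMap.zero_apply, sub_eq_zero]
    congr 1
    exact funext fun i : Fin 0 => i.elim0
  · intro k x
    simp [FaceSystem.Hom.d_chainMap]

theorem chainMap_prism {M' : Type u₁} (f : M → M') (k : ℕ) (x : (tupleSystem M).Chain k) :
    (tupleMap (Prod.map id f)).chainMap (k + 1) (prism M k x) =
      prism M' k ((tupleMap f).chainMap k x) :=
  chainMap_coneHomotopy f (Prod.map id f) _ _ _ _ (fun _ _ => rfl)
    (fun k x => by
      simp only [LinearMap.sub_apply, map_sub, ← FaceSystem.Hom.chainMap_comp]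
      rfl) k x

end tupleSystem

/-! ### Singular chains, affine simplices and homotopy invariance -/

/-- The inclusion of a face of the standard simplex. -/
def simplexFace {k : ℕ} (i : Fin (k + 1)) : C(stdSimplex ℝ (Fin k), stdSimplex ℝ (Fin (k + 1))) :=
  ⟨stdSimplex.map i.succAbove, stdSimplex.continuous_map _⟩

theorem sum_stdSimplex_map_smul {ι κ : Type*} [Fintype ι] [Fintype κ] {E : Type*}
    [AddCommGroup E] [Module ℝ E] (f : ι → κ) (t : stdSimplex ℝ ι) (v : κ → E) :
    ∑ j, stdSimplex.map f t j • v j = ∑ i, t i • v (f i) := by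
  classical
  simp only [stdSimplex.map_coe, FunOnFinite.linearMap_apply_apply, Finset.sum_smul]
  rw [← Finset.sum_fiberwise Finset.univ f fun i => t i • v (f i)]
  refine Finset.sum_congr rfl fun j _ => Finset.sum_congr rfl fun i hi => ?_
  rw [(Finset.mem_filter.1 hi).2]

/-- Singular simplices of a space, including the empty one. -/
def singularSystem (X : Type u) [TopologicalSpace X] : FaceSystem.{u} where
  simplex k := C(stdSimplex ℝ (Fin k), X)
  face i σ := σ.comp (simplexFace i)
  face_face {k i j} hij σ := by
    ext t
    change σ (stdSimplex.map _ (stdSimplex.map _ t)) = σ (stdSimplex.map _ (stdSimplex.map _ t))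
    rw [stdSimplex.map_comp_apply, stdSimplex.map_comp_apply]
    congr 2
    funext l
    rw [Fin.le_iff_val_le_val] at hij
    ext
    simp only [Function.comp_apply, Fin.succAbove, Fin.lt_def]
    split_ifs <;> simp_all <;> omega

section

variable {X : Type u₁} [TopologicalSpace X] {Y : Type u₂} [TopologicalSpace Y]
  {Z : Type u₃} [TopologicalSpace Z]

/-- The map of singular simplices induced by a continuous map. -/
def singularMap (f : C(X, Y)) : FaceSystem.Hom (singularSystem X) (singularSystem Y) where
  toFun _ σ := f.comp σ
  face_toFun _ _ := rfl

theorem singularMap_comp (f : C(X, Y)) (g : C(Y, Z)) :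
    singularMap (g.comp f) = (singularMap f).comp (singularMap g) := rfl

variable {E : Type*} [NormedAddCommGroup E] [NormedSpace ℝ E] {K : Set E}
  {E' : Type*} [NormedAddCommGroup E'] [NormedSpace ℝ E'] {K' : Set E'}

/-- The affine singular simplex of a convex set with given vertices. -/
def affineSimplex (hK : Convex ℝ K) : FaceSystem.Hom (tupleSystem K) (singularSystem K) where
  toFun k v :=
    { toFun t := ⟨∑ i, t i • (v i : E), hK.sum_mem (fun i _ => t.2.1 i) t.2.2
        fun i _ => (v i).2⟩
      continuous_toFun := by
        refine Continuous.subtype_mk (continuous_finsetSum _ fun i _ => ?_) _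
        exact ((continuous_apply i).comp continuous_subtype_val).smul continuous_const }
  face_toFun i v := by
    refine ContinuousMap.ext fun t => Subtype.ext ?_
    exact sum_stdSimplex_map_smul i.succAbove t fun j => (v j : E)

/-- The map between convex sets which is affine with given vertices. -/
def affineMap (hK : Convex ℝ K) {k : ℕ} (v : (tupleSystem K).simplex k) :
    C(stdSimplex ℝ (Fin k), K) := (affineSimplex hK).toFun k v

theorem coe_affineMap (hK : Convex ℝ K) {k : ℕ} (v : (tupleSystem K).simplex k)
    (t : stdSimplex ℝ (Fin k)) : (affineMap hK v t : E) = ∑ i, t i • (v i : E) := rfl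

/-- The vertices of the standard simplex. -/
def stdVertices (k : ℕ) : (tupleSystem (stdSimplex ℝ (Fin k))).simplex k :=
  fun i : Fin k => stdSimplex.vertex i

theorem tupleMap_affineMap_stdVertices (hK : Convex ℝ K) {k : ℕ} (v : (tupleSystem K).simplex k) :
    (tupleMap (affineMap hK v)).toFun k (stdVertices k) = v := by
  funext i
  refine Subtype.ext ?_
  change ∑ j, (stdSimplex.vertex (S := ℝ) i) j • (v j : E) = v i
  simp [stdSimplex.vertex_coe, Pi.single_apply]

theorem affineMap_stdVertices (k : ℕ) :
    affineMap (convex_stdSimplex ℝ (Fin k)) (stdVertices k) = ContinuousMap.id _ := by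
  ext t i
  change (∑ j, t j • (stdSimplex.vertex (S := ℝ) j : stdSimplex ℝ (Fin k)).1) i = t i
  rw [Finset.sum_apply]
  simp [Pi.single_apply]

theorem affineMap_affineMap (hK : Convex ℝ K) {k l : ℕ} (v : (tupleSystem K).simplex k)
    (w : (tupleSystem (stdSimplex ℝ (Fin k))).simplex l) (t : stdSimplex ℝ (Fin l)) :
    affineMap hK v (affineMap (convex_stdSimplex ℝ (Fin k)) w t) =
      affineMap hK ((tupleMap (affineMap hK v)).toFun l w) t := by
  refine Subtype.ext ?_
  change ∑ i, ((∑ j, t j • (w j : stdSimplex ℝ (Fin k)).1) i) • (v i : E) =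
    ∑ j, t j • ∑ i, (w j : stdSimplex ℝ (Fin k)).1 i • (v i : E)
  simp only [Finset.sum_apply, Finset.sum_smul, Finset.smul_sum, Pi.smul_apply, smul_eq_mul,
    mul_smul]
  rw [Finset.sum_comm]

/-- The affine maps between convex sets commute with the formation of affine simplices. -/
theorem affineSimplex_naturality (hK : Convex ℝ K) {k : ℕ} (v : (tupleSystem K).simplex k) :
    (affineSimplex (convex_stdSimplex ℝ (Fin k))).comp (singularMap (affineMap hK v)) =
      (tupleMap (affineMap hK v)).comp (affineSimplex hK) := by
  rw [FaceSystem.Hom.mk.injEq]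
  funext l w
  exact ContinuousMap.ext (affineMap_affineMap hK v w)

/-- The barycenter of an affine simplex. -/
def affineBarycenter (hK : Convex ℝ K) (k : ℕ) (v : (tupleSystem K).simplex (k + 1)) : K :=
  affineMap hK v stdSimplex.barycenter

theorem affineMap_affineBarycenter (hK : Convex ℝ K) {k l : ℕ} (v : (tupleSystem K).simplex k)
    (w : (tupleSystem (stdSimplex ℝ (Fin k))).simplex (l + 1)) :
    affineMap hK v (affineBarycenter (convex_stdSimplex ℝ (Fin k)) l w) =
      affineBarycenter hK l ((tupleMap (affineMap hK v)).toFun (l + 1) w) :=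
  affineMap_affineMap hK v w _

/-- Affine simplices in the cylinder over a convex set. -/
def affineSimplexCylinder (hK : Convex ℝ K) :
    FaceSystem.Hom (tupleSystem (unitInterval × K)) (singularSystem (unitInterval × K)) where
  toFun k v := ContinuousMap.prodMk
    (affineMap (convex_Icc (0 : ℝ) 1) ((tupleMap Prod.fst).toFun k v))
    (affineMap hK ((tupleMap Prod.snd).toFun k v))
  face_toFun i v := by
    refine ContinuousMap.ext fun t => Prod.ext ?_ ?_
    · exact ContinuousMap.congr_fun ((affineSimplex (convex_Icc (0 : ℝ) 1)).face_toFun i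
        ((tupleMap Prod.fst).toFun _ v)) t
    · exact ContinuousMap.congr_fun ((affineSimplex hK).face_toFun i
        ((tupleMap Prod.snd).toFun _ v)) t

/-- The operation on singular chains given by an operation on affine chains. -/
def liftOperation {e : ℕ → ℕ} (O : ∀ j k, (tupleSystem (stdSimplex ℝ (Fin j))).Chain k →ₗ[ℤ]
    (tupleSystem (stdSimplex ℝ (Fin j))).Chain (e k)) (X : Type u₁) [TopologicalSpace X] (k : ℕ) :
    (singularSystem X).Chain k →ₗ[ℤ] (singularSystem X).Chain (e k) :=
  Finsupp.linearCombination ℤ fun σ => (singularMap σ).chainMap (e k)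
    ((affineSimplex (convex_stdSimplex ℝ (Fin k))).chainMap (e k)
      (O k k (Finsupp.single (stdVertices k) 1)))

theorem liftOperation_single {e : ℕ → ℕ} (O : ∀ j k,
    (tupleSystem (stdSimplex ℝ (Fin j))).Chain k →ₗ[ℤ]
    (tupleSystem (stdSimplex ℝ (Fin j))).Chain (e k)) {k : ℕ} (σ : (singularSystem X).simplex k) :
    liftOperation O X k (Finsupp.single σ 1) = (singularMap σ).chainMap (e k)
    ((affineSimplex (convex_stdSimplex ℝ (Fin k))).chainMap (e k)
      (O k k (Finsupp.single (stdVertices k) 1))) := by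
  rw [liftOperation]
  exact (Finsupp.linearCombination_single ..).trans (one_smul _ _)

/-- Every singular simplex is the image of the identity simplex, so identities between natural
operations need only be checked on affine chains in standard simplices. -/
theorem single_eq_chainMap_stdVertices {k : ℕ} (σ : (singularSystem X).simplex k) :
    (Finsupp.single σ 1 : (singularSystem X).Chain k) = (singularMap σ).chainMap k
      ((affineSimplex (convex_stdSimplex ℝ (Fin k))).chainMap k
        (Finsupp.single (stdVertices k) 1)) := by
  rw [FaceSystem.Hom.chainMap_single, FaceSystem.Hom.chainMap_single]
  congr 1
  change σ = ContinuousMap.comp σ (affineMap (convex_stdSimplex ℝ (Fin k)) (stdVertices k))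
  rw [affineMap_stdVertices]
  rfl

/-- The lift is defined on identity simplices only. The naturality `hO` under affine maps makes it
agree with the given operation on all affine chains inside a singular simplex, in particular on the
faces that occur in boundaries. -/
theorem liftOperation_chainMap {e : ℕ → ℕ} (O : ∀ j k,
    (tupleSystem (stdSimplex ℝ (Fin j))).Chain k →ₗ[ℤ]
    (tupleSystem (stdSimplex ℝ (Fin j))).Chain (e k))
    (hO : ∀ j k (v : (tupleSystem (stdSimplex ℝ (Fin j))).simplex k)
      (x : (tupleSystem (stdSimplex ℝ (Fin k))).Chain k),
      (tupleMap (affineMap (convex_stdSimplex ℝ (Fin j)) v)).chainMap (e k) (O k k x) =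
      O j k ((tupleMap (affineMap (convex_stdSimplex ℝ (Fin j)) v)).chainMap k x))
    {j k : ℕ} (σ : (singularSystem X).simplex j)
    (x : (tupleSystem (stdSimplex ℝ (Fin j))).Chain k) :
    liftOperation O X k ((singularMap σ).chainMap k
      ((affineSimplex (convex_stdSimplex ℝ (Fin j))).chainMap k x)) =
      (singularMap σ).chainMap (e k)
        ((affineSimplex (convex_stdSimplex ℝ (Fin j))).chainMap (e k) (O j k x)) := by
  suffices (liftOperation O X k).comp (((singularMap σ).chainMap k).comp
      ((affineSimplex (convex_stdSimplex ℝ (Fin j))).chainMap k)) =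
      ((singularMap σ).chainMap (e k)).comp
        (((affineSimplex (convex_stdSimplex ℝ (Fin j))).chainMap (e k)).comp (O j k)) from
    LinearMap.congr_fun this x
  refine Finsupp.lhom_ext' fun v => LinearMap.ext_ring ?_
  simp only [LinearMap.comp_apply, Finsupp.lsingle_apply]
  rw [FaceSystem.Hom.chainMap_single, FaceSystem.Hom.chainMap_single, liftOperation_single]
  have h : singularMap ((singularMap σ).toFun k
      ((affineSimplex (convex_stdSimplex ℝ (Fin j))).toFun k v)) =
      (singularMap (affineMap (convex_stdSimplex ℝ (Fin j)) v)).comp (singularMap σ) := rfl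
  rw [h, FaceSystem.Hom.chainMap_comp]
  congr 1
  rw [← FaceSystem.Hom.chainMap_comp, affineSimplex_naturality, FaceSystem.Hom.chainMap_comp, hO,
    FaceSystem.Hom.chainMap_single, tupleMap_affineMap_stdVertices]

/-- Barycentric subdivision of singular chains. -/
def singularSubdivision (X : Type u₁) [TopologicalSpace X] (k : ℕ) :
    (singularSystem X).Chain k →ₗ[ℤ] (singularSystem X).Chain k :=
  liftOperation (e := fun k => k) (fun j k => tupleSystem.subdivision
    (affineBarycenter (convex_stdSimplex ℝ (Fin j))) k) X k

theorem singularSubdivision_chainMap {j k : ℕ} (σ : (singularSystem X).simplex j)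
    (x : (tupleSystem (stdSimplex ℝ (Fin j))).Chain k) :
    singularSubdivision X k ((singularMap σ).chainMap k
      ((affineSimplex (convex_stdSimplex ℝ (Fin j))).chainMap k x)) =
      (singularMap σ).chainMap k ((affineSimplex (convex_stdSimplex ℝ (Fin j))).chainMap k
        (tupleSystem.subdivision (affineBarycenter (convex_stdSimplex ℝ (Fin j))) k x)) :=
  liftOperation_chainMap _ (fun j _ v x => tupleSystem.chainMap_subdivision _ _ _
    (fun _ w => affineMap_affineBarycenter (convex_stdSimplex ℝ (Fin j)) v w) _ x) σ x

/-- The homotopy between barycentric subdivision and the identity. -/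
def singularSubdivisionHomotopy (X : Type u₁) [TopologicalSpace X] (k : ℕ) :
    (singularSystem X).Chain k →ₗ[ℤ] (singularSystem X).Chain (k + 1) :=
  liftOperation (e := fun k => k + 1) (fun j k => tupleSystem.subdivisionHomotopy
    (affineBarycenter (convex_stdSimplex ℝ (Fin j))) k) X k

theorem singularSubdivisionHomotopy_chainMap {j k : ℕ} (σ : (singularSystem X).simplex j)
    (x : (tupleSystem (stdSimplex ℝ (Fin j))).Chain k) :
    singularSubdivisionHomotopy X k ((singularMap σ).chainMap k
      ((affineSimplex (convex_stdSimplex ℝ (Fin j))).chainMap k x)) =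
      (singularMap σ).chainMap (k + 1)
        ((affineSimplex (convex_stdSimplex ℝ (Fin j))).chainMap (k + 1)
        (tupleSystem.subdivisionHomotopy (affineBarycenter (convex_stdSimplex ℝ (Fin j))) k x)) :=
  liftOperation_chainMap (e := fun k => k + 1) _
    (fun j _ v x => tupleSystem.chainMap_subdivisionHomotopy _ _ _
    (fun _ w => affineMap_affineBarycenter (convex_stdSimplex ℝ (Fin j)) v w) _ x) σ x

theorem d_singularSubdivision (k : ℕ) (x : (singularSystem X).Chain (k + 1)) :
    (singularSystem X).d k (singularSubdivision X (k + 1) x) =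
      singularSubdivision X k ((singularSystem X).d k x) := by
  suffices ((singularSystem X).d k).comp (singularSubdivision X (k + 1)) =
      (singularSubdivision X k).comp ((singularSystem X).d k) from LinearMap.congr_fun this x
  refine Finsupp.lhom_ext' fun σ => LinearMap.ext_ring ?_
  simp only [LinearMap.comp_apply, Finsupp.lsingle_apply]
  rw [single_eq_chainMap_stdVertices, singularSubdivision_chainMap]
  simp only [FaceSystem.Hom.d_chainMap, singularSubdivision_chainMap, tupleSystem.d_subdivision]

theorem d_singularSubdivisionHomotopy (k : ℕ) (x : (singularSystem X).Chain (k + 1)) :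
    (singularSystem X).d (k + 1) (singularSubdivisionHomotopy X (k + 1) x) +
      singularSubdivisionHomotopy X k ((singularSystem X).d k x) =
      x - singularSubdivision X (k + 1) x := by
  suffices ((singularSystem X).d (k + 1)).comp (singularSubdivisionHomotopy X (k + 1)) +
      (singularSubdivisionHomotopy X k).comp ((singularSystem X).d k) =
      LinearMap.id - singularSubdivision X (k + 1) from LinearMap.congr_fun this x
  refine Finsupp.lhom_ext' fun σ => LinearMap.ext_ring ?_
  simp only [LinearMap.comp_apply, Finsupp.lsingle_apply, LinearMap.add_apply, LinearMap.sub_apply,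
    LinearMap.id_apply]
  rw [single_eq_chainMap_stdVertices, singularSubdivision_chainMap,
    singularSubdivisionHomotopy_chainMap]
  simp only [FaceSystem.Hom.d_chainMap, singularSubdivisionHomotopy_chainMap, ← map_add, ← map_sub,
    tupleSystem.d_subdivisionHomotopy]

/-- The chain homotopy induced by a homotopy of maps. -/
def singularPrism {f g : C(X, Y)} (F : f.Homotopy g) (k : ℕ) :
    (singularSystem X).Chain k →ₗ[ℤ] (singularSystem Y).Chain (k + 1) :=
  Finsupp.linearCombination ℤ fun σ =>
    (singularMap (F.toContinuousMap.comp ((ContinuousMap.id _).prodMap σ))).chainMap (k + 1)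
      ((affineSimplexCylinder (convex_stdSimplex ℝ (Fin k))).chainMap (k + 1)
        (tupleSystem.prism _ k (Finsupp.single (stdVertices k) 1)))

theorem singularPrism_single {f g : C(X, Y)} (F : f.Homotopy g) {k : ℕ}
    (σ : (singularSystem X).simplex k) : singularPrism F k (Finsupp.single σ 1) =
    (singularMap (F.toContinuousMap.comp ((ContinuousMap.id _).prodMap σ))).chainMap (k + 1)
      ((affineSimplexCylinder (convex_stdSimplex ℝ (Fin k))).chainMap (k + 1)
        (tupleSystem.prism _ k (Finsupp.single (stdVertices k) 1))) := by
  rw [singularPrism]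
  exact (Finsupp.linearCombination_single ..).trans (one_smul _ _)

theorem affineSimplexCylinder_naturality (hK : Convex ℝ K) {k : ℕ}
    (v : (tupleSystem K).simplex k) :
    (affineSimplexCylinder (convex_stdSimplex ℝ (Fin k))).comp
      (singularMap ((ContinuousMap.id unitInterval).prodMap (affineMap hK v))) =
      (tupleMap (Prod.map id (affineMap hK v))).comp (affineSimplexCylinder hK) := by
  rw [FaceSystem.Hom.mk.injEq]
  funext l w
  refine ContinuousMap.ext fun t => Prod.ext rfl ?_
  exact affineMap_affineMap hK v ((tupleMap Prod.snd).toFun _ w) t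

theorem singularPrism_chainMap {f g : C(X, Y)} (F : f.Homotopy g)
    {j k : ℕ} (σ : (singularSystem X).simplex j)
    (x : (tupleSystem (stdSimplex ℝ (Fin j))).Chain k) :
    singularPrism F k ((singularMap σ).chainMap k
      ((affineSimplex (convex_stdSimplex ℝ (Fin j))).chainMap k x)) =
    (singularMap (F.toContinuousMap.comp ((ContinuousMap.id _).prodMap σ))).chainMap (k + 1)
      ((affineSimplexCylinder (convex_stdSimplex ℝ (Fin j))).chainMap (k + 1)
        (tupleSystem.prism _ k x)) := by
  suffices (singularPrism F k).comp (((singularMap σ).chainMap k).comp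
      ((affineSimplex (convex_stdSimplex ℝ (Fin j))).chainMap k)) =
      ((singularMap (F.toContinuousMap.comp ((ContinuousMap.id _).prodMap σ))).chainMap
        (k + 1)).comp (((affineSimplexCylinder (convex_stdSimplex ℝ (Fin j))).chainMap
        (k + 1)).comp (tupleSystem.prism _ k)) from LinearMap.congr_fun this x
  refine Finsupp.lhom_ext' fun v => LinearMap.ext_ring ?_
  simp only [LinearMap.comp_apply, Finsupp.lsingle_apply]
  rw [FaceSystem.Hom.chainMap_single, FaceSystem.Hom.chainMap_single, singularPrism_single]
  change (singularMap ((F.toContinuousMap.comp ((ContinuousMap.id _).prodMap σ)).comp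
    ((ContinuousMap.id unitInterval).prodMap
      (affineMap (convex_stdSimplex ℝ (Fin j)) v)))).chainMap (k + 1) _ = _
  rw [singularMap_comp, FaceSystem.Hom.chainMap_comp]
  congr 1
  rw [← FaceSystem.Hom.chainMap_comp, affineSimplexCylinder_naturality,
    FaceSystem.Hom.chainMap_comp, tupleSystem.chainMap_prism,
    FaceSystem.Hom.chainMap_single, tupleMap_affineMap_stdVertices]

theorem affineSimplexCylinder_end (hK : Convex ℝ K) (s : unitInterval) (l : ℕ)
    (w : (tupleSystem K).simplex (l + 1)) :
    (affineSimplexCylinder hK).toFun (l + 1) ((tupleMap fun x : K => (s, x)).toFun (l + 1) w) =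
      ContinuousMap.prodMk (ContinuousMap.const _ s) (affineMap hK w) := by
  refine ContinuousMap.ext fun t => Prod.ext (Subtype.ext ?_) rfl
  change ∑ i, t i • (s : ℝ) = s
  rw [← Finset.sum_smul]
  exact (congrArg (· • (s : ℝ)) t.2.2).trans (one_smul _ _)

/-- The prism operator is a chain homotopy with difference g - f, hence the symmetry at the start.
-/
theorem homologyMap_eq_of_homotopy {f g : C(X, Y)} (F : f.Homotopy g) (k : ℕ) :
    (singularMap f).homologyMap k = (singularMap g).homologyMap k := by
  refine (FaceSystem.Hom.homologyMap_eq_of_homotopy (singularPrism F) ?_ ?_).symm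
  · intro k x
    have h1 (σ : C(stdSimplex ℝ (Fin (k + 1)), X)) :
        (F.toContinuousMap.comp ((ContinuousMap.id _).prodMap σ)).comp
          ((ContinuousMap.const _ 1).prodMk (ContinuousMap.id _)) = g.comp σ :=
      ContinuousMap.ext fun t => F.apply_one (σ t)
    have h0 (σ : C(stdSimplex ℝ (Fin (k + 1)), X)) :
        (F.toContinuousMap.comp ((ContinuousMap.id _).prodMap σ)).comp
          ((ContinuousMap.const _ 0).prodMk (ContinuousMap.id _)) = f.comp σ :=
      ContinuousMap.ext fun t => F.apply_zero (σ t)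
    suffices ((singularSystem Y).d (k + 1)).comp (singularPrism F (k + 1)) +
        (singularPrism F k).comp ((singularSystem X).d k) =
        (singularMap g).chainMap (k + 1) - (singularMap f).chainMap (k + 1) from
      LinearMap.congr_fun this x
    refine Finsupp.lhom_ext' fun σ => LinearMap.ext_ring ?_
    simp only [LinearMap.comp_apply, Finsupp.lsingle_apply, LinearMap.add_apply,
      LinearMap.sub_apply]
    rw [single_eq_chainMap_stdVertices, singularPrism_chainMap]
    simp only [FaceSystem.Hom.d_chainMap, singularPrism_chainMap, ← map_add, tupleSystem.d_prism]
    rw [← single_eq_chainMap_stdVertices]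
    simp only [map_sub, FaceSystem.Hom.chainMap_single, affineSimplexCylinder_end,
      affineMap_stdVertices]
    congr 2
    · exact (FaceSystem.Hom.chainMap_single _ _ _ _).trans (congrArg (Finsupp.single · 1) (h1 σ))
    · exact (FaceSystem.Hom.chainMap_single _ _ _ _).trans (congrArg (Finsupp.single · 1) (h0 σ))
  · refine Finsupp.lhom_ext' fun σ => LinearMap.ext_ring ?_
    simp only [LinearMap.comp_apply, Finsupp.lsingle_apply, FaceSystem.Hom.chainMap_single]
    congr 1
    refine ContinuousMap.ext fun t => ?_
    have : IsEmpty (stdSimplex ℝ (Fin 0)) := by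
      rw [stdSimplex_of_isEmpty_index]
      infer_instance
    exact isEmptyElim t

end

end

/-! ### Small simplices: iterated subdivision and open covers -/

noncomputable section


theorem LinearMap.mem_of_mem_supported {α : Type*} {M : Type*} [AddCommGroup M] [Module ℤ M]
    (f : (α →₀ ℤ) →ₗ[ℤ] M) {s : Set α} {p : Submodule ℤ M}
    (h : ∀ a ∈ s, f (Finsupp.single a 1) ∈ p) {x : α →₀ ℤ} (hx : x ∈ Finsupp.supported ℤ ℤ s) :
    f x ∈ p := by
  rw [Finsupp.supported_eq_span_single] at hx
  refine Submodule.span_le (p := p.comap f).2 ?_ hx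
  rintro _ ⟨a, ha, rfl⟩
  exact h a ha

section Diameter

variable {E : Type*} [NormedAddCommGroup E] [NormedSpace ℝ E] {K : Set E}

/-- The vertices of the simplex have pairwise distance at most `r`. -/
def tupleSystem.DiamLE {M : Type*} [PseudoMetricSpace M] {k : ℕ} (r : ℝ)
    (v : (tupleSystem M).simplex k) : Prop :=
  ∀ i j : Fin k, dist ((show Fin k → M from v) i) ((show Fin k → M from v) j) ≤ r

/-- The barycentre minus a vertex is the average of k + 1 differences of vertices, one of which is
zero; the other k have norm at most r. -/
theorem dist_affineBarycenter_le (hK : Convex ℝ K) {k : ℕ} {r : ℝ}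
    (v : (tupleSystem K).simplex (k + 1)) (hv : tupleSystem.DiamLE r v) (i : Fin (k + 1)) :
    dist (affineBarycenter hK k v : E) ((show Fin (k + 1) → K from v) i : E) ≤
      k / (k + 1) * r := by
  set v' : Fin (k + 1) → K := v
  have h : (affineBarycenter hK k v : E) - v' i = ∑ j, ((k : ℝ) + 1)⁻¹ • ((v' j : E) - v' i) := by
    have h1 : (affineBarycenter hK k v : E) = ∑ j, ((k : ℝ) + 1)⁻¹ • (v' j : E) := by
      rw [affineBarycenter, coe_affineMap]
      refine Finset.sum_congr rfl fun j _ => ?_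
      congr 1
      change ((Fintype.card (Fin (k + 1)) : ℝ))⁻¹ = _
      simp
    rw [h1]
    simp only [smul_sub, Finset.sum_sub_distrib, Finset.sum_const, Finset.card_univ,
      Fintype.card_fin, ← Nat.cast_smul_eq_nsmul ℝ, smul_smul]
    rw [Nat.cast_add_one, mul_inv_cancel₀ (by positivity), one_smul]
  rw [dist_eq_norm, h]
  calc ‖∑ j, ((k : ℝ) + 1)⁻¹ • ((v' j : E) - v' i)‖
      ≤ ∑ j, ‖((k : ℝ) + 1)⁻¹ • ((v' j : E) - v' i)‖ := norm_sum_le _ _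
    _ = ∑ j ∈ Finset.univ.erase i, ‖((k : ℝ) + 1)⁻¹ • ((v' j : E) - v' i)‖ := by
        rw [← Finset.add_sum_erase _ _ (Finset.mem_univ i)]
        simp
    _ ≤ ∑ j ∈ Finset.univ.erase i, ((k : ℝ) + 1)⁻¹ * r := by
        refine Finset.sum_le_sum fun j _ => ?_
        rw [norm_smul, Real.norm_of_nonneg (by positivity), ← dist_eq_norm]
        exact mul_le_mul_of_nonneg_left (hv j i) (by positivity)
    _ = k / (k + 1) * r := by
        rw [Finset.sum_const, Finset.card_erase_of_mem (Finset.mem_univ i)]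
        simp [div_eq_mul_inv, mul_assoc]

/-- The bound n on the dimension is kept apart from k so that one contraction factor serves all
faces in the induction. An edge of the subdivision either lies in a subdivided face or joins the
barycentre to a point of the convex hull. The latter is short because the hull lies in a ball about
the barycentre, which is why the hull condition is carried along. -/
theorem subdivision_single_mem (hK : Convex ℝ K) (n : ℕ) {k : ℕ} (hk : k ≤ n + 1) {r : ℝ}
    (hr : 0 ≤ r) (v : (tupleSystem K).simplex k) (hv : tupleSystem.DiamLE r v) :
    tupleSystem.subdivision (affineBarycenter hK) k (Finsupp.single v 1) ∈
      Finsupp.supported ℤ ℤ {w : (tupleSystem K).simplex k |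
        (∀ i : Fin k, ((show Fin k → K from w) i : E) ∈
          convexHull ℝ (Set.range fun j : Fin k => ((show Fin k → K from v) j : E))) ∧
        tupleSystem.DiamLE (n / (n + 1) * r) w} := by
  induction k with
  | zero =>
    rw [tupleSystem.subdivision_zero, LinearMap.id_apply]
    exact Finsupp.single_mem_supported _ _ ⟨fun i => i.elim0, fun i => i.elim0⟩
  | succ k ih =>
    rw [tupleSystem.subdivision_succ_single, FaceSystem.d_single, map_sum, map_sum]
    refine Submodule.sum_mem _ fun i _ => ?_
    rw [map_smul, map_smul]
    refine Submodule.smul_mem _ _ (LinearMap.mem_of_mem_supported _ ?_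
      (ih (by omega) _ fun a b => hv (i.succAbove a) (i.succAbove b)))
    rintro w ⟨hw, hw'⟩
    rw [tupleSystem.cone_single]
    refine Finsupp.single_mem_supported _ _ ?_
    set v' : Fin (k + 1) → K := v with hv'
    set w' : Fin k → K := w with hw''
    have hc : (k : ℝ) / (k + 1) * r ≤ n / (n + 1) * r := by
      refine mul_le_mul_of_nonneg_right ?_ hr
      rw [div_le_div_iff₀ (by positivity) (by positivity)]
      have : (k : ℝ) ≤ n := by exact_mod_cast Nat.le_of_succ_le_succ hk
      nlinarith
    have hsub : ∀ j, (w' j : E) ∈ convexHull ℝ (Set.range fun j => (v' j : E)) := by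
      refine fun j => convexHull_mono ?_ (hw j)
      rintro _ ⟨a, rfl⟩
      exact ⟨i.succAbove a, rfl⟩
    have hball : ∀ j, dist (affineBarycenter hK k v : E) (w' j) ≤ n / (n + 1) * r := by
      intro j
      have : convexHull ℝ (Set.range fun j => (v' j : E)) ⊆
          Metric.closedBall (affineBarycenter hK k v : E) (n / (n + 1) * r) := by
        refine convexHull_min ?_ (convex_closedBall _ _)
        rintro _ ⟨a, rfl⟩
        rw [Metric.mem_closedBall, dist_comm]
        exact (dist_affineBarycenter_le hK v hv a).trans hc
      have := this (hsub j)
      rwa [Metric.mem_closedBall, dist_comm] at this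
    refine ⟨fun j => ?_, fun a b => ?_⟩
    · change ((Fin.cons (affineBarycenter hK k v) w' : Fin (k + 1) → K) j : E) ∈ _
      refine Fin.cases ?_ (fun j => ?_) j
      · rw [Fin.cons_zero, affineBarycenter, coe_affineMap]
        exact (convex_convexHull ℝ _).sum_mem (fun i _ => stdSimplex.barycenter.2.1 i)
          stdSimplex.barycenter.2.2 fun i _ => subset_convexHull _ _ ⟨i, rfl⟩
      · rw [Fin.cons_succ]
        exact hsub j
    · change dist ((Fin.cons (affineBarycenter hK k v) w' : Fin (k + 1) → K) a)
        ((Fin.cons (affineBarycenter hK k v) w' : Fin (k + 1) → K) b) ≤ _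
      refine Fin.cases ?_ (fun a => ?_) a <;> refine Fin.cases ?_ (fun b => ?_) b
      · rw [dist_self]
        positivity
      · rw [Fin.cons_zero, Fin.cons_succ]
        exact hball b
      · rw [Fin.cons_zero, Fin.cons_succ, dist_comm]
        exact hball a
      · rw [Fin.cons_succ, Fin.cons_succ]
        exact hw' a b

/-- A simplex with k vertices has dimension k - 1, but n = k is used: the factor k / (k + 1) is
still below 1 and avoids a subtraction. -/
theorem subdivision_iterate_mem (hK : Convex ℝ K) {k : ℕ} {r : ℝ}
    (hr : 0 ≤ r) (v : (tupleSystem K).simplex k) (hv : tupleSystem.DiamLE r v) (N : ℕ) :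
    (tupleSystem.subdivision (affineBarycenter hK) k ^ N) (Finsupp.single v 1) ∈
      Finsupp.supported ℤ ℤ
        {w : (tupleSystem K).simplex k | tupleSystem.DiamLE ((k / (k + 1) : ℝ) ^ N * r) w} := by
  induction N with
  | zero => simpa using Finsupp.single_mem_supported _ _ hv
  | succ N ih =>
    rw [pow_succ' (tupleSystem.subdivision (affineBarycenter hK) k), Module.End.mul_apply]
    refine LinearMap.mem_of_mem_supported _ (fun w hw => ?_) ih
    refine Finsupp.supported_mono ?_
      (subdivision_single_mem hK k (Nat.le_succ k) (by positivity) w hw)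
    rintro w' ⟨-, hw'⟩
    rwa [Set.mem_ofPred_eq, pow_succ', mul_assoc]

theorem dist_affineMap_le (hK : Convex ℝ K) {k : ℕ} {r : ℝ} (v : (tupleSystem K).simplex k)
    (hv : tupleSystem.DiamLE r v) (t : stdSimplex ℝ (Fin k)) (i : Fin k) :
    dist (affineMap hK v t) ((show Fin k → K from v) i) ≤ r :=
  Metric.mem_closedBall.1 ((convex_closedBall ((show Fin k → K from v) i : E) r).sum_mem
    (fun i _ => t.2.1 i) t.2.2 fun j _ => hv j i)

end Diameter

section Small

variable {X : Type u₁} [TopologicalSpace X] {Y : Type u₂} [TopologicalSpace Y]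

/-- The chains all of whose simplices lie in a given set. -/
def chainsIn (A : Set X) (k : ℕ) : Submodule ℤ ((singularSystem X).Chain k) :=
  Finsupp.supported ℤ ℤ {σ : (singularSystem X).simplex k |
    Set.range (show C(stdSimplex ℝ (Fin k), X) from σ) ⊆ A}

theorem chainsIn_mono {A B : Set X} (h : A ⊆ B) (k : ℕ) : chainsIn A k ≤ chainsIn B k :=
  Finsupp.supported_mono fun _ hσ => hσ.trans h

theorem chainsIn_inf (A B : Set X) (k : ℕ) : chainsIn A k ⊓ chainsIn B k = chainsIn (A ∩ B) k := by
  rw [chainsIn, chainsIn, ← Finsupp.supported_inter, chainsIn]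
  congr 1
  ext σ
  exact Set.subset_inter_iff.symm

theorem chainMap_mem_chainsIn (f : C(Y, X)) (k : ℕ) (y : (singularSystem Y).Chain k) :
    (singularMap f).chainMap k y ∈ chainsIn (Set.range f) k := by
  refine LinearMap.mem_of_mem_supported (s := Set.univ) _ (fun σ _ => ?_) (by simp)
  rw [FaceSystem.Hom.chainMap_single]
  refine Finsupp.single_mem_supported _ _ ?_
  rintro _ ⟨t, rfl⟩
  exact ⟨_, rfl⟩

theorem exists_chainMap_eq {f : C(Y, X)} (hf : Topology.IsInducing f) {k : ℕ}
    {x : (singularSystem X).Chain k} (hx : x ∈ chainsIn (Set.range f) k) :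
    ∃ y, (singularMap f).chainMap k y = x := by
  refine LinearMap.mem_of_mem_supported LinearMap.id
    (p := LinearMap.range ((singularMap f).chainMap k)) (fun σ hσ => ?_) hx
  change Set.range (show C(stdSimplex ℝ (Fin k), X) from σ) ⊆ _ at hσ
  choose g hg using fun t => hσ ⟨t, rfl⟩
  refine ⟨Finsupp.single (show (singularSystem Y).simplex k from
    (⟨g, hf.continuous_iff.2 ?_⟩ : C(stdSimplex ℝ (Fin k), Y))) 1, ?_⟩
  · have : f ∘ g = (show C(stdSimplex ℝ (Fin k), X) from σ) := funext hg
    rw [this]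
    exact ContinuousMap.continuous _
  · rw [FaceSystem.Hom.chainMap_single, LinearMap.id_apply]
    congr 1
    exact ContinuousMap.ext hg

theorem singularMap_toFun_injective {f : C(Y, X)} (hf : Function.Injective f) (k : ℕ) :
    Function.Injective ((singularMap f).toFun k) :=
  fun _ _ h => ContinuousMap.ext fun t => hf (ContinuousMap.congr_fun h t)

theorem singularMap_chainMap_injective {f : C(Y, X)} (hf : Function.Injective f) (k : ℕ) :
    Function.Injective ((singularMap f).chainMap k) :=
  Finsupp.mapDomain_injective (singularMap_toFun_injective hf k)

theorem chainMap_singularSubdivision (f : C(Y, X)) (k : ℕ) (y : (singularSystem Y).Chain k) :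
    (singularMap f).chainMap k (singularSubdivision Y k y) =
      singularSubdivision X k ((singularMap f).chainMap k y) := by
  suffices ((singularMap f).chainMap k).comp (singularSubdivision Y k) =
      (singularSubdivision X k).comp ((singularMap f).chainMap k) from LinearMap.congr_fun this y
  refine Finsupp.lhom_ext' fun σ => LinearMap.ext_ring ?_
  simp only [LinearMap.comp_apply, Finsupp.lsingle_apply]
  rw [FaceSystem.Hom.chainMap_single]
  refine Eq.trans (congrArg _ (liftOperation_single (e := fun k => k) _ σ))
    (Eq.trans ?_ (liftOperation_single (e := fun k => k) _ _).symm)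
  have h : singularMap ((singularMap f).toFun k σ) = (singularMap σ).comp (singularMap f) := rfl
  rw [h, FaceSystem.Hom.chainMap_comp]

theorem chainMap_singularSubdivision_pow (f : C(Y, X)) (k : ℕ) (y : (singularSystem Y).Chain k)
    (N : ℕ) : (singularMap f).chainMap k ((singularSubdivision Y k ^ N) y) =
      (singularSubdivision X k ^ N) ((singularMap f).chainMap k y) := by
  induction N with
  | zero => rfl
  | succ N ih =>
    rw [pow_succ', pow_succ', Module.End.mul_apply, Module.End.mul_apply,
      chainMap_singularSubdivision, ih]

theorem d_singularSubdivision_pow (k : ℕ) (x : (singularSystem X).Chain (k + 1)) (N : ℕ) :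
    (singularSystem X).d k ((singularSubdivision X (k + 1) ^ N) x) =
      (singularSubdivision X k ^ N) ((singularSystem X).d k x) := by
  induction N with
  | zero => rfl
  | succ N ih =>
    rw [pow_succ', pow_succ', Module.End.mul_apply, Module.End.mul_apply,
      d_singularSubdivision, ih]

theorem singularSubdivision_zero : singularSubdivision X 0 = LinearMap.id := by
  refine Finsupp.lhom_ext' fun σ => LinearMap.ext_ring ?_
  simp only [LinearMap.comp_apply, Finsupp.lsingle_apply, LinearMap.id_apply]
  rw [single_eq_chainMap_stdVertices, singularSubdivision_chainMap]
  rfl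

theorem singularSubdivision_mem_cycles {k : ℕ} {z : (singularSystem X).Chain k}
    (hz : z ∈ (singularSystem X).cycles k) :
    singularSubdivision X k z ∈ (singularSystem X).cycles k := by
  cases k with
  | zero => rwa [singularSubdivision_zero]
  | succ k =>
    rw [FaceSystem.mem_cycles, FaceSystem.dFrom_succ] at hz ⊢
    rw [d_singularSubdivision, hz, map_zero]

theorem exists_d_eq_sub_singularSubdivision {k : ℕ} {z : (singularSystem X).Chain k}
    (hz : z ∈ (singularSystem X).cycles k) :
    ∃ w, (singularSystem X).d k w = z - singularSubdivision X k z := by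
  cases k with
  | zero => exact ⟨0, by simp [singularSubdivision_zero]⟩
  | succ k =>
    rw [FaceSystem.mem_cycles, FaceSystem.dFrom_succ] at hz
    exact ⟨singularSubdivisionHomotopy X (k + 1) z, by
      rw [← d_singularSubdivisionHomotopy, hz, map_zero, add_zero]⟩

theorem singularSubdivision_pow_mem_cycles {k : ℕ} {z : (singularSystem X).Chain k}
    (hz : z ∈ (singularSystem X).cycles k) (N : ℕ) :
    (singularSubdivision X k ^ N) z ∈ (singularSystem X).cycles k := by
  induction N with
  | zero => exact hz
  | succ N ih =>
    rw [pow_succ', Module.End.mul_apply]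
    exact singularSubdivision_mem_cycles ih

theorem exists_d_eq_sub_singularSubdivision_pow {k : ℕ} {z : (singularSystem X).Chain k}
    (hz : z ∈ (singularSystem X).cycles k) (N : ℕ) :
    ∃ w, (singularSystem X).d k w = z - (singularSubdivision X k ^ N) z := by
  induction N with
  | zero => exact ⟨0, by simp⟩
  | succ N ih =>
    obtain ⟨w, hw⟩ := ih
    obtain ⟨w', hw'⟩ := exists_d_eq_sub_singularSubdivision
      (singularSubdivision_pow_mem_cycles hz N)
    refine ⟨w + w', ?_⟩
    rw [map_add, hw, hw', pow_succ', Module.End.mul_apply]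
    abel

theorem singularSubdivision_mem_chainsIn {A : Set X} {k : ℕ} {x : (singularSystem X).Chain k}
    (hx : x ∈ chainsIn A k) : singularSubdivision X k x ∈ chainsIn A k := by
  refine LinearMap.mem_of_mem_supported _ (fun σ hσ => ?_) hx
  rw [single_eq_chainMap_stdVertices, singularSubdivision_chainMap]
  exact chainsIn_mono hσ k (chainMap_mem_chainsIn _ _ _)

theorem singularSubdivision_pow_mem_sup {A B : Set X} {k N N' : ℕ} (h : N ≤ N')
    {x : (singularSystem X).Chain k}
    (hx : (singularSubdivision X k ^ N) x ∈ chainsIn A k ⊔ chainsIn B k) :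
    (singularSubdivision X k ^ N') x ∈ chainsIn A k ⊔ chainsIn B k := by
  induction h with
  | refl => exact hx
  | step _ ih =>
    rw [pow_succ', Module.End.mul_apply]
    obtain ⟨a, ha, b, hb, hab⟩ := Submodule.mem_sup.1 ih
    rw [← hab, map_add]
    exact Submodule.add_mem_sup (singularSubdivision_mem_chainsIn ha)
      (singularSubdivision_mem_chainsIn hb)

/-- Iterated subdivision makes a singular chain subordinate to an open cover by two sets. -/
theorem exists_singularSubdivision_pow_mem {A B : Set X} (hA : IsOpen A) (hB : IsOpen B)
    (hAB : A ∪ B = Set.univ) {k : ℕ} (x : (singularSystem X).Chain k) :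
    ∃ N, (singularSubdivision X k ^ N) x ∈ chainsIn A k ⊔ chainsIn B k := by
  induction x using Finsupp.induction_linear with
  | zero => exact ⟨0, by simp⟩
  | add x y hx hy =>
    obtain ⟨N, hN⟩ := hx
    obtain ⟨N', hN'⟩ := hy
    refine ⟨max N N', ?_⟩
    rw [map_add]
    exact add_mem (singularSubdivision_pow_mem_sup (le_max_left _ _) hN)
      (singularSubdivision_pow_mem_sup (le_max_right _ _) hN')
  | single σ n =>
    suffices ∃ N, (singularSubdivision X k ^ N) (Finsupp.single σ 1) ∈
        chainsIn A k ⊔ chainsIn B k by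
      obtain ⟨N, hN⟩ := this
      refine ⟨N, ?_⟩
      rw [← mul_one n, ← smul_eq_mul, ← Finsupp.smul_single, map_smul]
      exact Submodule.smul_mem _ _ hN
    set s : C(stdSimplex ℝ (Fin k), X) := σ with hs
    -- A Lebesgue number: every δ-ball of the model simplex is mapped into A or into B.
    obtain ⟨δ, hδ, hball⟩ := lebesgue_number_lemma_of_metric
      (s := (Set.univ : Set (stdSimplex ℝ (Fin k)))) (c := fun b : Bool => cond b (s ⁻¹' A) (s ⁻¹' B))
      isCompact_univ
      (by rintro (_ | _); exacts [hB.preimage s.continuous, hA.preimage s.continuous])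
      (fun t _ => by
        rcases (hAB ▸ Set.mem_univ (s t) : s t ∈ A ∪ B) with h | h
        · exact Set.mem_iUnion.2 ⟨true, h⟩
        · exact Set.mem_iUnion.2 ⟨false, h⟩)
    obtain ⟨N, hN⟩ := exists_pow_lt_of_lt_one hδ
      (show (k / (k + 1) : ℝ) < 1 by rw [div_lt_one (by positivity)]; linarith)
    refine ⟨N, ?_⟩
    have hpow (y : (tupleSystem (stdSimplex ℝ (Fin k))).Chain k) :
        (singularSubdivision X k ^ N) ((singularMap s).chainMap k
          ((affineSimplex (convex_stdSimplex ℝ (Fin k))).chainMap k y)) =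
        (singularMap s).chainMap k ((affineSimplex (convex_stdSimplex ℝ (Fin k))).chainMap k
          ((tupleSystem.subdivision (affineBarycenter (convex_stdSimplex ℝ (Fin k))) k ^ N) y)) := by
      clear hN
      induction N with
      | zero => rfl
      | succ N ih =>
        rw [pow_succ', pow_succ', Module.End.mul_apply, Module.End.mul_apply, ih]
        exact singularSubdivision_chainMap σ _
    rw [single_eq_chainMap_stdVertices]
    refine Set.mem_of_eq_of_mem (hpow _) ?_
    -- In the sup metric the vertices of the standard simplex are at distance at most 1, so r = 1.
    have hmem := subdivision_iterate_mem (convex_stdSimplex ℝ (Fin k)) zero_le_one (stdVertices k)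
      (fun i j => (dist_pi_le_iff zero_le_one).2 fun l => by
        have h1 := mem_Icc_of_mem_stdSimplex (stdSimplex.vertex (S := ℝ) i).2 l
        have h2 := mem_Icc_of_mem_stdSimplex (stdSimplex.vertex (S := ℝ) j).2 l
        exact Real.dist_le_of_mem_Icc_01 h1 h2) N
    refine LinearMap.mem_of_mem_supported (((singularMap s).chainMap k).comp
      ((affineSimplex (convex_stdSimplex ℝ (Fin k))).chainMap k)) (fun w hw => ?_) hmem
    rw [LinearMap.comp_apply, FaceSystem.Hom.chainMap_single, FaceSystem.Hom.chainMap_single]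
    have key : Set.range (s.comp (affineMap (convex_stdSimplex ℝ (Fin k)) w)) ⊆ A ∨
        Set.range (s.comp (affineMap (convex_stdSimplex ℝ (Fin k)) w)) ⊆ B := by
      rcases Nat.eq_zero_or_pos k with rfl | hk
      · left
        have : IsEmpty (stdSimplex ℝ (Fin 0)) := by
          rw [stdSimplex_of_isEmpty_index]
          infer_instance
        rintro _ ⟨t, rfl⟩
        exact isEmptyElim t
      -- A subdivided simplex lies within its mesh of its first vertex, hence in a single δ-ball.
      · obtain ⟨b, hb⟩ := hball ((show Fin k → _ from w) ⟨0, hk⟩) (Set.mem_univ _)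
        have this (t) : affineMap (convex_stdSimplex ℝ (Fin k)) w t ∈ cond b (s ⁻¹' A) (s ⁻¹' B) :=
          hb (Metric.mem_ball.2 ((dist_affineMap_le _ w hw t ⟨0, hk⟩).trans_lt (by simpa using hN)))
        cases b
        · right
          rintro _ ⟨t, rfl⟩
          exact this t
        · left
          rintro _ ⟨t, rfl⟩
          exact this t
    rcases key with h | h
    · exact Submodule.mem_sup_left (Finsupp.single_mem_supported _ _ h)
    · exact Submodule.mem_sup_right (Finsupp.single_mem_supported _ _ h)

end Small

/-! ### The Mayer–Vietoris sequence -/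

/-- A commutative square of inclusions exhibiting `Y` as the union of two open subspaces `U` and `V`
with intersection `W`. -/
structure IsOpenUnion {W : Type*} {U : Type*} {V : Type*} {Y : Type*} [TopologicalSpace W]
    [TopologicalSpace U] [TopologicalSpace V] [TopologicalSpace Y]
    (jU : C(W, U)) (jV : C(W, V)) (iU : C(U, Y)) (iV : C(V, Y)) : Prop where
  comm : iU.comp jU = iV.comp jV
  isEmbedding : Topology.IsEmbedding jU
  isOpenEmbedding_left : Topology.IsOpenEmbedding iU
  isOpenEmbedding_right : Topology.IsOpenEmbedding iV
  union : Set.range iU ∪ Set.range iV = Set.univ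
  inter : ∀ u v, iU u = iV v → u ∈ Set.range jU

namespace IsOpenUnion

variable {W U V Y : Type*} [TopologicalSpace W] [TopologicalSpace U] [TopologicalSpace V]
  [TopologicalSpace Y] {jU : C(W, U)} {jV : C(W, V)} {iU : C(U, Y)} {iV : C(V, Y)}
  (h : IsOpenUnion jU jV iU iV)

include h

theorem chainMap_comm (k : ℕ) (w : (singularSystem W).Chain k) :
    (singularMap iU).chainMap k ((singularMap jU).chainMap k w) =
      (singularMap iV).chainMap k ((singularMap jV).chainMap k w) := by
  rw [← FaceSystem.Hom.chainMap_comp, ← FaceSystem.Hom.chainMap_comp, ← singularMap_comp,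
    ← singularMap_comp, h.comm]

/-- A chain carried both by U and by V has all its simplices in the intersection: exactness of the
chain-level sequence in the middle. -/
theorem exists_of_chainMap_eq {k : ℕ} {a : (singularSystem U).Chain k}
    {b : (singularSystem V).Chain k}
    (hab : (singularMap iU).chainMap k a = (singularMap iV).chainMap k b) :
    ∃ w, (singularMap jU).chainMap k w = a ∧ (singularMap jV).chainMap k w = b := by
  have h1 : (singularMap iU).chainMap k a ∈ chainsIn (Set.range (iU.comp jU)) k := by
    refine chainsIn_mono ?_ k ((chainsIn_inf _ _ k).le
      ⟨chainMap_mem_chainsIn iU k a, hab ▸ chainMap_mem_chainsIn iV k b⟩)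
    rintro _ ⟨⟨u, rfl⟩, v, hv⟩
    obtain ⟨w, rfl⟩ := h.inter u v hv.symm
    exact ⟨w, rfl⟩
  obtain ⟨w, hw⟩ := exists_chainMap_eq
    (h.isOpenEmbedding_left.isEmbedding.comp h.isEmbedding).isInducing h1
  rw [singularMap_comp, FaceSystem.Hom.chainMap_comp] at hw
  have hU := singularMap_chainMap_injective h.isOpenEmbedding_left.injective k hw
  refine ⟨w, hU, singularMap_chainMap_injective h.isOpenEmbedding_right.injective k ?_⟩
  rw [← h.chainMap_comm, hw, hab]

theorem exists_subdivision (k : ℕ) (y : (singularSystem Y).Chain k) :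
    ∃ N a b, (singularSubdivision Y k ^ N) y =
      (singularMap iU).chainMap k a + (singularMap iV).chainMap k b := by
  obtain ⟨N, hN⟩ := exists_singularSubdivision_pow_mem h.isOpenEmbedding_left.isOpen_range
    h.isOpenEmbedding_right.isOpen_range h.union y
  obtain ⟨a, ha, b, hb, hab⟩ := Submodule.mem_sup.1 hN
  obtain ⟨a, rfl⟩ := exists_chainMap_eq h.isOpenEmbedding_left.isInducing ha
  obtain ⟨b, rfl⟩ := exists_chainMap_eq h.isOpenEmbedding_right.isInducing hb
  exact ⟨N, a, b, hab.symm⟩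

/-- The Mayer–Vietoris connecting homomorphism and its exactness properties. -/
theorem exists_connecting (k : ℕ) :
    ∃ δ : (singularSystem Y).Homology (k + 1) →ₗ[ℤ] (singularSystem W).Homology k,
      LinearMap.ker δ ≤ LinearMap.range ((singularMap iU).homologyMap (k + 1)) ⊔
        LinearMap.range ((singularMap iV).homologyMap (k + 1)) ∧
      ∀ w, (singularMap jU).homologyMap k w = 0 → (singularMap jV).homologyMap k w = 0 →
        w ∈ LinearMap.range δ := by
  let s : (singularSystem U).Chain (k + 1) × (singularSystem V).Chain (k + 1) →ₗ[ℤ]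
      (singularSystem Y).Chain (k + 1) :=
    ((singularMap iU).chainMap (k + 1)).coprod ((singularMap iV).chainMap (k + 1))
  -- M consists of the pairs (a, b) whose sum is a cycle in Y. The connecting map should send the
  -- class of a + b to that of da = -db, a cycle of W. It is obtained by factoring `q : M → H(W)`
  -- through the surjection `p : M → H(Y)`, which avoids choosing decompositions linearly.
  let M : Submodule ℤ ((singularSystem U).Chain (k + 1) × (singularSystem V).Chain (k + 1)) :=
    ((singularSystem Y).cycles (k + 1)).comap s
  have hs (a b) : s (a, b) = (singularMap iU).chainMap (k + 1) a +
    (singularMap iV).chainMap (k + 1) b := rfl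
  let p : M →ₗ[ℤ] (singularSystem Y).Homology (k + 1) :=
    ((singularSystem Y).toHomology (k + 1)).comp (s.restrict fun _ hx => hx)
  have hM (m : M) : (singularMap iU).chainMap k ((singularSystem U).d k m.1.1) =
      (singularMap iV).chainMap k (-(singularSystem V).d k m.1.2) := by
    rw [map_neg, ← FaceSystem.Hom.d_chainMap, ← FaceSystem.Hom.d_chainMap, eq_neg_iff_add_eq_zero,
      ← map_add]
    exact m.2
  have hjU := singularMap_chainMap_injective h.isEmbedding.injective k
  let q₀ : M →ₗ[ℤ] (singularSystem W).Chain k :=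
    (LinearEquiv.ofInjective _ hjU).symm.toLinearMap.comp
      ((((singularSystem U).d k).comp ((LinearMap.fst ℤ _ _).comp M.subtype)).codRestrict
        (LinearMap.range ((singularMap jU).chainMap k)) fun m => by
          obtain ⟨w, hw, -⟩ := h.exists_of_chainMap_eq (hM m)
          exact ⟨w, hw⟩)
  have hq₀ (m : M) : (singularMap jU).chainMap k (q₀ m) = (singularSystem U).d k m.1.1 := by
    have := (LinearEquiv.ofInjective _ hjU).apply_symm_apply
      ((((singularSystem U).d k).comp ((LinearMap.fst ℤ _ _).comp M.subtype)).codRestrict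
        (LinearMap.range ((singularMap jU).chainMap k)) (fun m => by
          obtain ⟨w, hw, -⟩ := h.exists_of_chainMap_eq (hM m)
          exact ⟨w, hw⟩) m)
    exact congrArg Subtype.val this
  have hq₀V (m : M) : (singularMap jV).chainMap k (q₀ m) = -(singularSystem V).d k m.1.2 := by
    refine singularMap_chainMap_injective h.isOpenEmbedding_right.injective k ?_
    rw [← h.chainMap_comm, hq₀, hM]
  have hq₀c (m : M) : q₀ m ∈ (singularSystem W).cycles k := by
    refine FaceSystem.Hom.mem_cycles_of_chainMap (singularMap jU)
      (singularMap_toFun_injective h.isEmbedding.injective) ?_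
    rw [hq₀, FaceSystem.mem_cycles, FaceSystem.dFrom_d]
  let q : M →ₗ[ℤ] (singularSystem W).Homology k :=
    ((singularSystem W).toHomology k).comp (q₀.codRestrict _ hq₀c)
  have hp : Function.Surjective p := by
    intro y
    obtain ⟨z, hz, rfl⟩ := FaceSystem.exists_toHomology_eq _ y
    obtain ⟨N, a, b, hab⟩ := h.exists_subdivision (k + 1) z
    obtain ⟨w, hw⟩ := exists_d_eq_sub_singularSubdivision_pow hz N
    refine ⟨⟨(a, b), ?_⟩, ?_⟩
    · change s (a, b) ∈ (singularSystem Y).cycles (k + 1)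
      rw [hs, ← hab]
      exact singularSubdivision_pow_mem_cycles hz N
    · refine ((FaceSystem.toHomology_eq_iff _).2 ⟨w, ?_⟩).symm
      exact hw.trans (congrArg (z - ·) hab)
  -- Well-definedness: if a + b = dy, subdivide y into y₁ + y₂. Then Sd^N a - dy₁ = dy₂ - Sd^N b is
  -- a chain c of W, and dc = Sd^N q₀, which is homologous to q₀.
  have hpq : LinearMap.ker p ≤ LinearMap.ker q := by
    rintro ⟨⟨a, b⟩, hm⟩ hker
    obtain ⟨y, hy⟩ := (FaceSystem.toHomology_eq_zero _).1 hker
    change (singularSystem Y).d (k + 1) y = s (a, b) at hy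
    refine (FaceSystem.toHomology_eq_zero _).2 ?_
    change ∃ w, (singularSystem W).d k w = q₀ ⟨(a, b), hm⟩
    obtain ⟨N, y₁, y₂, hN⟩ := h.exists_subdivision (k + 2) y
    have h1 : (singularMap iU).chainMap (k + 1)
          ((singularSubdivision U (k + 1) ^ N) a - (singularSystem U).d (k + 1) y₁) =
        (singularMap iV).chainMap (k + 1)
          ((singularSystem V).d (k + 1) y₂ - (singularSubdivision V (k + 1) ^ N) b) := by
      rw [map_sub, map_sub, chainMap_singularSubdivision_pow, chainMap_singularSubdivision_pow,
        ← FaceSystem.Hom.d_chainMap, ← FaceSystem.Hom.d_chainMap, sub_eq_sub_iff_add_eq_add,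
        ← map_add, ← map_add, ← hs, ← hy, ← d_singularSubdivision_pow, hN,
        add_comm ((singularMap iU).chainMap (k + 2) y₁)]
    obtain ⟨c, hc, -⟩ := h.exists_of_chainMap_eq h1
    have h2 : (singularSystem W).d k c = (singularSubdivision W k ^ N) (q₀ ⟨(a, b), hm⟩) := by
      refine hjU ?_
      rw [← FaceSystem.Hom.d_chainMap, hc, map_sub, FaceSystem.d_d, sub_zero,
        d_singularSubdivision_pow, chainMap_singularSubdivision_pow, hq₀]
    obtain ⟨w, hw⟩ := exists_d_eq_sub_singularSubdivision_pow (hq₀c ⟨(a, b), hm⟩) N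
    exact ⟨w + c, by rw [map_add, hw, h2, sub_add_cancel]⟩
  let δ : (singularSystem Y).Homology (k + 1) →ₗ[ℤ] (singularSystem W).Homology k :=
    ((LinearMap.ker p).liftQ q hpq).comp (p.quotKerEquivOfSurjective hp).symm.toLinearMap
  have hδ (m : M) : δ (p m) = q m := by
    have : (p.quotKerEquivOfSurjective hp).symm (p m) = Submodule.Quotient.mk m := by
      rw [LinearEquiv.symm_apply_eq]
      rfl
    change (LinearMap.ker p).liftQ q hpq ((p.quotKerEquivOfSurjective hp).symm (p m)) = _
    rw [this]
    rfl
  refine ⟨δ, fun y hy => ?_, fun w hwU hwV => ?_⟩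
  -- If q₀ = dc, then a - c and b + c are cycles in U and V with sum a + b.
  · obtain ⟨⟨⟨a, b⟩, hm⟩, rfl⟩ := hp y
    rw [LinearMap.mem_ker, hδ] at hy
    obtain ⟨c, hc⟩ := (FaceSystem.toHomology_eq_zero _).1 hy
    change (singularSystem W).d k c = q₀ ⟨(a, b), hm⟩ at hc
    have ha : a - (singularMap jU).chainMap (k + 1) c ∈ (singularSystem U).cycles (k + 1) := by
      rw [FaceSystem.mem_cycles, FaceSystem.dFrom_succ, map_sub, FaceSystem.Hom.d_chainMap, hc,
        hq₀, sub_self]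
    have hb : b + (singularMap jV).chainMap (k + 1) c ∈ (singularSystem V).cycles (k + 1) := by
      rw [FaceSystem.mem_cycles, FaceSystem.dFrom_succ, map_add, FaceSystem.Hom.d_chainMap, hc,
        hq₀V, add_neg_cancel]
    refine Submodule.mem_sup.2 ⟨_, ⟨FaceSystem.toHomology _ _ ⟨_, ha⟩, rfl⟩, _,
      ⟨FaceSystem.toHomology _ _ ⟨_, hb⟩, rfl⟩, ?_⟩
    rw [FaceSystem.Hom.homologyMap_toHomology, FaceSystem.Hom.homologyMap_toHomology, ← map_add]
    refine congrArg _ (Subtype.ext ?_)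
    change (singularMap iU).chainMap _ _ + (singularMap iV).chainMap _ _ = s (a, b)
    rw [hs, map_sub, map_add, h.chainMap_comm]
    abel
  · obtain ⟨w, hw, rfl⟩ := FaceSystem.exists_toHomology_eq _ w
    obtain ⟨a, ha⟩ := ((singularMap jU).homologyMap_eq_zero_iff k w hw).1 hwU
    obtain ⟨b, hb⟩ := ((singularMap jV).homologyMap_eq_zero_iff k w hw).1 hwV
    -- If w bounds a in U and b in V, then a - b is a cycle in Y whose connecting image is w.
    have hm : (a, -b) ∈ M := by
      change (singularSystem Y).d k (s (a, -b)) = 0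
      rw [hs, map_add, FaceSystem.Hom.d_chainMap, FaceSystem.Hom.d_chainMap, map_neg, ha, hb,
        h.chainMap_comm, map_neg, add_neg_cancel]
    refine ⟨p ⟨(a, -b), hm⟩, ?_⟩
    rw [hδ]
    refine congrArg _ (Subtype.ext (hjU ?_))
    exact (hq₀ _).trans ha

end IsOpenUnion

end

noncomputable section


/-! ### Homotopy equivalences, contractible spaces and index zero -/

section Homotopy

variable {X : Type u₁} [TopologicalSpace X] {Y : Type u₂} [TopologicalSpace Y]

theorem homologyMap_id (k : ℕ) (x : (singularSystem X).Homology k) :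
    (singularMap (ContinuousMap.id X)).homologyMap k x = x := by
  obtain ⟨z, hz, rfl⟩ := FaceSystem.exists_toHomology_eq _ x
  rw [FaceSystem.Hom.homologyMap_toHomology]
  refine congrArg _ (Subtype.ext ?_)
  exact Finsupp.mapDomain_id

/-- Homotopy equivalent spaces have isomorphic homology. -/
def homologyEquiv (e : ContinuousMap.HomotopyEquiv X Y) (k : ℕ) :
    (singularSystem X).Homology k ≃ₗ[ℤ] (singularSystem Y).Homology k :=
  LinearEquiv.ofLinearMap ((singularMap e.toFun).homologyMap k) ((singularMap e.invFun).homologyMap k)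
    (by
      obtain ⟨F⟩ := e.right_inv
      refine LinearMap.ext fun x => ?_
      rw [LinearMap.comp_apply, ← FaceSystem.Hom.homologyMap_comp, ← singularMap_comp,
        homologyMap_eq_of_homotopy F, homologyMap_id, LinearMap.id_apply])
    (by
      obtain ⟨F⟩ := e.left_inv
      refine LinearMap.ext fun x => ?_
      rw [LinearMap.comp_apply, ← FaceSystem.Hom.homologyMap_comp, ← singularMap_comp,
        homologyMap_eq_of_homotopy F, homologyMap_id, LinearMap.id_apply])

/-- Each index holds a single simplex, and raising the index by one behaves like coning: dD = id -
Dd. The augmentation makes the complex of a point exact in every index. -/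
theorem subsingleton_homology_of_unique [Unique X] (k : ℕ) :
    Subsingleton ((singularSystem X).Homology k) := by
  have hs (k : ℕ) : Subsingleton ((singularSystem X).simplex k) :=
    ⟨fun σ τ => ContinuousMap.ext fun t => Subsingleton.elim _ _⟩
  let c (k : ℕ) : (singularSystem X).simplex k := ContinuousMap.const _ default
  let D (k : ℕ) : (singularSystem X).Chain k →ₗ[ℤ] (singularSystem X).Chain (k + 1) :=
    Finsupp.lmapDomain ℤ ℤ fun _ => c (k + 1)
  have hD (k : ℕ) (x) : D k (Finsupp.single x 1) = Finsupp.single (c (k + 1)) 1 :=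
    Finsupp.mapDomain_single
  rw [FaceSystem.subsingleton_homology_iff]
  intro z hz
  refine ⟨D k z, ?_⟩
  cases k with
  | zero =>
    suffices ((singularSystem X).d 0).comp (D 0) = LinearMap.id from LinearMap.congr_fun this z
    refine Finsupp.lhom_ext' fun v => LinearMap.ext_ring ?_
    simp [hD]
    congr 1
    exact Subsingleton.elim _ _
  | succ k =>
    suffices ((singularSystem X).d (k + 1)).comp (D (k + 1)) =
        LinearMap.id - (D k).comp ((singularSystem X).d k) by
      have h := LinearMap.congr_fun this z
      simp only [LinearMap.comp_apply, LinearMap.sub_apply, LinearMap.id_apply] at h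
      rw [h, show (singularSystem X).d k z = 0 from hz, map_zero, sub_zero]
    refine Finsupp.lhom_ext' fun v => LinearMap.ext_ring ?_
    simp only [LinearMap.comp_apply, Finsupp.lsingle_apply, hD, LinearMap.sub_apply,
      LinearMap.id_apply, FaceSystem.d_single]
    rw [Fin.sum_univ_succ, map_sum, sub_eq_add_neg, ← Finset.sum_neg_distrib]
    congr 1
    · rw [Fin.val_zero, pow_zero, one_smul]
      congr 1
      exact Subsingleton.elim _ _
    · refine Finset.sum_congr rfl fun i _ => ?_
      rw [map_smul, hD, Fin.val_succ, pow_succ, mul_neg_one, neg_smul]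
      congr 3

theorem subsingleton_homology_of_contractible [ContractibleSpace X] (k : ℕ) :
    Subsingleton ((singularSystem X).Homology k) := by
  obtain ⟨e⟩ := ContractibleSpace.hequiv_unit X
  have := subsingleton_homology_of_unique (X := Unit) k
  exact (homologyEquiv e k).toEquiv.subsingleton

instance : Subsingleton ((singularSystem X).simplex 0) := by
  have : IsEmpty (stdSimplex ℝ (Fin 0)) := by
    rw [stdSimplex_of_isEmpty_index]
    infer_instance
  exact ⟨fun σ τ => ContinuousMap.ext fun t => isEmptyElim t⟩

instance finite_homology_zero : Module.Finite ℤ ((singularSystem X).Homology 0) :=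
  Module.Finite.of_surjective ((singularSystem X).toHomology 0)
    ((singularSystem X).toHomology_surjective 0)

/-- The empty simplex is the boundary of any point. -/
theorem subsingleton_homology_zero [Nonempty X] :
    Subsingleton ((singularSystem X).Homology 0) := by
  rw [FaceSystem.subsingleton_homology_iff]
  intro z _
  let c : (singularSystem X).simplex 1 := ContinuousMap.const _ (Classical.arbitrary X)
  refine ⟨Finsupp.lmapDomain ℤ ℤ (fun _ => c) z, ?_⟩
  suffices ((singularSystem X).d 0).comp (Finsupp.lmapDomain ℤ ℤ fun _ => c) = LinearMap.id from
    LinearMap.congr_fun this z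
  refine Finsupp.lhom_ext' fun v => LinearMap.ext_ring ?_
  simp
  congr 1
  exact Subsingleton.elim _ _

theorem isEmpty_simplex_succ [IsEmpty X] (k : ℕ) : IsEmpty ((singularSystem X).simplex (k + 1)) :=
  ⟨fun σ : C(stdSimplex ℝ (Fin (k + 1)), X) => isEmptyElim (σ (stdSimplex.vertex 0))⟩

theorem subsingleton_homology_of_isEmpty [IsEmpty X] (k : ℕ) :
    Subsingleton ((singularSystem X).Homology (k + 1)) := by
  have := isEmpty_simplex_succ (X := X) k
  exact (FaceSystem.toHomology_surjective _ _).subsingleton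

/-- The empty space plays the role of the sphere of dimension -1; it starts the induction in
`homology_compl_zero`. -/
theorem nonempty_homology_zero_equiv_of_isEmpty [IsEmpty X] :
    Nonempty ((singularSystem X).Homology 0 ≃ₗ[ℤ] ℤ) := by
  have := isEmpty_simplex_succ (X := X) 0
  have h1 : Function.Injective ((singularSystem X).toHomology 0) := by
    rw [← LinearMap.ker_eq_bot, eq_bot_iff]
    intro z hz
    obtain ⟨w, hw⟩ := (FaceSystem.toHomology_eq_zero _).1 hz
    rw [Submodule.mem_bot, Subtype.ext_iff, ← hw, Subsingleton.elim w 0, map_zero]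
    rfl
  have : Unique ((singularSystem X).simplex 0) :=
    { default := (⟨fun t => (by
        have : IsEmpty (stdSimplex ℝ (Fin 0)) := by
          rw [stdSimplex_of_isEmpty_index]
          infer_instance
        exact isEmptyElim t), by
        have : IsEmpty (stdSimplex ℝ (Fin 0)) := by
          rw [stdSimplex_of_isEmpty_index]
          infer_instance
        exact continuous_of_const fun t => isEmptyElim t⟩ : C(stdSimplex ℝ (Fin 0), X))
      uniq := fun _ => Subsingleton.elim _ _ }
  refine ⟨((LinearEquiv.ofBijective _ ⟨h1, FaceSystem.toHomology_surjective _ 0⟩).symm.trans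
    (LinearEquiv.ofTop _ ?_)).trans (Finsupp.uniqueLinearEquiv ℤ ℤ (default : (singularSystem X).simplex 0))⟩
  rw [FaceSystem.cycles, FaceSystem.dFrom_zero, LinearMap.ker_zero]

end Homotopy

namespace IsOpenUnion

section

variable {W U V Y : Type*} [TopologicalSpace W] [TopologicalSpace U] [TopologicalSpace V]
  [TopologicalSpace Y] {jU : C(W, U)} {jV : C(W, V)} {iU : C(U, Y)} {iV : C(V, Y)}
  (h : IsOpenUnion jU jV iU iV)

include h

/-- The kernel of the connecting map sits in a finitely generated subgroup and its image in a
finitely generated group; ℤ is Noetherian. -/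
theorem finite_homology (k : ℕ) [Module.Finite ℤ ((singularSystem U).Homology (k + 1))]
    [Module.Finite ℤ ((singularSystem V).Homology (k + 1))]
    [Module.Finite ℤ ((singularSystem W).Homology k)] :
    Module.Finite ℤ ((singularSystem Y).Homology (k + 1)) := by
  obtain ⟨δ, hδ, -⟩ := h.exists_connecting k
  have h1 : (LinearMap.range ((singularMap iU).homologyMap (k + 1)) ⊔
      LinearMap.range ((singularMap iV).homologyMap (k + 1))).FG :=
    Submodule.FG.sup (Submodule.fg_range _) (Submodule.fg_range _)
  have h2 : (LinearMap.ker δ).FG := Submodule.FG.of_le h1 hδ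
  refine ⟨Submodule.fg_of_fg_map_of_fg_inf_ker δ ?_ (by rwa [top_inf_eq])⟩
  exact IsNoetherian.noetherian _

theorem homologyMap_surjective (k : ℕ) [Subsingleton ((singularSystem V).Homology (k + 1))]
    [Subsingleton ((singularSystem W).Homology k)] :
    Function.Surjective ((singularMap iU).homologyMap (k + 1)) := by
  obtain ⟨δ, hδ, -⟩ := h.exists_connecting k
  intro y
  obtain ⟨a, ⟨u, rfl⟩, b, ⟨v, rfl⟩, rfl⟩ := Submodule.mem_sup.1
    (hδ (LinearMap.mem_ker.2 (Subsingleton.elim (δ y) 0)))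
  exact ⟨u, by rw [Subsingleton.elim v 0, map_zero, add_zero]⟩

theorem nonempty_homology_equiv (k : ℕ) [Subsingleton ((singularSystem U).Homology (k + 1))]
    [Subsingleton ((singularSystem V).Homology (k + 1))]
    [Subsingleton ((singularSystem U).Homology k)]
    [Subsingleton ((singularSystem V).Homology k)] :
    Nonempty ((singularSystem Y).Homology (k + 1) ≃ₗ[ℤ] (singularSystem W).Homology k) := by
  obtain ⟨δ, hδ, hδ'⟩ := h.exists_connecting k
  refine ⟨LinearEquiv.ofBijective δ ⟨?_, fun w =>
    hδ' w (Subsingleton.elim _ _) (Subsingleton.elim _ _)⟩⟩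
  rw [← LinearMap.ker_eq_bot, eq_bot_iff]
  intro y hy
  obtain ⟨a, ⟨u, rfl⟩, b, ⟨v, rfl⟩, rfl⟩ := Submodule.mem_sup.1 (hδ hy)
  rw [Subsingleton.elim u 0, Subsingleton.elim v 0, map_zero, map_zero, add_zero]
  exact zero_mem _

end

/-- The square of inclusions of subsets given by two relatively open subsets. -/
theorem ofSubsets {X : Type*} [TopologicalSpace X] {W U V Y : Set X} (hWU : W ⊆ U) (hWV : W ⊆ V)
    (hUY : U ⊆ Y) (hVY : V ⊆ Y) (hY : Y ⊆ U ∪ V) (hW : U ∩ V ⊆ W)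
    (hU : IsOpen ((↑) ⁻¹' U : Set Y)) (hV : IsOpen ((↑) ⁻¹' V : Set Y)) :
    IsOpenUnion ⟨Set.inclusion hWU, continuous_inclusion hWU⟩
      ⟨Set.inclusion hWV, continuous_inclusion hWV⟩
      ⟨Set.inclusion hUY, continuous_inclusion hUY⟩
      ⟨Set.inclusion hVY, continuous_inclusion hVY⟩ where
  comm := rfl
  isEmbedding := Topology.IsEmbedding.inclusion hWU
  isOpenEmbedding_left := ⟨Topology.IsEmbedding.inclusion hUY, by
    rw [ContinuousMap.coe_mk, Set.range_inclusion]
    exact hU⟩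
  isOpenEmbedding_right := ⟨Topology.IsEmbedding.inclusion hVY, by
    rw [ContinuousMap.coe_mk, Set.range_inclusion]
    exact hV⟩
  union := by
    rw [ContinuousMap.coe_mk, ContinuousMap.coe_mk, Set.range_inclusion, Set.range_inclusion]
    exact Set.eq_univ_of_forall fun y => hY y.2
  inter u v huv := by
    have : (u : X) = v := congrArg Subtype.val huv
    exact ⟨⟨u, hW ⟨u.2, this ▸ v.2⟩⟩, rfl⟩

end IsOpenUnion

/-! ### Homology of punctured Euclidean space -/

section Punctured

variable {E : Type*} [NormedAddCommGroup E] [NormedSpace ℝ E]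

/-- A subset of the punctured space which is a deformation retract of it by radial scaling. -/
theorem nonempty_homotopyEquiv_compl_zero {A : Set E} (hA : A ⊆ {x | x ≠ 0})
    (ρ : ({x | x ≠ 0} : Set E) → ℝ) (hρ : Continuous ρ) (hpos : ∀ x, 0 < ρ x)
    (hmem : ∀ x : ({x | x ≠ 0} : Set E), ρ x • (x : E) ∈ A)
    (hseg : ∀ a (ha : a ∈ A), ∀ s : unitInterval,
      ((s : ℝ) + (1 - s) * ρ ⟨a, hA ha⟩) • a ∈ A) :
    Nonempty (ContinuousMap.HomotopyEquiv A ({x | x ≠ 0} : Set E)) := by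
  have hfac (s : unitInterval) (x) : 0 < (s : ℝ) + (1 - s) * ρ x := by
    rcases s.2.1.eq_or_lt with h | h
    · rw [← h]
      simpa using hpos x
    · exact add_pos_of_pos_of_nonneg h (mul_nonneg (sub_nonneg.2 s.2.2) (hpos x).le)
  refine ⟨
    { toFun := ⟨Set.inclusion hA, continuous_inclusion hA⟩
      invFun := ⟨fun x => ⟨ρ x • (x : E), hmem x⟩,
        (hρ.smul continuous_subtype_val).subtype_mk _⟩
      left_inv := ⟨
        { toFun p := ⟨((p.1 : ℝ) + (1 - p.1) * ρ ⟨p.2, hA p.2.2⟩) • (p.2 : E), hseg _ p.2.2 p.1⟩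
          continuous_toFun := by
            refine Continuous.subtype_mk ?_ _
            have : Continuous fun p : unitInterval × A => ρ ⟨p.2, hA p.2.2⟩ :=
              hρ.comp ((continuous_subtype_val.comp continuous_snd).subtype_mk _)
            fun_prop
          map_zero_left x := Subtype.ext (by simp [Set.inclusion])
          map_one_left x := Subtype.ext (by simp) }⟩
      right_inv := ⟨
        { toFun p := ⟨((p.1 : ℝ) + (1 - p.1) * ρ p.2) • (p.2 : E),
            smul_ne_zero (hfac _ _).ne' p.2.2⟩
          continuous_toFun := by
            refine Continuous.subtype_mk ?_ _
            have : Continuous fun p : unitInterval × ({x | x ≠ 0} : Set E) => ρ p.2 :=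
              hρ.comp continuous_snd
            fun_prop
          map_zero_left x := Subtype.ext (by simp [Set.inclusion])
          map_one_left x := Subtype.ext (by simp) }⟩ }⟩

/-- Scaling by (1 + ‖x‖)⁻¹ sends the punctured space into the punctured unit ball. The factor is at
most 1, so points of the ball stay in it during the homotopy. -/
theorem nonempty_ball_homotopyEquiv :
    Nonempty (ContinuousMap.HomotopyEquiv (Metric.ball (0 : E) 1 \ {0} : Set E)
      ({x | x ≠ 0} : Set E)) := by
  have hpos (x : E) : 0 < (1 + ‖x‖)⁻¹ := by positivity
  refine nonempty_homotopyEquiv_compl_zero (fun x hx => hx.2) (fun x => (1 + ‖(x : E)‖)⁻¹) ?_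
    (fun x => hpos x) (fun x => ⟨?_, smul_ne_zero (hpos x).ne' x.2⟩) fun a ha s => ⟨?_, ?_⟩
  · refine Continuous.inv₀ (by fun_prop) fun x => (by positivity)
  · rw [mem_ball_zero_iff, norm_smul, Real.norm_of_nonneg (hpos x).le, inv_mul_lt_iff₀ (by positivity)]
    linarith
  · have h1 := mem_ball_zero_iff.1 ha.1
    have h2 : (1 + ‖a‖)⁻¹ ≤ 1 := inv_le_one_of_one_le₀ (by linarith [norm_nonneg a])
    have h3 := s.2.1
    have h4 := s.2.2
    have h5 := hpos a
    rw [mem_ball_zero_iff, norm_smul, Real.norm_of_nonneg (by nlinarith)]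
    have : (s : ℝ) + (1 - s) * (1 + ‖a‖)⁻¹ ≤ 1 := by nlinarith
    nlinarith [norm_nonneg a]
  · refine smul_ne_zero ?_ ha.2
    have h3 := s.2.1
    have h4 := s.2.2
    have h5 := hpos a
    rcases h3.eq_or_lt with h | h
    · rw [← h]
      simpa using h5.ne'
    · exact (add_pos_of_pos_of_nonneg h (mul_nonneg (sub_nonneg.2 h4) h5.le)).ne'

theorem nonempty_sphere_homotopyEquiv :
    Nonempty (ContinuousMap.HomotopyEquiv (Metric.sphere (0 : E) 1) ({x | x ≠ 0} : Set E)) := by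
  refine nonempty_homotopyEquiv_compl_zero (fun x hx => ?_) (fun x => ‖(x : E)‖⁻¹) ?_
    (fun x => inv_pos.2 (norm_pos_iff.2 x.2)) (fun x => ?_) fun a ha s => ?_
  · rintro rfl
    simp at hx
  · exact Continuous.inv₀ (by fun_prop) fun x => norm_ne_zero_iff.2 x.2
  · rw [mem_sphere_zero_iff_norm, norm_smul, norm_inv, norm_norm,
      inv_mul_cancel₀ (norm_ne_zero_iff.2 x.2)]
  · rw [mem_sphere_zero_iff_norm] at ha ⊢
    simp [ha]

variable (E)

/-- The suspension isomorphism. The sets U and V omit a closed half-line each and are star-shaped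
about (0, 1) and (0, -1), while their intersection, where the first coordinate is nonzero, retracts
onto the punctured E. With augmented chains no low-degree exception arises, even for E = 0. -/
theorem nonempty_homology_compl_zero_prod (k : ℕ) :
    Nonempty ((singularSystem ({x | x ≠ 0} : Set (E × ℝ))).Homology (k + 1) ≃ₗ[ℤ]
      (singularSystem ({x | x ≠ 0} : Set E)).Homology k) := by
  let U : Set (E × ℝ) := {p | p.1 ≠ 0 ∨ 0 < p.2}
  let V : Set (E × ℝ) := {p | p.1 ≠ 0 ∨ p.2 < 0}
  let W : Set (E × ℝ) := {p | p.1 ≠ 0}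
  have hUo : IsOpen U := (isOpen_ne.preimage continuous_fst).union
    (isOpen_lt continuous_const continuous_snd)
  have hVo : IsOpen V := (isOpen_ne.preimage continuous_fst).union
    (isOpen_lt continuous_snd continuous_const)
  have hU : ContractibleSpace U := by
    refine StarConvex.contractibleSpace (x := ((0 : E), (1 : ℝ))) ?_
      ⟨((0 : E), (1 : ℝ)), Or.inr zero_lt_one⟩
    intro p hp a b ha hb hab
    rcases hb.eq_or_lt with rfl | hb
    · right
      have : a = 1 := by linarith
      simp [this]
    · rcases hp with h | h
      · left
        simpa using ⟨hb.ne', h⟩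
      · right
        have : 0 < b * p.2 := mul_pos hb h
        simp only [Prod.snd_add, Prod.smul_snd, smul_eq_mul, mul_one]
        linarith
  have hV : ContractibleSpace V := by
    refine StarConvex.contractibleSpace (x := ((0 : E), (-1 : ℝ))) ?_
      ⟨((0 : E), (-1 : ℝ)), Or.inr (by norm_num)⟩
    intro p hp a b ha hb hab
    rcases hb.eq_or_lt with rfl | hb
    · right
      have : a = 1 := by linarith
      simp [this]
    · rcases hp with h | h
      · left
        simpa using ⟨hb.ne', h⟩
      · right
        have : b * p.2 < 0 := mul_neg_of_pos_of_neg hb h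
        simp only [Prod.snd_add, Prod.smul_snd, smul_eq_mul]
        linarith
  have hUV := IsOpenUnion.ofSubsets (W := W) (U := U) (V := V) (Y := {x : E × ℝ | x ≠ 0})
    (fun p hp => Or.inl hp) (fun p hp => Or.inl hp)
    (by
      rintro p (h | h) rfl
      · exact h rfl
      · exact lt_irrefl _ h)
    (by
      rintro p (h | h) rfl
      · exact h rfl
      · exact lt_irrefl _ h)
    (by
      intro p hp
      by_cases h : p.1 = 0
      · rcases lt_trichotomy p.2 0 with h' | h' | h'
        · exact Or.inr (Or.inr h')
        · exact absurd (Prod.ext h h') hp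
        · exact Or.inl (Or.inr h')
      · exact Or.inl (Or.inl h))
    (by
      rintro p ⟨h | h, h' | h'⟩
      · exact h
      · exact h
      · exact h'
      · exact absurd (h.trans h') (lt_irrefl _))
    (hUo.preimage continuous_subtype_val) (hVo.preimage continuous_subtype_val)
  have := fun k => subsingleton_homology_of_contractible (X := U) k
  have := fun k => subsingleton_homology_of_contractible (X := V) k
  obtain ⟨e⟩ := hUV.nonempty_homology_equiv k
  let f : ContinuousMap.HomotopyEquiv W ({x | x ≠ 0} : Set E) :=
    { toFun := ⟨fun p => ⟨p.1.1, p.2⟩, by fun_prop⟩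
      invFun := ⟨fun x => ⟨((x : E), (0 : ℝ)), x.2⟩, by fun_prop⟩
      left_inv := ⟨
        { toFun q := ⟨(q.2.1.1, (q.1 : ℝ) * q.2.1.2), q.2.2⟩
          continuous_toFun := by fun_prop
          map_zero_left x := Subtype.ext (Prod.ext rfl (by simp))
          map_one_left x := Subtype.ext (Prod.ext rfl (by simp)) }⟩
      right_inv := ContinuousMap.Homotopic.refl _ }
  exact ⟨e.trans (homologyEquiv f k)⟩

end Punctured

/-- The homology of the punctured Euclidean space. -/
theorem homology_compl_zero (m : ℕ) : ∀ (E : Type) [NormedAddCommGroup E] [NormedSpace ℝ E]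
    [FiniteDimensional ℝ E], Module.finrank ℝ E = m → ∀ k : ℕ,
      (k = m → Nonempty ((singularSystem ({x | x ≠ 0} : Set E)).Homology k ≃ₗ[ℤ] ℤ)) ∧
      (k ≠ m → Subsingleton ((singularSystem ({x | x ≠ 0} : Set E)).Homology k)) := by
  -- In dimension 0 the punctured space is empty, with homology ℤ in index 0; each suspension raises
  -- dimension and index together.
  induction m with
  | zero =>
    intro E _ _ _ hE k
    have : Subsingleton E := Module.finrank_zero_iff.1 hE
    have : IsEmpty ({x | x ≠ 0} : Set E) := ⟨fun x => x.2 (Subsingleton.elim _ _)⟩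
    refine ⟨?_, fun hk => ?_⟩
    · rintro rfl
      exact nonempty_homology_zero_equiv_of_isEmpty
    · obtain ⟨k, rfl⟩ := Nat.exists_eq_succ_of_ne_zero hk
      exact subsingleton_homology_of_isEmpty k
  | succ m ih =>
    intro E _ _ _ hE k
    let e : ((Fin m → ℝ) × ℝ) ≃L[ℝ] E := ContinuousLinearEquiv.ofFinrankEq (by simp [hE])
    let f : ({x | x ≠ 0} : Set ((Fin m → ℝ) × ℝ)) ≃ₜ ({x | x ≠ 0} : Set E) :=
      e.toHomeomorph.subtype fun x => (e.map_ne_zero_iff).symm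
    cases k with
    | zero =>
      refine ⟨fun h => absurd h (by omega), fun _ => ?_⟩
      have : Nonempty ({x | x ≠ 0} : Set E) := by
        have : Nontrivial E := Module.nontrivial_of_finrank_pos (R := ℝ) (by omega)
        obtain ⟨x, hx⟩ := exists_ne (0 : E)
        exact ⟨x, hx⟩
      exact subsingleton_homology_zero
    | succ k =>
      obtain ⟨g⟩ := nonempty_homology_compl_zero_prod (Fin m → ℝ) k
      let g' := (homologyEquiv f.symm.toHomotopyEquiv (k + 1)).trans g
      obtain ⟨h1, h2⟩ := ih (Fin m → ℝ) (by simp) k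
      refine ⟨fun hk => ?_, fun hk => ?_⟩
      · obtain ⟨i⟩ := h1 (by omega)
        exact ⟨g'.trans i⟩
      · have := h2 (by omega)
        exact g'.toEquiv.subsingleton

theorem finite_homology_compl_zero (E : Type) [NormedAddCommGroup E] [NormedSpace ℝ E]
    [FiniteDimensional ℝ E] (k : ℕ) :
    Module.Finite ℤ ((singularSystem ({x | x ≠ 0} : Set E)).Homology k) := by
  obtain ⟨h1, h2⟩ := homology_compl_zero _ E rfl k
  by_cases hk : k = Module.finrank ℝ E
  · obtain ⟨e⟩ := h1 hk
    exact Module.Finite.equiv e.symm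
  · have := h2 hk
    infer_instance

end

noncomputable section


/-! ### Attaching one cell -/

section CellAttachment

variable {E : Type*} [NormedAddCommGroup E] {X : Type*}

/-- The homeomorphism of a subset of the source of a partial equivalence onto its image. -/
def PartialEquiv.homeomorphImage {E X : Type*} [TopologicalSpace E] [TopologicalSpace X]
    (e : PartialEquiv E X) {S : Set E} (hS : S ⊆ e.source)
    (he : ContinuousOn e S) (he' : ContinuousOn e.symm e.target) : S ≃ₜ (e '' S : Set X) where
  toFun v := ⟨e v, v, v.2, rfl⟩
  invFun x := ⟨e.symm x, by
    obtain ⟨v, hv, hx⟩ := x.2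
    rw [← hx, e.left_inv (hS hv)]
    exact hv⟩
  left_inv v := Subtype.ext (e.left_inv (hS v.2))
  right_inv x := by
    obtain ⟨v, hv, hx⟩ := x.2
    refine Subtype.ext ?_
    change e (e.symm x) = x
    rw [← hx, e.left_inv (hS hv)]
  continuous_toFun := (continuousOn_iff_continuous_domRestrict.1 he).subtype_mk _
  continuous_invFun := by
    refine Continuous.subtype_mk (he'.comp_continuous continuous_subtype_val fun x => ?_) _
    obtain ⟨v, hv, hx⟩ := x.2
    exact hx ▸ e.map_source (hS hv)

/-- The data of a space `A ∪ e '' closedBall 0 1` obtained from a closed subset `A` of `X` by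
attaching a cell. -/
structure IsCellAttachment [TopologicalSpace X] (A : Set X) (e : PartialEquiv E X) : Prop where
  isClosed : IsClosed A
  source_eq : e.source = Metric.ball 0 1
  continuousOn : ContinuousOn e (Metric.closedBall 0 1)
  continuousOn_symm : ContinuousOn e.symm e.target
  mapsTo : Set.MapsTo e (Metric.sphere 0 1) A
  disjoint : Disjoint A (e '' Metric.ball 0 1)

namespace IsCellAttachment

section

variable [NormedSpace ℝ E]

/-- The radial deformation of the punctured ball to the sphere. -/
def radial (s : ℝ) (v : E) : E := ((1 - s) + s * ‖v‖⁻¹) • v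

theorem radial_zero (v : E) : radial 0 v = v := by simp [radial]

theorem norm_radial {s : ℝ} (hs : s ∈ unitInterval) {v : E} (hv : v ≠ 0) :
    ‖radial s v‖ = (1 - s) * ‖v‖ + s := by
  have h := norm_pos_iff.2 hv
  have h0 : 0 ≤ (1 - s) + s * ‖v‖⁻¹ :=
    add_nonneg (sub_nonneg.2 hs.2) (mul_nonneg hs.1 (inv_nonneg.2 h.le))
  rw [radial, norm_smul, Real.norm_of_nonneg h0, add_mul, mul_assoc, inv_mul_cancel₀ h.ne', mul_one]

theorem radial_of_norm_eq_one (s : ℝ) {v : E} (hv : ‖v‖ = 1) : radial s v = v := by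
  simp [radial, hv]

theorem radial_mem_closedBall {s : ℝ} (hs : s ∈ unitInterval) {v : E} (hv : v ≠ 0)
    (hv' : v ∈ Metric.closedBall (0 : E) 1) : radial s v ∈ Metric.closedBall (0 : E) 1 := by
  rw [mem_closedBall_zero_iff] at *
  rw [norm_radial hs hv]
  nlinarith [hs.1, hs.2, norm_nonneg v]

theorem radial_ne_zero {s : ℝ} (hs : s ∈ unitInterval) {v : E} (hv : v ≠ 0) : radial s v ≠ 0 := by
  have h := norm_pos_iff.2 hv
  rw [← norm_pos_iff, norm_radial hs hv]
  rcases hs.1.eq_or_lt with h0 | h0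
  · rw [← h0]
    simpa using hv
  · exact add_pos_of_nonneg_of_pos (mul_nonneg (sub_nonneg.2 hs.2) h.le) h0

open Classical in
/-- The radial deformation of the complement of the centre of the attached cell. -/
def deformation (A : Set X) (e : PartialEquiv E X) (p : X × unitInterval) : X :=
  if p.1 ∈ A then p.1 else e (radial p.2 (e.symm p.1))

theorem deformation_of_mem {A : Set X} {e : PartialEquiv E X} {p : X × unitInterval} (hp : p.1 ∈ A) : deformation A e p = p.1 :=
  if_pos hp

end

variable [TopologicalSpace X] {A : Set X} {e : PartialEquiv E X} (h : IsCellAttachment A e)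

include h

theorem notMem {v : E} (hv : v ∈ Metric.ball (0 : E) 1) : e v ∉ A :=
  fun hA => Set.disjoint_left.1 h.disjoint hA ⟨v, hv, rfl⟩

theorem symm_apply {v : E} (hv : v ∈ Metric.ball (0 : E) 1) : e.symm (e v) = v :=
  e.left_inv (h.source_eq ▸ hv)

theorem mem_or_mem_ball {v : E} (hv : v ∈ Metric.closedBall (0 : E) 1) :
    e v ∈ A ∧ ‖v‖ = 1 ∨ v ∈ Metric.ball (0 : E) 1 := by
  rcases (mem_closedBall_zero_iff.1 hv).lt_or_eq with h1 | h1
  · exact Or.inr (mem_ball_zero_iff.2 h1)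
  · exact Or.inl ⟨h.mapsTo (mem_sphere_zero_iff_norm.2 h1), h1⟩

theorem apply_ne {v : E} (hv : v ∈ Metric.closedBall (0 : E) 1) (hv0 : v ≠ 0) : e v ≠ e 0 := by
  have h0 : (0 : E) ∈ Metric.ball (0 : E) 1 := Metric.mem_ball_self one_pos
  intro heq
  rcases h.mem_or_mem_ball hv with ⟨hA, -⟩ | hv
  · exact h.notMem h0 (heq ▸ hA)
  · rw [← h.symm_apply hv, heq, h.symm_apply h0] at hv0
    exact hv0 rfl

theorem subset_diff : A ⊆ (A ∪ e '' Metric.closedBall 0 1) \ {e 0} :=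
  fun _ hx => ⟨Or.inl hx, fun h0 => h.notMem (Metric.mem_ball_self one_pos) (h0 ▸ hx)⟩

section

variable [NormedSpace ℝ E]

/-- The formula also holds on the boundary sphere, where `e.symm` gives no information: such points
land in A and are fixed by the radial map. -/
theorem deformation_apply {v : E} (hv : v ∈ Metric.closedBall (0 : E) 1) (s : unitInterval) :
    deformation A e (e v, s) = e (radial s v) := by
  rcases h.mem_or_mem_ball hv with ⟨hA, h1⟩ | hv
  · rw [deformation_of_mem hA, radial_of_norm_eq_one _ h1]
  · rw [deformation, if_neg (h.notMem hv), h.symm_apply hv]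

theorem deformation_mem {U : Set X} (hU : (A ∪ e '' Metric.closedBall 0 1) \ {e 0} = U) {x : X}
    (hx : x ∈ U) (s : unitInterval) : deformation A e (x, s) ∈ U := by
  subst hU
  rcases hx.1 with hA | ⟨v, hv, rfl⟩
  · rwa [deformation_of_mem hA]
  · have hv0 : v ≠ 0 := fun h0 => hx.2 (congrArg e h0)
    rw [h.deformation_apply hv]
    have := radial_mem_closedBall s.2 hv0 hv
    exact ⟨Or.inr ⟨_, this, rfl⟩, h.apply_ne this (radial_ne_zero s.2 hv0)⟩

theorem deformation_one_mem {x : X} (hx : x ∈ (A ∪ e '' Metric.closedBall 0 1) \ {e 0}) :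
    deformation A e (x, 1) ∈ A := by
  rcases hx.1 with hA | ⟨v, hv, rfl⟩
  · rwa [deformation_of_mem hA]
  · have hv0 : v ≠ 0 := fun h0 => hx.2 (congrArg e h0)
    rw [h.deformation_apply hv]
    refine h.mapsTo (mem_sphere_zero_iff_norm.2 ?_)
    rw [norm_radial (1 : unitInterval).2 hv0]
    simp

end

variable [NormedSpace ℝ E] [FiniteDimensional ℝ E] [T2Space X]

theorem isClosed_image : IsClosed (e '' Metric.closedBall 0 1) := by
  have := FiniteDimensional.proper_real E
  exact ((isCompact_closedBall 0 1).image_of_continuousOn h.continuousOn).isClosed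

/-- Continuity of `e.symm` is known only on the open cell. The map is instead tested on the closed
ball times the interval, which by compactness maps to its image by a closed map; restricted to the
preimage of the complement of the centre, this is still a quotient map. -/
theorem continuousOn_deformation_image : ContinuousOn (deformation A e)
    ((e '' Metric.closedBall 0 1 \ {e 0}) ×ˢ Set.univ) := by
  have := FiniteDimensional.proper_real E
  have : CompactSpace (Metric.closedBall (0 : E) 1) :=
    isCompact_iff_compactSpace.1 (isCompact_closedBall 0 1)
  let f : Metric.closedBall (0 : E) 1 × unitInterval → X × unitInterval := fun p => (e p.1, p.2)
  have hf : Continuous f :=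
    ((continuousOn_iff_continuous_domRestrict.1 h.continuousOn).comp continuous_fst).prodMk
      continuous_snd
  let S : Set (X × unitInterval) := (e '' Metric.closedBall 0 1 \ {e 0}) ×ˢ Set.univ
  have hq : Topology.IsQuotientMap (S.restrictPreimage f) := by
    refine (hf.isClosedMap.restrictPreimage S).isQuotientMap hf.restrictPreimage ?_
    rintro ⟨⟨x, s⟩, hx⟩
    obtain ⟨v, hv, hvx⟩ := hx.1.1
    exact ⟨⟨(⟨v, hv⟩, s), ⟨⟨⟨v, hv, rfl⟩, fun h0 => hx.1.2 (hvx.symm.trans h0)⟩, trivial⟩⟩,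
      Subtype.ext (Prod.ext hvx rfl)⟩
  rw [continuousOn_iff_continuous_domRestrict]
  refine hq.continuous_iff.2 ?_
  have h0 (p : f ⁻¹' S) : (p.1.1 : E) ≠ 0 := fun hp => p.2.1.2 (congrArg e hp)
  have : Continuous fun p : f ⁻¹' S => e (radial p.1.2 p.1.1) := by
    refine h.continuousOn.comp_continuous ?_ fun p =>
      radial_mem_closedBall p.1.2.2 (h0 p) p.1.1.2
    unfold radial
    have hn : Continuous fun p : f ⁻¹' S => ‖(p.1.1 : E)‖⁻¹ :=
      Continuous.inv₀ (by fun_prop) fun p => norm_ne_zero_iff.2 (h0 p)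
    fun_prop
  exact this.congr fun p => (h.deformation_apply p.1.1.2 _).symm

theorem continuous_deformation {U : Set X} (hU : U ⊆ (A ∪ e '' Metric.closedBall 0 1) \ {e 0}) :
    Continuous fun p : U × unitInterval => deformation A e (p.1, p.2) := by
  rw [← continuousOn_univ]
  have h1 : IsClosed {p : U × unitInterval | (p.1 : X) ∈ A} :=
    h.isClosed.preimage (continuous_subtype_val.comp continuous_fst)
  have h2 : IsClosed {p : U × unitInterval | (p.1 : X) ∈ e '' Metric.closedBall 0 1} :=
    h.isClosed_image.preimage (continuous_subtype_val.comp continuous_fst)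
  refine (ContinuousOn.union_of_isClosed ?_ ?_ h1 h2).mono fun p _ => (hU p.1.2).1
  · refine ContinuousOn.congr (f := fun p : U × unitInterval => (p.1 : X)) ?_ fun p hp =>
      deformation_of_mem hp
    exact (continuous_subtype_val.comp continuous_fst).continuousOn
  · refine h.continuousOn_deformation_image.comp (t := _) (Continuous.continuousOn (by fun_prop))
      fun p hp => ⟨⟨hp, (hU p.1.2).2⟩, trivial⟩

/-- The radial deformation ends in A and shows that the inclusion after the retraction is homotopic
to the identity. Surjectivity is the only half of the deformation retraction needed. -/
theorem homologyMap_inclusion_diff_surjective (k : ℕ) : Function.Surjective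
    ((singularMap ⟨Set.inclusion h.subset_diff, continuous_inclusion _⟩).homologyMap k) := by
  let U := (A ∪ e '' Metric.closedBall 0 1) \ {e 0}
  let i : C(A, U) := ⟨Set.inclusion h.subset_diff, continuous_inclusion _⟩
  have hc : Continuous fun p : U × unitInterval => deformation A e (p.1, p.2) :=
    h.continuous_deformation subset_rfl
  let r : C(U, A) := ⟨fun x => ⟨deformation A e (x, 1), h.deformation_one_mem x.2⟩,
    (hc.comp (Continuous.prodMk continuous_id (continuous_const (y := (1 : unitInterval))))).subtype_mk _⟩
  let F : (ContinuousMap.id U).Homotopy (i.comp r) :=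
    { toFun p := ⟨deformation A e (p.2, p.1), h.deformation_mem rfl p.2.2 p.1⟩
      continuous_toFun := (hc.comp continuous_swap).subtype_mk _
      map_zero_left x := Subtype.ext (by
        change deformation A e (x, 0) = x
        rcases x.2.1 with hA | ⟨v, hv, hx⟩
        · exact deformation_of_mem hA
        · rw [← hx, h.deformation_apply hv]
          exact congrArg e (radial_zero v))
      map_one_left x := rfl }
  intro x
  refine ⟨(singularMap r).homologyMap k x, ?_⟩
  change (singularMap i).homologyMap k _ = x
  rw [← FaceSystem.Hom.homologyMap_comp, ← singularMap_comp, ← homologyMap_eq_of_homotopy F,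
    homologyMap_id]

end IsCellAttachment

namespace IsCellAttachment

variable {m : ℕ} {X : Type*} [TopologicalSpace X] {A : Set X}
  {e : PartialEquiv (Fin m → ℝ) X} (h : IsCellAttachment A e)

include h

theorem nonempty_homology_equiv_punctured (k : ℕ) :
    Nonempty ((singularSystem (e '' (Metric.ball 0 1 \ {0}) : Set X)).Homology k ≃ₗ[ℤ]
      (singularSystem ({x | x ≠ 0} : Set (Fin m → ℝ))).Homology k) := by
  obtain ⟨f⟩ := nonempty_ball_homotopyEquiv (E := Fin m → ℝ)
  let g := e.homeomorphImage (S := Metric.ball 0 1 \ {0}) (h.source_eq ▸ Set.sdiff_subset)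
    (h.continuousOn.mono (Set.sdiff_subset.trans Metric.ball_subset_closedBall)) h.continuousOn_symm
  exact ⟨homologyEquiv (g.symm.toHomotopyEquiv.trans f) k⟩

theorem subsingleton_homology_openCell (k : ℕ) :
    Subsingleton ((singularSystem (e '' Metric.ball 0 1 : Set X)).Homology k) := by
  let g := e.homeomorphImage (S := Metric.ball 0 1) h.source_eq.ge
    (h.continuousOn.mono Metric.ball_subset_closedBall) h.continuousOn_symm
  have : ContractibleSpace (Metric.ball (0 : Fin m → ℝ) 1) :=
    (convex_ball 0 1).contractibleSpace ⟨0, Metric.mem_ball_self one_pos⟩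
  exact (homologyEquiv g.symm.toHomotopyEquiv k).toEquiv.subsingleton_congr.2
    (subsingleton_homology_of_contractible k)

variable [T2Space X]

/-- The cover consists of the complement of the centre of the cell and of the open cell; they meet
in the punctured open cell. -/
theorem isOpenUnion : IsOpenUnion
    ⟨Set.inclusion (s := e '' (Metric.ball 0 1 \ {0}))
      (t := (A ∪ e '' Metric.closedBall 0 1) \ {e 0}) (by
        rintro _ ⟨v, hv, rfl⟩
        have hv' := Metric.ball_subset_closedBall hv.1
        exact ⟨Or.inr ⟨v, hv', rfl⟩, h.apply_ne hv' hv.2⟩), continuous_inclusion _⟩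
    ⟨Set.inclusion (t := e '' Metric.ball 0 1) (Set.image_mono Set.sdiff_subset),
      continuous_inclusion _⟩
    ⟨Set.inclusion (t := A ∪ e '' Metric.closedBall 0 1) Set.sdiff_subset, continuous_inclusion _⟩
    ⟨Set.inclusion (Set.subset_union_of_subset_right
      (Set.image_mono Metric.ball_subset_closedBall) A), continuous_inclusion _⟩ := by
  refine IsOpenUnion.ofSubsets _ _ _ _ (fun x hx => ?_) ?_ ?_ ?_
  · by_cases h0 : x = e 0
    · exact Or.inr ⟨0, Metric.mem_ball_self one_pos, h0.symm⟩
    · exact Or.inl ⟨hx, h0⟩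
  · rintro _ ⟨hx, v, hv, rfl⟩
    exact ⟨v, ⟨hv, fun h0 => hx.2 (congrArg e h0)⟩, rfl⟩
  · have : ((↑) ⁻¹' ((A ∪ e '' Metric.closedBall 0 1) \ {e 0}) :
        Set (A ∪ e '' Metric.closedBall 0 1 : Set X)) = (↑) ⁻¹' ({e 0}ᶜ : Set X) := by
      ext x
      exact ⟨fun hx => hx.2, fun hx => ⟨x.2, hx⟩⟩
    rw [this]
    exact isOpen_compl_singleton.preimage continuous_subtype_val
  · have : ((↑) ⁻¹' (e '' Metric.ball 0 1) :
        Set (A ∪ e '' Metric.closedBall 0 1 : Set X)) = (↑) ⁻¹' Aᶜ := by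
      ext x
      refine ⟨fun hx hA => Set.disjoint_left.1 h.disjoint hA hx, fun hx => ?_⟩
      obtain ⟨v, hv, hvx⟩ := x.2.resolve_left hx
      refine ⟨v, (h.mem_or_mem_ball hv).resolve_left fun hA => hx ?_, hvx⟩
      exact (congrArg (· ∈ A) hvx).mp hA.1
    rw [this]
    exact h.isClosed.isOpen_compl.preimage continuous_subtype_val

theorem finite_homology (hA : ∀ k, Module.Finite ℤ ((singularSystem A).Homology k)) (k : ℕ) :
    Module.Finite ℤ
      ((singularSystem (A ∪ e '' Metric.closedBall 0 1 : Set X)).Homology k) := by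
  cases k with
  | zero => infer_instance
  | succ k =>
    have := h.subsingleton_homology_openCell (k + 1)
    have := finite_homology_compl_zero (Fin m → ℝ) k
    obtain ⟨f⟩ := h.nonempty_homology_equiv_punctured k
    have := Module.Finite.equiv f.symm
    have := hA (k + 1)
    have := Module.Finite.of_surjective _ (h.homologyMap_inclusion_diff_surjective (k + 1))
    exact h.isOpenUnion.finite_homology k

/-- The punctured m-cell has homology only in index m. For k ≠ m Mayer–Vietoris shows that the
complement of the centre carries all of index k + 1, that is, degree k, and that complement is
reached from A. -/
theorem homologyMap_inclusion_surjective {k : ℕ} (hk : k ≠ m) : Function.Surjective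
    ((singularMap ⟨Set.inclusion (Set.subset_union_left (s := A)
      (t := e '' Metric.closedBall 0 1)), continuous_inclusion _⟩).homologyMap (k + 1)) := by
  have := h.subsingleton_homology_openCell (k + 1)
  have := (homology_compl_zero m (Fin m → ℝ) (by simp) k).2 hk
  obtain ⟨f⟩ := h.nonempty_homology_equiv_punctured k
  have := f.toEquiv.subsingleton
  intro y
  obtain ⟨u, rfl⟩ := h.isOpenUnion.homologyMap_surjective k y
  obtain ⟨a, rfl⟩ := h.homologyMap_inclusion_diff_surjective (k + 1) u
  exact ⟨a, by rw [← FaceSystem.Hom.homologyMap_comp, ← singularMap_comp]; rfl⟩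

end IsCellAttachment

end CellAttachment

section HomologyImage

variable {X : Type u₁} [TopologicalSpace X]

/-- The image of the homology of a subspace. -/
def homologyImage (A : Set X) (k : ℕ) : Submodule ℤ ((singularSystem X).Homology k) :=
  LinearMap.range ((singularMap (⟨Subtype.val, continuous_subtype_val⟩ : C(A, X))).homologyMap k)

theorem homologyImage_le {A B : Set X} (hAB : A ⊆ B) {k : ℕ} (hs : Function.Surjective
    ((singularMap ⟨Set.inclusion hAB, continuous_inclusion hAB⟩).homologyMap k)) :
    homologyImage B k ≤ homologyImage A k := by
  rintro _ ⟨y, rfl⟩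
  obtain ⟨x, rfl⟩ := hs y
  exact ⟨x, by rw [← FaceSystem.Hom.homologyMap_comp, ← singularMap_comp]; rfl⟩

theorem toHomology_mem_homologyImage {A : Set X} {k : ℕ} (z : (singularSystem X).cycles k)
    (hz : (z : (singularSystem X).Chain k) ∈ chainsIn A k) :
    (singularSystem X).toHomology k z ∈ homologyImage A k := by
  let i : C(A, X) := ⟨Subtype.val, continuous_subtype_val⟩
  obtain ⟨y, hy⟩ := exists_chainMap_eq (f := i) Topology.IsInducing.subtypeVal
    (by simpa [i] using hz)
  have hy' : y ∈ (singularSystem A).cycles k :=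
    (singularMap i).mem_cycles_of_chainMap
      (fun k => singularMap_toFun_injective (f := i) Subtype.val_injective k) (hy ▸ z.2)
  exact ⟨(singularSystem A).toHomology k ⟨y, hy'⟩, by
    rw [FaceSystem.Hom.homologyMap_toHomology]
    exact congrArg _ (Subtype.ext hy)⟩

end HomologyImage

end

noncomputable section


/-! ### Finite generation for CW complexes of finite type -/

namespace Topology.CWComplex

variable {X : Type u₁} [TopologicalSpace X] [CWComplex (Set.univ : Set X)]

theorem isCellAttachment {n : ℕ} (j : cell (Set.univ : Set X) n) {A : Set X} (hA : IsClosed A)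
    (h1 : cellFrontier n j ⊆ A) (h2 : Disjoint A (openCell n j)) :
    IsCellAttachment A (map n j) where
  isClosed := hA
  source_eq := source_eq n j
  continuousOn := continuousOn n j
  continuousOn_symm := continuousOn_symm n j
  mapsTo := Set.mapsTo_iff_image_subset.2 h1
  disjoint := h2

variable [T2Space X]

/-- The subspace between two consecutive skeleta given by a set of cells. -/
def partialSkeleton (X : Type u₁) [TopologicalSpace X] [T2Space X] [CWComplex (Set.univ : Set X)]
    (n : ℕ) (s : Finset (cell (Set.univ : Set X) n)) : Set X :=
  skeletonLT (Set.univ : Set X) n ∪ ⋃ j ∈ s, closedCell n j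

theorem isClosed_partialSkeleton (n : ℕ) (s : Finset (cell (Set.univ : Set X) n)) :
    IsClosed (partialSkeleton X n s) :=
  (skeletonLT (Set.univ : Set X) n).closed.union
    (s.finite_toSet.isClosed_biUnion fun _ _ => isClosed_closedCell)

open Classical in
theorem partialSkeleton_insert (n : ℕ) (j : cell (Set.univ : Set X) n)
    (s : Finset (cell (Set.univ : Set X) n)) :
    partialSkeleton X n (insert j s) =
      partialSkeleton X n s ∪ map n j '' Metric.closedBall 0 1 := by
  rw [partialSkeleton, Finset.set_biUnion_insert, Set.union_comm (closedCell n j),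
    ← Set.union_assoc]
  rfl

theorem isCellAttachment_partialSkeleton {n : ℕ} {j : cell (Set.univ : Set X) n}
    {s : Finset (cell (Set.univ : Set X) n)} (hj : j ∉ s) :
    IsCellAttachment (partialSkeleton X n s) (map n j) := by
  have h0 : Disjoint (skeletonLT (Set.univ : Set X) n : Set X) (openCell n j) :=
    disjoint_skeletonLT_openCell le_rfl
  refine isCellAttachment j (isClosed_partialSkeleton n s)
    ((cellFrontier_subset_skeletonLT n j).trans Set.subset_union_left) (h0.union_left ?_)
  rw [Set.disjoint_iUnion₂_left]
  intro i hi
  rw [← cellFrontier_union_openCell_eq_closedCell]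
  refine (h0.mono_left (cellFrontier_subset_skeletonLT n i)).union_left ?_
  refine disjoint_openCell_of_ne fun h => hj ?_
  rw [Sigma.mk.injEq] at h
  exact eq_of_heq h.2 ▸ hi

open Classical in
theorem finite_homology_partialSkeleton {n : ℕ} (hn : ∀ k, Module.Finite ℤ
    ((singularSystem (skeletonLT (Set.univ : Set X) n : Set X)).Homology k))
    (s : Finset (cell (Set.univ : Set X) n)) (k : ℕ) :
    Module.Finite ℤ ((singularSystem (partialSkeleton X n s)).Homology k) := by
  induction s using Finset.induction_on generalizing k with
  | empty =>
    have : partialSkeleton X n ∅ = skeletonLT (Set.univ : Set X) n := by simp [partialSkeleton]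
    rw [this]
    exact hn k
  | insert j s hj ih =>
    rw [partialSkeleton_insert]
    exact (isCellAttachment_partialSkeleton hj).finite_homology ih k

open Classical in
theorem homologyImage_partialSkeleton_le {n k : ℕ} (hk : k ≠ n)
    (s : Finset (cell (Set.univ : Set X) n)) :
    homologyImage (partialSkeleton X n s) (k + 1) ≤
      homologyImage (skeletonLT (Set.univ : Set X) n : Set X) (k + 1) := by
  induction s using Finset.induction_on with
  | empty =>
    have : partialSkeleton X n ∅ = skeletonLT (Set.univ : Set X) n := by simp [partialSkeleton]
    rw [this]
  | insert j s hj ih =>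
    rw [partialSkeleton_insert]
    exact (homologyImage_le _
      ((isCellAttachment_partialSkeleton hj).homologyMap_inclusion_surjective hk)).trans ih

section

variable [FiniteType (Set.univ : Set X)]

theorem exists_partialSkeleton_eq (n : ℕ) : ∃ s : Finset (cell (Set.univ : Set X) n),
    partialSkeleton X n s = skeletonLT (Set.univ : Set X) (n + 1 : ℕ) := by
  have := FiniteType.finite_cell (C := (Set.univ : Set X)) (D := ∅) n
  have := Fintype.ofFinite (cell (Set.univ : Set X) n)
  refine ⟨Finset.univ, ?_⟩
  rw [Nat.cast_add, Nat.cast_one, ← skeletonLT_union_iUnion_closedCell_eq_skeletonLT_succ,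
    partialSkeleton]
  simp

theorem finite_homology_skeletonLT (n k : ℕ) : Module.Finite ℤ
    ((singularSystem (skeletonLT (Set.univ : Set X) n : Set X)).Homology k) := by
  induction n generalizing k with
  | zero =>
    rw [Nat.cast_zero, skeletonLT_zero_eq_empty]
    cases k with
    | zero => infer_instance
    | succ k =>
      have := subsingleton_homology_of_isEmpty (X := (∅ : Set X)) k
      infer_instance
  | succ n ih =>
    obtain ⟨s, hs⟩ := exists_partialSkeleton_eq (X := X) n
    rw [← hs]
    exact finite_homology_partialSkeleton ih s k

/-- Index k + 1 is degree k, and the skeleton on the right contains exactly the cells of dimension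
at most k; cells of higher dimension add no classes in that degree. -/
theorem homologyImage_skeletonLT_le {n k : ℕ} (hk : k + 1 ≤ n) :
    homologyImage (skeletonLT (Set.univ : Set X) n : Set X) (k + 1) ≤
      homologyImage (skeletonLT (Set.univ : Set X) (k + 1 : ℕ) : Set X) (k + 1) := by
  induction n, hk using Nat.le_induction with
  | base => rfl
  | succ n hn ih =>
    obtain ⟨s, hs⟩ := exists_partialSkeleton_eq (X := X) n
    rw [← hs]
    exact (homologyImage_partialSkeleton_le (by omega) s).trans ih

end

theorem exists_mem_skeletonLT (x : X) : ∃ n : ℕ, x ∈ (skeletonLT (Set.univ : Set X) n : Set X) := by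
  have : x ∈ ⋃ n : ℕ, (skeletonLT (Set.univ : Set X) n : Set X) := by
    rw [iUnion_skeletonLT_eq_complex]
    trivial
  exact Set.mem_iUnion.1 this

/-- Otherwise choose a point of K outside each skeleton. These points form an infinite set all of
whose subsets are closed, so it has no accumulation point, which compactness of K forbids. -/
theorem exists_subset_skeletonLT {K : Set X} (hK : IsCompact K) :
    ∃ n : ℕ, K ⊆ (skeletonLT (Set.univ : Set X) n : Set X) := by
  by_contra! hn
  choose x hxK hx using fun n => Set.not_subset.1 (hn n)
  have hmono {m n : ℕ} (h : m ≤ n) : (skeletonLT (Set.univ : Set X) m : Set X) ⊆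
      skeletonLT (Set.univ : Set X) n := skeletonLT_mono (by exact_mod_cast h)
  -- A closed m-cell lies in the skeleton with index m + 1, so it contains x n only for n ≤ m. A set
  -- meeting every closed cell in a finite set is closed.
  have hcl (T : Set X) (hT : T ⊆ Set.range x) : IsClosed T := by
    rw [closed (Set.univ : Set X) T (Set.subset_univ T)]
    intro m j
    refine (((Set.finite_Iic m).image x).subset ?_).isClosed
    rintro y ⟨hy, hyc⟩
    obtain ⟨n, rfl⟩ := hT hy
    refine ⟨n, Set.mem_Iic.2 (not_lt.1 fun hmn => hx n ?_), rfl⟩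
    refine hmono (Nat.succ_le_of_lt hmn) ?_
    have := closedCell_subset_skeletonLT m j hyc
    exact_mod_cast this
  have hinf : (Set.range x).Infinite := by
    intro hfin
    choose N hN using exists_mem_skeletonLT (X := X)
    obtain ⟨M, hM⟩ := (hfin.image N).bddAbove
    exact hx M (hmono (hM ⟨x M, ⟨M, rfl⟩, rfl⟩) (hN (x M)))
  obtain ⟨a, -, ha⟩ := hinf.exists_accPt_of_subset_isCompact hK (Set.range_subset_iff.2 hxK)
  rw [accPt_principal_iff_clusterPt, ← mem_closure_iff_clusterPt,
    (hcl _ Set.sdiff_subset).closure_eq] at ha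
  exact ha.2 rfl

theorem exists_mem_chainsIn_skeletonLT {k : ℕ} (x : (singularSystem X).Chain k) :
    ∃ n : ℕ, x ∈ chainsIn (skeletonLT (Set.univ : Set X) n : Set X) k := by
  have h1 (σ : (singularSystem X).simplex k) : ∃ n : ℕ,
      Finsupp.single σ (1 : ℤ) ∈ chainsIn (skeletonLT (Set.univ : Set X) n : Set X) k := by
    have hc : Continuous (show C(stdSimplex ℝ (Fin k), X) from σ) := ContinuousMap.continuous _
    obtain ⟨n, hn⟩ := exists_subset_skeletonLT (isCompact_range hc)
    exact ⟨n, Finsupp.single_mem_supported ℤ _ hn⟩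
  choose N hN using h1
  refine ⟨x.support.sup N, ?_⟩
  suffices h : x.sum Finsupp.single ∈
      chainsIn (skeletonLT (Set.univ : Set X) (x.support.sup N : ℕ) : Set X) k by
    rwa [Finsupp.sum_single] at h
  refine Submodule.sum_mem _ fun σ hσ => ?_
  rw [← mul_one (x σ), ← smul_eq_mul, ← Finsupp.smul_single]
  refine Submodule.smul_mem _ _ (chainsIn_mono (skeletonLT_mono ?_) k (hN σ))
  exact_mod_cast Finset.le_sup hσ

/-- The homology of a CW complex of finite type is finitely generated in each degree. -/
theorem finite_homology [FiniteType (Set.univ : Set X)] (k : ℕ) :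
    Module.Finite ℤ ((singularSystem X).Homology k) := by
  cases k with
  | zero => infer_instance
  | succ k =>
    have := finite_homology_skeletonLT (X := X) (k + 1) (k + 1)
    refine ⟨?_⟩
    -- A cycle lies in some finite skeleton; higher cells being irrelevant in this degree, its class
    -- comes from one fixed skeleton, whose homology is finitely generated.
    suffices h : homologyImage (skeletonLT (Set.univ : Set X) (k + 1 : ℕ) : Set X) (k + 1) = ⊤ by
      rw [← h]
      exact Submodule.fg_range _
    refine eq_top_iff.2 fun y _ => ?_
    obtain ⟨z, hz, rfl⟩ := FaceSystem.exists_toHomology_eq _ y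
    obtain ⟨n, hn⟩ := exists_mem_chainsIn_skeletonLT z
    have := chainsIn_mono (skeletonLT_mono (C := (Set.univ : Set X)) (m := n)
      (n := (max n (k + 1) : ℕ)) (by exact_mod_cast le_max_left _ _)) (k + 1) hn
    exact homologyImage_skeletonLT_le (le_max_right n (k + 1))
      (toHomology_mem_homologyImage ⟨z, hz⟩ this)

end Topology.CWComplex

end

noncomputable section


/-! ### Homomorphisms to Z/p and universal coefficients -/

section ModPrime

variable (p : ℕ) [Fact p.Prime]

theorem ULift.zmod_zsmul_eq_zero (a : ULift.{v} (ZMod p)) : (p : ℤ) • a = 0 := by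
  refine ULift.ext _ _ ?_
  simp

variable {N : Type*} [AddCommGroup N]

variable {p} in
theorem exists_addMonoidHom_zmod_ne_zero (hN : ∀ y : N, p • y = 0) {x : N} (hx : x ≠ 0) :
    ∃ f : N →+ ZMod p, f x ≠ 0 := by
  have := AddCommGroup.zmodModule hN
  obtain ⟨f, hf⟩ := Module.Projective.exists_dual_ne_zero (ZMod p) hx
  exact ⟨f.toAddMonoidHom, hf⟩

/-- An element which is not divisible by `p` is detected by a homomorphism to `ZMod p`. -/
theorem exists_linearMap_zmod_ne_zero {x : N} (hx : ∀ y : N, (p : ℤ) • y ≠ x) :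
    ∃ f : N →ₗ[ℤ] ULift.{v} (ZMod p), f x ≠ 0 := by
  let S : Submodule ℤ N := LinearMap.range (LinearMap.lsmul ℤ N (p : ℤ))
  have hp (y : N ⧸ S) : p • y = 0 := by
    obtain ⟨y, rfl⟩ := S.mkQ_surjective y
    rw [← map_nsmul, Submodule.mkQ_apply, Submodule.Quotient.mk_eq_zero]
    exact ⟨y, by simp⟩
  have h0 : S.mkQ x ≠ 0 := by
    rw [Submodule.mkQ_apply, Ne, Submodule.Quotient.mk_eq_zero]
    rintro ⟨y, hy⟩
    exact hx y hy
  obtain ⟨f, hf⟩ := exists_addMonoidHom_zmod_ne_zero hp h0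
  refine ⟨(AddEquiv.ulift.symm.toAddMonoidHom.comp f).toIntLinearMap.comp S.mkQ,
    fun h => hf ?_⟩
  exact congrArg ULift.down h

/-- A homomorphism to `ZMod p` on a subgroup with torsion-free quotient extends, up to changing it
outside its kernel. -/
theorem exists_linearMap_zmod_of_subgroup (Z : Submodule ℤ N)
    (hZ : ∀ c : N, (p : ℤ) • c ∈ Z → c ∈ Z) (f : Z →ₗ[ℤ] ULift.{v} (ZMod p)) {z : Z}
    (hz : f z ≠ 0) :
    ∃ g : N →ₗ[ℤ] ULift.{v} (ZMod p), g z ≠ 0 ∧ ∀ z' : Z, f z' = 0 → g z' = 0 := by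
  -- It suffices that z is not divisible by p modulo D = ker f. If pc - z lies in D, then pc and
  -- hence c lie in Z, and f z = p f(c) = 0. No complement of Z has to be chosen.
  let D := (LinearMap.ker f).map Z.subtype
  obtain ⟨g, hg⟩ : ∃ g : (N ⧸ D) →ₗ[ℤ] ULift.{v} (ZMod p), g (D.mkQ z) ≠ 0 :=
    exists_linearMap_zmod_ne_zero p (by
    intro y hy
    obtain ⟨c, rfl⟩ := D.mkQ_surjective y
    rw [← map_smul, ← sub_eq_zero, ← map_sub, Submodule.mkQ_apply,
      Submodule.Quotient.mk_eq_zero] at hy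
    obtain ⟨w, hw, hwc⟩ := hy
    have hc : c ∈ Z := hZ c (by
      rw [← sub_add_cancel ((p : ℤ) • c) (z : N), ← hwc]
      exact Z.add_mem w.2 z.2)
    have : w = (p : ℤ) • ⟨c, hc⟩ - z := Subtype.ext hwc
    rw [SetLike.mem_coe, LinearMap.mem_ker, this, map_sub, map_smul,
      ULift.zmod_zsmul_eq_zero, zero_sub, neg_eq_zero] at hw
    exact hz hw)
  refine ⟨g.comp D.mkQ, hg, fun z' hz' => ?_⟩
  have : D.mkQ z' = 0 := (Submodule.Quotient.mk_eq_zero _).2 ⟨z', hz', rfl⟩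
  rw [LinearMap.comp_apply, this, map_zero]

end ModPrime

section TorsionFree

variable {M : Type*} [AddCommGroup M]

theorem isTorsionFree_of_forall_prime
    (h : ∀ p : ℕ, p.Prime → ∀ y : M, (p : ℤ) • y = 0 → y = 0) : Module.IsTorsionFree ℤ M := by
  have key (n : ℕ) : n ≠ 0 → ∀ y : M, (n : ℤ) • y = 0 → y = 0 := by
    induction n using Nat.recOnMul with
    | zero => exact fun h => absurd rfl h
    | one => exact fun _ y hy => by simpa using hy
    | prime p hp => exact fun _ => h p hp
    | mul a b ha hb =>
      intro hab y hy
      rw [Nat.cast_mul, mul_smul] at hy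
      exact hb (right_ne_zero_of_mul hab) y (ha (left_ne_zero_of_mul hab) _ hy)
  rw [Module.isTorsionFree_iff_smul_eq_zero]
  intro r y
  refine fun hy => or_iff_not_imp_left.2 fun hr => key r.natAbs (Int.natAbs_ne_zero.2 hr) y ?_
  rcases Int.natAbs_eq r with h | h
  · rwa [← h]
  · rw [h, neg_smul, neg_eq_zero] at hy
    exact hy

/-- A finitely generated abelian group with `p`-torsion has a nonzero homomorphism to `ZMod p`. -/
theorem exists_linearMap_zmod_of_torsion (p : ℕ) [Fact p.Prime] [Module.Finite ℤ M] {y : M}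
    (hy : y ≠ 0) (hpy : (p : ℤ) • y = 0) :
    ∃ (x : M) (f : M →ₗ[ℤ] ULift.{v} (ZMod p)), f x ≠ 0 := by
  by_contra! h
  -- Without homomorphisms to Z/p, multiplication by p is onto; on a Noetherian module it is then
  -- injective, against the torsion element.
  have hs : Function.Surjective (LinearMap.lsmul ℤ M (p : ℤ)) := by
    intro x
    by_contra! hx
    obtain ⟨f, hf⟩ : ∃ f : M →ₗ[ℤ] ULift.{v} (ZMod p), f x ≠ 0 :=
      exists_linearMap_zmod_ne_zero p hx
    exact hf (h x f)
  refine hy (IsNoetherian.injective_of_surjective_endomorphism _ hs ?_)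
  rw [map_zero]
  exact hpy

end TorsionFree

section UniversalCoefficients

open CategoryTheory
open scoped Simplicial

variable (k : Type v) [Field k] {X : Type u} [TopologicalSpace X]

/-- The singular simplices in the singular simplicial set. -/
def singularSimplexEquiv (X : Type u) [TopologicalSpace X] (n : ℕ) :
    (singularSystem X).simplex (n + 1) ≃ (TopCat.toSSet.obj (TopCat.of X)) _⦋n⦌ :=
  (TopCat.toSSetObjEquiv (TopCat.of X) (.op ⦋n⦌)).symm

theorem singularSimplexEquiv_face (n : ℕ) (i : Fin (n + 2))
    (σ : (singularSystem X).simplex (n + 2)) :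
    singularSimplexEquiv X n ((singularSystem X).face i σ) =
      (TopCat.toSSet.obj (TopCat.of X)).δ i (singularSimplexEquiv X (n + 1) σ) := rfl

/-- The evaluation of cochains on chains. -/
def evalCochain (n : ℕ) :
    (singularSystem X).Chain (n + 1) →ₗ[ℤ] SingularCochain k X n →ₗ[k] k :=
  Finsupp.linearCombination ℤ fun σ =>
    LinearMap.proj (R := k) (φ := fun _ => k) (singularSimplexEquiv X n σ)

theorem evalCochain_single (n : ℕ) (σ : (singularSystem X).simplex (n + 1))
    (φ : SingularCochain k X n) :
    evalCochain k n (Finsupp.single σ 1) φ = φ (singularSimplexEquiv X n σ) := by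
  simp [evalCochain]

theorem evalCochain_coboundary (n : ℕ) (x : (singularSystem X).Chain (n + 2))
    (φ : SingularCochain k X n) :
    evalCochain k (n + 1) x (singularCoboundary k X n φ) =
      evalCochain k n ((singularSystem X).d (n + 1) x) φ := by
  let F : (singularSystem X).Chain (n + 2) →ₗ[ℤ] k :=
    (LinearMap.applyₗ (R := k) (singularCoboundary k X n φ)).toAddMonoidHom.toIntLinearMap.comp
      (evalCochain k (n + 1))
  let G : (singularSystem X).Chain (n + 2) →ₗ[ℤ] k :=
    (LinearMap.applyₗ (R := k) φ).toAddMonoidHom.toIntLinearMap.comp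
      ((evalCochain k n).comp ((singularSystem X).d (n + 1)))
  suffices h : F = G from LinearMap.congr_fun h x
  refine Finsupp.lhom_ext' fun σ => LinearMap.ext_ring ?_
  change evalCochain k (n + 1) (Finsupp.single σ 1) (singularCoboundary k X n φ) =
    evalCochain k n ((singularSystem X).d (n + 1) (Finsupp.single σ 1)) φ
  rw [evalCochain_single, FaceSystem.d_single, map_sum, LinearMap.sum_apply]
  change ∑ i : Fin (n + 2), _ = _
  refine Finset.sum_congr rfl fun i _ => ?_
  rw [map_smul, LinearMap.smul_apply, evalCochain_single, singularSimplexEquiv_face]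
  simp

theorem exists_evalCochain_eq (n : ℕ) (g : (singularSystem X).Chain (n + 1) →ₗ[ℤ] k) :
    ∃ φ : SingularCochain k X n, ∀ x, evalCochain k n x φ = g x := by
  let φ : SingularCochain k X n := fun s =>
    g (Finsupp.single ((singularSimplexEquiv X n).symm s) 1)
  let F : (singularSystem X).Chain (n + 1) →ₗ[ℤ] k :=
    (LinearMap.applyₗ (R := k) φ).toAddMonoidHom.toIntLinearMap.comp (evalCochain k n)
  refine ⟨φ, fun x => ?_⟩
  suffices h : F = g from LinearMap.congr_fun h x
  refine Finsupp.lhom_ext' fun σ => LinearMap.ext_ring ?_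
  change evalCochain k n (Finsupp.single σ 1) φ = g (Finsupp.single σ 1)
  rw [evalCochain_single]
  exact congrArg (fun τ => g (Finsupp.single τ 1)) ((singularSimplexEquiv X n).symm_apply_apply σ)

theorem mem_ker_singularCoboundary {n : ℕ} {φ : SingularCochain k X n}
    (h : ∀ x, evalCochain k n ((singularSystem X).d (n + 1) x) φ = 0) :
    φ ∈ LinearMap.ker (singularCoboundary k X n) := by
  rw [LinearMap.mem_ker]
  funext s
  obtain ⟨σ, rfl⟩ := (singularSimplexEquiv X (n + 1)).surjective s
  rw [← evalCochain_single k (n + 1) σ (singularCoboundary k X n φ), evalCochain_coboundary, h]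
  rfl

/-- The evaluation of cohomology classes on cycles. -/
def evalCohomology (n : ℕ) (z : (singularSystem X).cycles (n + 2)) :
    ReducedCohomology k X (n + 1) →ₗ[k] k :=
  Submodule.liftQ _ ((evalCochain k (n + 1) z).comp (Submodule.subtype _)) <| by
    rintro ⟨_, hφ⟩ ⟨ψ, rfl⟩
    change evalCochain k (n + 1) z (singularCoboundary k X n ψ) = 0
    have hz : (singularSystem X).d (n + 1) z = 0 := z.2
    rw [evalCochain_coboundary, hz, map_zero, LinearMap.zero_apply]

end UniversalCoefficients

section ModPrimeCohomology

variable (p : ℕ) [Fact p.Prime] {X : Type u} [TopologicalSpace X]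

/-- Homomorphisms from homology to `ZMod p` give cohomology classes. -/
theorem exists_cohomology_of_linearMap (n : ℕ)
    (f : (singularSystem X).Homology (n + 2) →ₗ[ℤ] ULift.{v} (ZMod p))
    {z : (singularSystem X).cycles (n + 2)} (hz : f ((singularSystem X).toHomology _ z) ≠ 0) :
    ∃ c : ReducedCohomology (ULift.{v} (ZMod p)) X (n + 1),
      evalCohomology (ULift.{v} (ZMod p)) n z c ≠ 0 ∧ ∀ z' : (singularSystem X).cycles (n + 2),
        f ((singularSystem X).toHomology _ z') = 0 → evalCohomology (ULift.{v} (ZMod p)) n z' c = 0 := by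
  -- The quotient of chains by cycles is torsion-free, because it embeds by the boundary map into a
  -- free group.
  obtain ⟨g, hg, hg'⟩ := exists_linearMap_zmod_of_subgroup p
    ((singularSystem X).cycles (n + 2)) (fun c hc => by
      rw [FaceSystem.mem_cycles, map_smul] at hc
      exact (smul_eq_zero_iff_right (by exact_mod_cast (Fact.out : p.Prime).ne_zero)).1 hc)
    (f.comp ((singularSystem X).toHomology _)) hz
  obtain ⟨φ, hφ⟩ := exists_evalCochain_eq (ULift.{v} (ZMod p)) (n + 1) g
  have hker : φ ∈ LinearMap.ker (singularCoboundary (ULift.{v} (ZMod p)) X (n + 1)) :=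
    mem_ker_singularCoboundary _ fun x => by
      rw [hφ]
      refine hg' ⟨_, FaceSystem.dFrom_d _ _ x⟩ ?_
      rw [LinearMap.comp_apply, (FaceSystem.toHomology_eq_zero _).2 ⟨x, rfl⟩, map_zero]
  exact ⟨Submodule.Quotient.mk ⟨φ, hker⟩, (hφ z).trans_ne hg, fun z' hz' => (hφ z').trans (hg' z' hz')⟩

/-- The `p`-torsion in homology gives cohomology classes in the next degree. -/
theorem nontrivial_cohomology_of_torsion (n : ℕ) {y : (singularSystem X).Homology (n + 2)}
    (hy : y ≠ 0) (hpy : (p : ℤ) • y = 0) :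
    Nontrivial (ReducedCohomology (ULift.{v} (ZMod p)) X (n + 2)) := by
  obtain ⟨z, rfl⟩ := FaceSystem.toHomology_surjective _ _ y
  rw [← map_smul, FaceSystem.toHomology_eq_zero] at hpy
  obtain ⟨c, hc⟩ := hpy
  let B := LinearMap.range ((singularSystem X).d (n + 2))
  -- Write pz = dc. If dc were p times a boundary dw, then z = dw, contrary to y ≠ 0. So some g on
  -- boundaries detects dc, and g ∘ d is the cocycle of the Ext class.
  obtain ⟨g, hg⟩ : ∃ g : B →ₗ[ℤ] ULift.{v} (ZMod p), g ⟨_, c, rfl⟩ ≠ 0 :=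
    exists_linearMap_zmod_ne_zero p (by
    rintro ⟨_, w, rfl⟩ hw
    refine hy ((FaceSystem.toHomology_eq_zero _).2 ⟨w, ?_⟩)
    have h1 : (p : ℤ) • (singularSystem X).d (n + 2) w = (p : ℤ) • (z : (singularSystem X).Chain _) :=
      (congrArg Subtype.val hw).trans hc
    exact smul_right_injective _ (by exact_mod_cast (Fact.out : p.Prime).ne_zero) h1)
  obtain ⟨φ, hφ⟩ := exists_evalCochain_eq (ULift.{v} (ZMod p)) (n + 2)
    (g.comp ((singularSystem X).d (n + 2)).rangeRestrict)
  have hker : φ ∈ LinearMap.ker (singularCoboundary (ULift.{v} (ZMod p)) X (n + 2)) :=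
    mem_ker_singularCoboundary _ fun x => by
      rw [hφ, LinearMap.comp_apply, (Subtype.ext (FaceSystem.d_d _ _ x) :
        ((singularSystem X).d (n + 2)).rangeRestrict _ = 0), map_zero]
  refine ⟨Submodule.Quotient.mk ⟨φ, hker⟩, 0, fun h => ?_⟩
  rw [Submodule.Quotient.mk_eq_zero] at h
  obtain ⟨ψ, hψ⟩ := h
  change singularCoboundary _ X (n + 1) ψ = φ at hψ
  -- If the cocycle were δψ, its value on c would be ψ(dc) = ψ(pz) = p ψ(z) = 0.
  have h2 := hφ c
  rw [← hψ, evalCochain_coboundary, hc] at h2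
  refine hg (h2.symm.trans ?_)
  change evalCochain _ (n + 1) ((p : ℤ) • (z : (singularSystem X).Chain _)) ψ = 0
  rw [map_smul, LinearMap.smul_apply, ULift.zmod_zsmul_eq_zero]

end ModPrimeCohomology

end

noncomputable section


/-! ### Consequences of total dimension at most one -/

section TotalDimension

/-- In an at most one-dimensional direct sum, all homogeneous elements are multiples of the same
family. -/
theorem DirectSum.exists_family_of_rank_le_one {ι : Type*} [DecidableEq ι] {k : Type*} [Field k]
    {M : ι → Type*} [∀ i, AddCommGroup (M i)] [∀ i, Module k (M i)]
    (h : Module.rank k (DirectSum ι M) ≤ 1) :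
    ∃ v : ∀ i, M i, ∀ (i : ι) (a : M i), ∃ r : k, r • v i = a ∧ ∀ j, j ≠ i → r • v j = 0 := by
  obtain ⟨v, hv⟩ := (rank_le_one_iff (K := k) (V := DirectSum ι M)).1 h
  refine ⟨fun i => DirectSum.component k ι M i v, fun i a => ?_⟩
  obtain ⟨r, hr⟩ := hv (DirectSum.lof k ι M i a)
  refine ⟨r, ?_, fun j hj => ?_⟩
  · rw [← map_smul, hr, DirectSum.component.lof_self]
  · rw [← map_smul, hr]
    exact DirectSum.of_eq_of_ne _ _ _ hj

variable {k : Type v} [Field k] {X : Type u} [TopologicalSpace X]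

theorem exists_family_cohomology (h : reducedCohomologyDim k X ≤ 1) :
    ∃ v : ∀ n, ReducedCohomology k X n, ∀ (n : ℕ) (a : ReducedCohomology k X n),
      ∃ r : k, r • v n = a ∧ ∀ m, m ≠ n → r • v m = 0 := by
  refine DirectSum.exists_family_of_rank_le_one (k := k) (M := fun n => ReducedCohomology k X n) ?_
  exact h

/-- For m ≠ n, a scalar producing a nonzero class in degree m kills the component of the spanning
family in degree n. The scalar is nonzero, so that component vanishes and degree n has no classes.
-/
theorem eq_of_nontrivial_cohomology (h : reducedCohomologyDim k X ≤ 1) {m n : ℕ}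
    (hm : Nontrivial (ReducedCohomology k X m)) (hn : Nontrivial (ReducedCohomology k X n)) :
    m = n := by
  obtain ⟨v, hv⟩ := exists_family_cohomology h
  obtain ⟨a, ha⟩ := exists_ne (0 : ReducedCohomology k X m)
  obtain ⟨b, hb⟩ := exists_ne (0 : ReducedCohomology k X n)
  obtain ⟨r, rfl, hr⟩ := hv m a
  obtain ⟨s, rfl, -⟩ := hv n b
  by_contra hmn
  rcases smul_eq_zero.1 (hr n (Ne.symm hmn)) with h0 | h0
  · exact ha (by rw [h0, zero_smul])
  · exact hb (by rw [h0, smul_zero])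

theorem exists_smul_of_cohomology (h : reducedCohomologyDim k X ≤ 1) {n : ℕ}
    (a b : ReducedCohomology k X n) :
    ∃ (c : ReducedCohomology k X n) (r s : k), r • c = a ∧ s • c = b := by
  obtain ⟨v, hv⟩ := exists_family_cohomology h
  obtain ⟨r, hr, -⟩ := hv n a
  obtain ⟨s, hs, -⟩ := hv n b
  exact ⟨v n, r, s, hr, hs⟩

end TotalDimension

section Homology

variable {X : Type u} [TopologicalSpace X]

theorem nontrivial_cohomology_of_linearMap (p : ℕ) [Fact p.Prime] {n : ℕ}
    {x : (singularSystem X).Homology (n + 2)}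
    {f : (singularSystem X).Homology (n + 2) →ₗ[ℤ] ULift.{v} (ZMod p)} (hf : f x ≠ 0) :
    Nontrivial (ReducedCohomology (ULift.{v} (ZMod p)) X (n + 1)) := by
  obtain ⟨z, rfl⟩ := FaceSystem.toHomology_surjective _ _ x
  obtain ⟨c, hc, -⟩ := exists_cohomology_of_linearMap p n f hf
  exact ⟨c, 0, fun h => hc (by rw [h, map_zero])⟩

variable [∀ k, Module.Finite ℤ ((singularSystem X).Homology k)]
  (hdim : ∀ (k : Type v) [Field k], reducedCohomologyDim k X ≤ 1)

include hdim

/-- Torsion of order p in degree n + 1 produces classes mod p in two degrees: n + 1 through Hom, by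
finite generation, and n + 2 through Ext. -/
theorem isTorsionFree_homology (n : ℕ) :
    Module.IsTorsionFree ℤ ((singularSystem X).Homology (n + 2)) := by
  refine isTorsionFree_of_forall_prime fun p hp y hpy => by_contra fun hy => ?_
  have : Fact p.Prime := ⟨hp⟩
  obtain ⟨x, f, hf⟩ : ∃ (x : (singularSystem X).Homology (n + 2))
      (f : (singularSystem X).Homology (n + 2) →ₗ[ℤ] ULift.{v} (ZMod p)), f x ≠ 0 :=
    exists_linearMap_zmod_of_torsion p hy hpy
  have h1 := nontrivial_cohomology_of_linearMap p hf
  have h2 := nontrivial_cohomology_of_torsion p n hy hpy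
  have h3 := eq_of_nontrivial_cohomology (hdim (ULift.{v} (ZMod p))) h1 h2
  omega

/-- A basis vector of homology and its coordinate function modulo two. -/
theorem exists_linearMap_zmod_two {n : ℕ} (hn : Nontrivial ((singularSystem X).Homology (n + 2))) :
    ∃ (x : (singularSystem X).Homology (n + 2))
      (f : (singularSystem X).Homology (n + 2) →ₗ[ℤ] ULift.{v} (ZMod 2)), f x ≠ 0 := by
  have := isTorsionFree_homology hdim n
  let b := Module.Free.chooseBasis ℤ ((singularSystem X).Homology (n + 2))
  obtain ⟨i⟩ := b.index_nonempty
  exact ⟨b i, b.constr ℤ fun _ => 1, by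
    rw [Module.Basis.constr_basis]
    exact one_ne_zero⟩

theorem eq_of_nontrivial_homology {m n : ℕ}
    (hm : Nontrivial ((singularSystem X).Homology (m + 2)))
    (hn : Nontrivial ((singularSystem X).Homology (n + 2))) : m = n := by
  obtain ⟨x, f, hf⟩ := exists_linearMap_zmod_two hdim hm
  obtain ⟨y, g, hg⟩ := exists_linearMap_zmod_two hdim hn
  exact Nat.succ_injective (eq_of_nontrivial_cohomology (hdim (ULift.{v} (ZMod 2)))
    (nontrivial_cohomology_of_linearMap 2 hf) (nontrivial_cohomology_of_linearMap 2 hg))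

/-- Two distinct basis vectors would have independent coordinate functions mod 2, hence independent
cohomology classes in one degree. -/
theorem nonempty_homology_equiv_of_nontrivial {n : ℕ}
    (hn : Nontrivial ((singularSystem X).Homology (n + 2))) :
    Nonempty ((singularSystem X).Homology (n + 2) ≃ₗ[ℤ] ℤ) := by
  have := isTorsionFree_homology hdim n
  let b := Module.Free.chooseBasis ℤ ((singularSystem X).Homology (n + 2))
  obtain ⟨i⟩ := b.index_nonempty
  suffices h : Subsingleton (Module.Free.ChooseBasisIndex ℤ ((singularSystem X).Homology (n + 2))) by
    exact ⟨b.repr.trans (Finsupp.uniqueLinearEquiv ℤ ℤ i)⟩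
  refine ⟨fun i j => by_contra fun hij => ?_⟩
  classical
  let f (i) : (singularSystem X).Homology (n + 2) →ₗ[ℤ] ULift.{v} (ZMod 2) :=
    b.constr ℤ (Pi.single i 1)
  have hf (i) : f i (b i) ≠ 0 := by
    rw [Module.Basis.constr_basis, Pi.single_eq_same]
    exact one_ne_zero
  have hf' {i j} (h : j ≠ i) : f i (b j) = 0 := by
    rw [Module.Basis.constr_basis, Pi.single_eq_of_ne h]
  choose z hz using fun i => FaceSystem.toHomology_surjective _ _ (b i)
  obtain ⟨c, hc, hc'⟩ := exists_cohomology_of_linearMap 2 n (f i) (z := z i) (by rw [hz]; exact hf i)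
  obtain ⟨c₂, hc₂, hc₂'⟩ := exists_cohomology_of_linearMap 2 n (f j) (z := z j)
    (by rw [hz]; exact hf j)
  -- Both classes are multiples r w and t w. The first vanishes on z j, so r = 0 or w vanishes on z
  -- j, making one of the two classes vanish where it should not.
  obtain ⟨w, r, t, rfl, rfl⟩ := exists_smul_of_cohomology (hdim (ULift.{v} (ZMod 2))) c c₂
  have h1 := hc' (z j) (by rw [hz]; exact hf' (Ne.symm hij))
  rw [map_smul, smul_eq_mul] at hc hc₂ h1
  rcases mul_eq_zero.1 h1 with h0 | h0
  · exact hc (by rw [h0, zero_mul])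
  · exact hc₂ (by rw [h0, mul_zero])

end Homology

end

noncomputable section


theorem Finsupp.linearCombination_single_one {R α M : Type*} [Ring R] [AddCommGroup M] [Module R M]
    (v : α → M) (a : α) : Finsupp.linearCombination R v (Finsupp.single a 1) = v a := by
  rw [Finsupp.linearCombination_single, one_smul]

/-! ### Comparison with the categorical singular homology -/

section Comparison

open CategoryTheory AlgebraicTopology Limits
open scoped Simplicial

variable (X : Type u) [TopologicalSpace X]

/-- The chain complex computing the integral homology. -/
abbrev integralChainComplex : ChainComplex (ModuleCat.{u} ℤ) ℕ :=
  (TopCat.toSSet.obj (TopCat.of X)).chainComplex (ModuleCat.of ℤ (ULift.{u} ℤ))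

/-- The map from the coproduct of copies of `ℤ` to the free abelian group on simplices. -/
def toSingularChain (n : ℕ) :
    (integralChainComplex X).X n ⟶ ModuleCat.of ℤ ((singularSystem X).Chain (n + 1)) :=
  Cofan.IsColimit.desc ((TopCat.toSSet.obj (TopCat.of X)).isColimitChainComplexXCofan _ n) fun s =>
    ModuleCat.ofHom ((Finsupp.lsingle ((singularSimplexEquiv X n).symm s)).comp
      (ULift.moduleEquiv (R := ℤ) (M := ℤ)).toLinearMap)

theorem ι_toSingularChain (n : ℕ) (s : (TopCat.toSSet.obj (TopCat.of X)) _⦋n⦌) :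
    (TopCat.toSSet.obj (TopCat.of X)).ιChainComplex s ≫ toSingularChain X n =
      ModuleCat.ofHom ((Finsupp.lsingle ((singularSimplexEquiv X n).symm s)).comp
        (ULift.moduleEquiv (R := ℤ) (M := ℤ)).toLinearMap) :=
  Cofan.IsColimit.fac _ _ _

variable {X} in
/-- The chain given by a single simplex. -/
def simplexChain {n : ℕ} (s : (TopCat.toSSet.obj (TopCat.of X)) _⦋n⦌) :
    (integralChainComplex X).X n :=
  ((TopCat.toSSet.obj (TopCat.of X)).ιChainComplex (R := ModuleCat.of ℤ (ULift.{u} ℤ)) s).hom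
    (⟨1⟩ : ULift.{u} ℤ)

theorem toSingularChain_simplexChain (n : ℕ) (s : (TopCat.toSSet.obj (TopCat.of X)) _⦋n⦌) :
    (toSingularChain X n).hom (simplexChain s) =
      Finsupp.single ((singularSimplexEquiv X n).symm s) 1 :=
  LinearMap.congr_fun (congrArg ModuleCat.Hom.hom (ι_toSingularChain X n s)) (⟨1⟩ : ULift.{u} ℤ)

theorem d_simplexChain (n : ℕ) (s : (TopCat.toSSet.obj (TopCat.of X)) _⦋n + 1⦌) :
    ((integralChainComplex X).d (n + 1) n).hom (simplexChain s) =
      ∑ i : Fin (n + 2), (-1 : ℤ) ^ (i : ℕ) •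
        simplexChain ((TopCat.toSSet.obj (TopCat.of X)).δ i s) := by
  refine (LinearMap.congr_fun (congrArg ModuleCat.Hom.hom
    ((TopCat.toSSet.obj (TopCat.of X)).ιChainComplex_d (R := ModuleCat.of ℤ (ULift.{u} ℤ)) s))
      (⟨1⟩ : ULift.{u} ℤ)).trans ?_
  rw [ModuleCat.hom_sum, LinearMap.sum_apply]
  exact Finset.sum_congr rfl fun i _ => rfl

/-- The inverse of `toSingularChain`. -/
def ofSingularChain (n : ℕ) :
    ModuleCat.of ℤ ((singularSystem X).Chain (n + 1)) ⟶ (integralChainComplex X).X n :=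
  ModuleCat.ofHom (Finsupp.linearCombination ℤ fun σ => simplexChain (singularSimplexEquiv X n σ))

theorem ofSingularChain_single (n : ℕ) (σ : (singularSystem X).simplex (n + 1)) :
    (ofSingularChain X n).hom (Finsupp.single σ 1) = simplexChain (singularSimplexEquiv X n σ) :=
  Finsupp.linearCombination_single_one _ σ

theorem integralChainComplex_hom_ext {n : ℕ} {M : ModuleCat.{u} ℤ}
    {f g : (integralChainComplex X).X n ⟶ M}
    (h : ∀ s, f.hom (simplexChain s) = g.hom (simplexChain s)) : f = g := by
  refine SSet.chainComplex_hom_ext fun s => ModuleCat.hom_ext ?_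
  have (F G : ULift.{u} ℤ →ₗ[ℤ] M) (hFG : F ⟨1⟩ = G ⟨1⟩) : F = G := by
    refine LinearMap.ext fun a => ?_
    have ha : a = a.down • (⟨1⟩ : ULift.{u} ℤ) := ULift.ext _ _ (by simp)
    rw [ha, map_zsmul, map_zsmul, hFG]
  exact this _ _ (h s)

theorem singularChain_hom_ext {k : ℕ} {M : ModuleCat.{u} ℤ}
    {f g : ModuleCat.of ℤ ((singularSystem X).Chain k) ⟶ M}
    (h : ∀ σ, f.hom (Finsupp.single σ 1) = g.hom (Finsupp.single σ 1)) : f = g :=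
  ModuleCat.hom_ext (Finsupp.lhom_ext' fun σ => LinearMap.ext_ring (h σ))

/-- The comparison of the two models of the singular chains. -/
def singularChainIso (n : ℕ) :
    (integralChainComplex X).X n ≅ ModuleCat.of ℤ ((singularSystem X).Chain (n + 1)) where
  hom := toSingularChain X n
  inv := ofSingularChain X n
  hom_inv_id := integralChainComplex_hom_ext X fun s => by
    change (ofSingularChain X n).hom ((toSingularChain X n).hom _) = simplexChain s
    rw [toSingularChain_simplexChain, ofSingularChain_single, Equiv.apply_symm_apply]
  inv_hom_id := singularChain_hom_ext X fun σ => by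
    change (toSingularChain X n).hom ((ofSingularChain X n).hom _) = Finsupp.single σ 1
    rw [ofSingularChain_single, toSingularChain_simplexChain, Equiv.symm_apply_apply]

theorem toSingularChain_d (n : ℕ) :
    toSingularChain X (n + 1) ≫ ModuleCat.ofHom ((singularSystem X).d (n + 1)) =
      (integralChainComplex X).d (n + 1) n ≫ toSingularChain X n := by
  refine integralChainComplex_hom_ext X fun s => ?_
  obtain ⟨σ, rfl⟩ := (singularSimplexEquiv X (n + 1)).surjective s
  change (singularSystem X).d (n + 1) ((toSingularChain X (n + 1)).hom _) =
    (toSingularChain X n).hom (((integralChainComplex X).d (n + 1) n).hom _)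
  rw [d_simplexChain, toSingularChain_simplexChain, Equiv.symm_apply_apply, FaceSystem.d_single,
    map_sum]
  refine Finset.sum_congr rfl fun i _ => ?_
  rw [map_zsmul, toSingularChain_simplexChain, ← singularSimplexEquiv_face, Equiv.symm_apply_apply]

/-- Two consecutive differentials of the augmented singular chain complex. -/
def singularShortComplex (k : ℕ) : ShortComplex (ModuleCat.{u} ℤ) :=
  ShortComplex.moduleCatMk ((singularSystem X).d (k + 1)) ((singularSystem X).d k)
    (LinearMap.ext fun x => (singularSystem X).d_d k x)

/-- The comparison of the two models of integral homology in positive degrees. -/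
def integralHomologyIso (n : ℕ) :
    integralHomology (n + 1) (TopCat.of X) ≅ (singularShortComplex X (n + 1)).homology :=
  -- Degree n + 1 involves only chain degrees n, n + 1 and n + 2, where the augmented and the
  -- unaugmented complexes coincide.
  (integralChainComplex X).homologyIsoSc' (n + 2) (n + 1) n (by simp) (by simp) ≪≫
    ShortComplex.homologyMapIso (ShortComplex.isoMk (singularChainIso X (n + 2))
      (singularChainIso X (n + 1)) (singularChainIso X n) (toSingularChain_d X (n + 1))
      (toSingularChain_d X n))

theorem nonempty_integralHomology_equiv (n : ℕ) :
    Nonempty (integralHomology (n + 1) (TopCat.of X) ≃+ (singularSystem X).Homology (n + 2)) := by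
  let S := singularShortComplex X (n + 1)
  have h : LinearMap.range S.moduleCatToCycles =
      (LinearMap.range ((singularSystem X).d (n + 2))).submoduleOf
        ((singularSystem X).cycles (n + 2)) := by
    ext z
    exact ⟨fun ⟨w, hw⟩ => ⟨w, congrArg Subtype.val hw⟩, fun ⟨w, hw⟩ => ⟨w, Subtype.ext hw⟩⟩
  let e : integralHomology (n + 1) (TopCat.of X) ≃ₗ[ℤ]
      (LinearMap.ker S.g.hom ⧸ LinearMap.range S.moduleCatToCycles) :=
    (integralHomologyIso X n ≪≫ S.moduleCatHomologyIso).toLinearEquiv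
  let e' : (LinearMap.ker S.g.hom ⧸ LinearMap.range S.moduleCatToCycles) ≃ₗ[ℤ]
      (singularSystem X).Homology (n + 2) := Submodule.quotEquivOfEq _ _ h
  exact ⟨e.toAddEquiv.trans e'.toAddEquiv⟩

end Comparison

/-! ### Degree zero and spheres -/

section DegreeZero

open CategoryTheory AlgebraicTopology

theorem nonempty_integralHomology_zero_equiv (X : TopCat.{u}) [PathConnectedSpace X] :
    Nonempty (integralHomology 0 X ≃ₗ[ℤ] ULift.{u} ℤ) :=
  ⟨(asIso (X.singularHomology₀ε (ModuleCat.of ℤ (ULift.{u} ℤ)))).toLinearEquiv⟩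

theorem integralHomologyMap_comp (n : ℕ) {X Y Z : TopCat.{u}} (f : X ⟶ Y) (g : Y ⟶ Z) :
    integralHomologyMap n (f ≫ g) = integralHomologyMap n f ≫ integralHomologyMap n g :=
  CategoryTheory.Functor.map_comp _ _ _

theorem integralHomologyMap_id (n : ℕ) (X : TopCat.{u}) :
    integralHomologyMap n (𝟙 X) = 𝟙 (integralHomology n X) :=
  CategoryTheory.Functor.map_id _ _

/-- A point of X splits H_0(X) → H_0(pt), so this map is onto. Both groups are abstractly ℤ, and a
surjective endomorphism of a Noetherian module is injective; the map itself need not be computed. -/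
theorem reducedIntegralHomology_zero (X : TopCat.{u}) [PathConnectedSpace X] :
    reducedIntegralHomology 0 X = ⊥ := by
  let P : TopCat.{u} := TopCat.of PUnit.{u + 1}
  let f : X ⟶ P := TopCat.ofHom (ContinuousMap.const X PUnit.unit)
  let s : P ⟶ X := TopCat.ofHom (ContinuousMap.const PUnit.{u + 1} (Classical.arbitrary X))
  have hs : s ≫ f = 𝟙 P := rfl
  obtain ⟨a⟩ := nonempty_integralHomology_zero_equiv X
  have : PathConnectedSpace P := inferInstanceAs (PathConnectedSpace PUnit.{u + 1})
  obtain ⟨b⟩ := nonempty_integralHomology_zero_equiv P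
  have hsurj : Function.Surjective (integralHomologyMap 0 f).hom := fun y =>
    ⟨(integralHomologyMap 0 s).hom y, by
      have := integralHomologyMap_comp 0 s f
      rw [hs, integralHomologyMap_id] at this
      exact LinearMap.congr_fun (congrArg ModuleCat.Hom.hom this.symm) y⟩
  have : IsNoetherian ℤ (integralHomology 0 X) := isNoetherian_of_linearEquiv
    (ULift.moduleEquiv.symm.trans a.symm : ℤ ≃ₗ[ℤ] integralHomology 0 X)
  have hinj := IsNoetherian.injective_of_surjective_endomorphism
    (((b.trans a.symm).toLinearMap).comp (integralHomologyMap 0 f).hom)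
    ((b.trans a.symm).surjective.comp hsurj)
  refine LinearMap.ker_eq_bot.2 fun x y hxy => hinj ?_
  exact congrArg (b.trans a.symm) hxy

end DegreeZero

section Sphere

theorem pathConnectedSpace_sphere {n : ℕ} (hn : 1 ≤ n) :
    PathConnectedSpace (TopCat.sphere.{u} n) := by
  have h : IsPathConnected (Metric.sphere (0 : EuclideanSpace ℝ (Fin (n + 1))) 1) :=
    isPathConnected_sphere (by
      rw [← Module.finrank_eq_rank, finrank_euclideanSpace_fin]
      exact_mod_cast Nat.lt_add_of_pos_left hn) 0 zero_le_one
  have := isPathConnected_iff_pathConnectedSpace.1 h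
  exact Homeomorph.ulift.symm.surjective.pathConnectedSpace Homeomorph.ulift.symm.continuous

theorem homology_sphere (n k : ℕ) :
    (k = n + 1 → Nonempty (integralHomology k (TopCat.sphere.{u} (n + 1)) ≃+ ℤ)) ∧
      (k ≠ n + 1 → 1 ≤ k → Subsingleton (integralHomology k (TopCat.sphere.{u} (n + 1)))) := by
  cases k with
  | zero => exact ⟨fun h => absurd h (by omega), fun _ h => absurd h (by omega)⟩
  | succ k =>
    let E := EuclideanSpace ℝ (Fin (n + 2))
    obtain ⟨e⟩ := nonempty_integralHomology_equiv
      (ULift.{u} (Metric.sphere (0 : EuclideanSpace ℝ (Fin (n + 2))) 1)) k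
    obtain ⟨f⟩ := nonempty_sphere_homotopyEquiv (E := E)
    let g := e.trans (homologyEquiv (Homeomorph.ulift.toHomotopyEquiv.trans f) (k + 2)).toAddEquiv
    -- The sphere of dimension n + 1 is the punctured space of dimension n + 2 up to homotopy, and
    -- degree k + 1 is index k + 2.
    obtain ⟨h1, h2⟩ := homology_compl_zero (n + 2) E finrank_euclideanSpace_fin (k + 2)
    refine ⟨fun hk => ?_, fun hk _ => ?_⟩
    · obtain ⟨i⟩ := h1 (by omega)
      exact ⟨g.trans i.toAddEquiv⟩
    · have := h2 (by omega)
      exact g.toEquiv.subsingleton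

end Sphere

end

/-! ### The dichotomy -/

theorem mainTheorem6 (X : Type u) [TopologicalSpace X] [T2Space X]
    [PathConnectedSpace X] [Topology.CWComplex (Set.univ : Set X)]
    [Topology.CWComplex.FiniteType (Set.univ : Set X)]
    (hdim : ∀ (k : Type v) [Field k], reducedCohomologyDim k X ≤ 1) :
    IsAcyclicSpace X ∨ IsIntegralHomologySphere X := by
  have hfin (k : ℕ) : Module.Finite ℤ ((singularSystem X).Homology k) :=
    Topology.CWComplex.finite_homology k
  have hX : PathConnectedSpace (TopCat.of X) := inferInstanceAs (PathConnectedSpace X)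
  -- Index m + 2 is degree m + 1, so the question is whether some homology in positive degree
  -- survives; if so, the sphere has dimension m + 1.
  by_cases h : ∃ m, Nontrivial ((singularSystem X).Homology (m + 2))
  · obtain ⟨m, hm⟩ := h
    refine Or.inr ⟨m + 1, Nat.succ_pos m, fun i => ?_⟩
    cases i with
    | zero =>
      have := pathConnectedSpace_sphere.{u} (Nat.succ_pos m)
      obtain ⟨a⟩ := nonempty_integralHomology_zero_equiv (TopCat.of X)
      obtain ⟨b⟩ := nonempty_integralHomology_zero_equiv (TopCat.sphere.{u} (m + 1))
      exact ⟨(a.trans b.symm).toAddEquiv⟩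
    | succ i =>
      obtain ⟨e⟩ := nonempty_integralHomology_equiv X i
      obtain ⟨h1, h2⟩ := homology_sphere.{u} m (i + 1)
      rcases eq_or_ne i m with rfl | hi
      · obtain ⟨f⟩ := nonempty_homology_equiv_of_nontrivial hdim hm
        obtain ⟨g⟩ := h1 rfl
        exact ⟨(e.trans f.toAddEquiv).trans g.symm⟩
      · have hs := h2 (by omega) (Nat.succ_pos i)
        have hs' : Subsingleton ((singularSystem X).Homology (i + 2)) :=
          not_nontrivial_iff_subsingleton.1 fun hn => hi (eq_of_nontrivial_homology hdim hn hm)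
        have := e.toEquiv.subsingleton
        exact ⟨
          { toFun := 0
            invFun := 0
            left_inv := fun _ => Subsingleton.elim _ _
            right_inv := fun _ => Subsingleton.elim _ _
            map_add' := fun _ _ => Subsingleton.elim _ _ }⟩
  · refine Or.inl ⟨inferInstance, fun n => ?_⟩
    cases n with
    | zero => exact reducedIntegralHomology_zero (TopCat.of X)
    | succ n =>
      obtain ⟨e⟩ := nonempty_integralHomology_equiv X n
      have : Subsingleton ((singularSystem X).Homology (n + 2)) :=
        not_nontrivial_iff_subsingleton.1 fun hn => h ⟨n, hn⟩
      have := e.toEquiv.subsingleton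
      exact eq_bot_iff.2 fun x _ => Subsingleton.elim x 0
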